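/- An $r$-partite graph is a finite simple graph whose vertex set is partitioned into $r$ (possibly empty) independent sets $V_1,\dots,V_r$, its parts. For $t\ge 1$, a $t$-IT of such a graph is an independent set of $t$ vertices that has at most one vertex in each part. For integers $1\le D\le r$ and $\Delta\ge 0$, let $n(r,D,\Delta)$ be the largest integer $n\ge 0$ such that there is an $r$-partite graph with at least $n$ vertices in each part, with maximum degree $\Delta$, and without an $(r-D+1)$-IT. For integers $n\ge 0$ and $2\le t\le r$, let $f(n,r,t)$ be the largest minimum degree among all $r$-partite graphs with exactly $n$ vertices in each part and without a copy of the complete graph $K_t$. (The graph without vertices has maximum and minimum degree $0$.) Let $r,d,q,k$ be non-negative integers with $r=q(d+1)+k$ and $0\le k\le d$, and suppose that $q$ is odd and $q\ge 6d+6k+7$. Then, for every integer $\Delta\ge 0$, the number $n(r,d+1,\Delta)$ is well defined (the largest $n$ exists) and $$n(r,d+1,\Delta)=\left\lfloor 2\Delta\left(1-\frac1{q-1}\right)\right\rfloor ,$$ and, equivalently, for every integer $n\ge 0$, the number $f(n,r,r-d)$ is well defined and $$f(n,r,r-d)=(r-1)n-\left\lceil \frac{(q-1)n}{2(q-2)}\right\rceil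 .$$ -/

import Mathlib

namespace PartialIT

/-- An `r`-partite graph with its parts `V_1, …, V_r` is a graph `G` together with a proper
colouring `c : G.Coloring (Fin r)`; the part `V_i` is the colour class `c.colorClass i`
(parts may be empty).  The set `S` is an independent `t`-transversal (a `t`-IT): an independent set
consisting of one vertex in each of `t` different parts. -/
def IsIT {V : Type*} {G : SimpleGraph V} {r : ℕ} (c : G.Coloring (Fin r)) (t : ℕ)
    (S : Finset V) : Prop :=
  G.IsIndepSet (S : Set V) ∧ Set.InjOn c (S : Set V) ∧ S.card = t

open Classical in
/-- The set of all `n` for which there is a finite `r`-partite graph with at least `n` vertices in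
each part, with maximum degree `Δ`, and without an `(r - D + 1)`-IT (used for `D ≤ r`). -/
def partSizes (r D Δ : ℕ) : Set ℕ :=
  {n | ∃ (V : Type) (_ : Fintype V) (G : SimpleGraph V) (c : G.Coloring (Fin r)),
    (∀ i, n ≤ (c.colorClass i).ncard) ∧ G.maxDegree = Δ ∧
      ¬ ∃ S : Finset V, IsIT c (r + 1 - D) S}

/-- The extremal function `n(r, D, Δ)`: the largest element of `partSizes r D Δ`. -/
noncomputable def nMax (r D Δ : ℕ) : ℕ := sSup (partSizes r D Δ)

open Classical in
/-- The set of minimum degrees of all `r`-partite graphs with exactly `n` vertices in each part and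
without a copy of the complete graph `K_t`. -/
def minDegrees (n r t : ℕ) : Set ℕ :=
  {δ | ∃ (V : Type) (_ : Fintype V) (G : SimpleGraph V) (c : G.Coloring (Fin r)),
    (∀ i, (c.colorClass i).ncard = n) ∧ G.CliqueFree t ∧ G.minDegree = δ}

/-- The extremal function `f(n, r, t)`: the largest element of `minDegrees n r t`. -/
noncomputable def fMax (n r t : ℕ) : ℕ := sSup (minDegrees n r t)

end PartialIT

/-! Write `q = 2h + 1`. Both formulas say that the threshold is `n h + Δ ≤ 2 Δ h`, that is, `n ≤ (2
- 1/h) Δ`. The statement on `f` is the same one seen in the complement inside the complete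
multipartite graph, where independent transversals become cliques and maximum degree becomes minimum
degree.

Upper bound (`Counter.false`). Suppose that the parts are larger and that every independent
transversal misses more than `d` parts. Haxell's argument (`exists_closed`) adds stars to a partial
structure until the parts reached are dominated. Counting shows that all these stars are single
edges. The outcome is an induced matching that dominates its parts and contracts to a forest of `d +
1` trees on them; a tree on `s` parts has `2(s - 1)` vertices. In such a forest covering as many
parts as possible, an end of an edge may be exchanged for a private neighbour of the other end
(`Counter.swap`), and each tree dominates its own parts (`Counter.dom_tree`). Counting gives `s ≥ 2h
+ 1` for each tree, and since `r < (2h + 2)(d + 1)`, some tree has exactly `2h + 1` parts. These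
parts have a full transversal (`exists_full_of_odd`), which can be rerouted so that it has few
neighbours outside (`SwapClass.exists_small_out`). The deficiency form of Haxell's theorem
(`exists_outer`) then extends it over the other parts with at most `d` of them missed, a
contradiction.

Odd case (`exists_full_of_odd`). In an edge-minimal counterexample on `2h + 1` parts, every edge
lies in a tree matching that spans and dominates all parts. The domination count is almost tight:
each matching vertex has more than `2Δ/3` private neighbours, and in fact every vertex has exactly
one neighbour in the matching (`Critical.nbr_unique`). Some matching edge `ab` cuts the parts into
two sides in such a way that the private neighbours of all other matching vertices stay on the side
of that vertex (`Critical.exists_top`). A side with `s` parts is then dominated by `2s - 1`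
vertices, which forces `s ≥ h + 1`; two such sides need `2h + 2` parts.

Lower bound (`extGraph`). There are `d + 1` pairs of sides with `h` parts each, and `d + 1 + k`
parts of isolated vertices. In each side a stream of `h` blocks of `Δ` vertices is spread over the
parts, and every block after the first is completely joined to a further block of `Δ` vertices lying
in one of the earlier parts. A transversal of a side is thereby driven down to the first block of
its stream; the first blocks of paired sides are completely joined, so every pair misses a part. -/

namespace PartialIT

open Finset
open scoped Classical

variable {V P : Type*}

/-! ### Induced matchings that contract to trees. -/

/-- `M` is an independent set of `G` with exactly one vertex in each part of `T`. -/
def FullIT (G : SimpleGraph V) (c : V → P) (T : Finset P) (M : Finset V) : Prop :=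
  (∀ v ∈ M, ∀ w ∈ M, ¬ G.Adj v w) ∧ Set.InjOn c (M : Set V) ∧ M.image c = T

/-- An induced matching with vertex set `D` whose contraction to the parts is a tree on `C`. -/
structure IMC (G : SimpleGraph V) (c : V → P) (C : Finset P) (D : Finset V) : Prop where
  color : ∀ v ∈ D, c v ∈ C
  pair : ∀ v ∈ D, ∃ w ∈ D, G.Adj v w ∧ ∀ x ∈ D, G.Adj v x → x = w
  card : D.card + 2 = 2 * C.card
  conn : ∀ φ : P → ZMod 2, (∀ v ∈ D, ∀ w ∈ D, G.Adj v w → φ (c v) = φ (c w)) →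
    ∀ p ∈ C, ∀ p' ∈ C, φ p = φ p'

theorem card_image_pair (D : Finset V) (p : V → V) (hp : ∀ v ∈ D, p v ∈ D)
    (hpp : ∀ v ∈ D, p (p v) = v) (hne : ∀ v ∈ D, p v ≠ v) :
    D.card = 2 * (D.image (fun v => ({v, p v} : Finset V))).card := by
  rw [Finset.card_eq_sum_card_image (fun v => ({v, p v} : Finset V)) D]
  rw [Finset.sum_const_nat (m := 2), mul_comm]
  intro e he
  obtain ⟨v, hv, rfl⟩ := Finset.mem_image.1 he
  have : D.filter (fun w => ({w, p w} : Finset V) = {v, p v}) = {v, p v} := by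
    ext w
    simp only [Finset.mem_filter, Finset.mem_insert, Finset.mem_singleton]
    constructor
    · rintro ⟨_, h⟩
      have : w ∈ ({w, p w} : Finset V) := by simp
      rw [h] at this
      simpa using this
    · rintro (rfl | rfl)
      · exact ⟨hv, rfl⟩
      · refine ⟨hp v hv, ?_⟩
        rw [hpp v hv, Finset.pair_comm]
  rw [this, Finset.card_pair (hne v hv).symm]

/-- There are fewer matching edges than parts in `A`, so the linear map over the field of two
elements that sends a function on `A` to its differences along the edges has a nonzero kernel. Such
potentials replace all arguments with paths and components. -/
theorem exists_potential (c : V → P) (D : Finset V) (p : V → V) (hp : ∀ v ∈ D, p v ∈ D)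
    (hpp : ∀ v ∈ D, p (p v) = v) (hne : ∀ v ∈ D, p v ≠ v) (A : Finset P)
    (h : D.card < 2 * A.card) :
    ∃ ψ : P → ZMod 2, (∃ x ∈ A, ψ x ≠ 0) ∧ (∀ x, x ∉ A → ψ x = 0) ∧
      ∀ v ∈ D, ψ (c v) = ψ (c (p v)) := by
  set E := D.image (fun v => ({v, p v} : Finset V)) with hE
  have hcard := card_image_pair D p hp hpp hne
  rw [← hE] at hcard
  have hrep : ∀ e : {e // e ∈ E}, ∃ v ∈ D, ({v, p v} : Finset V) = e.1 := fun e => by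
    obtain ⟨v, hv, h⟩ := Finset.mem_image.1 e.2
    exact ⟨v, hv, h⟩
  choose rep hrepD hrep using hrep
  let ext : ({x // x ∈ A} → ZMod 2) →ₗ[ZMod 2] (P → ZMod 2) :=
    { toFun := fun φ x => if hx : x ∈ A then φ ⟨x, hx⟩ else 0
      map_add' := by
        intro a b; ext x; by_cases hx : x ∈ A <;> simp [hx]
      map_smul' := by
        intro a b; ext x; by_cases hx : x ∈ A <;> simp [hx] }
  let L : ({x // x ∈ A} → ZMod 2) →ₗ[ZMod 2] ({e // e ∈ E} → ZMod 2) :=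
    { toFun := fun φ e => ext φ (c (rep e)) - ext φ (c (p (rep e)))
      map_add' := by
        intro a b; ext e; simp only [map_add, Pi.add_apply]; ring
      map_smul' := by
        intro a b; ext e; simp only [map_smul, Pi.smul_apply, smul_eq_mul, RingHom.id_apply]; ring }
  have hker : LinearMap.ker L ≠ ⊥ := by
    apply LinearMap.ker_ne_bot_of_finrank_lt
    simp only [Module.finrank_fintype_fun_eq_card, Fintype.card_coe]
    omega
  obtain ⟨φ, hφ, hφ0⟩ := (Submodule.ne_bot_iff _).1 hker
  have hφ' : ∀ e, ext φ (c (rep e)) = ext φ (c (p (rep e))) := fun e =>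
    sub_eq_zero.1 (congrFun (LinearMap.mem_ker.1 hφ) e)
  refine ⟨ext φ, ?_, ?_, ?_⟩
  · by_contra hcon
    push Not at hcon
    apply hφ0
    ext x
    have := hcon x.1 x.2
    simpa [ext, x.2] using this
  · intro x hx
    simp [ext, hx]
  · intro v hv
    have he : ({v, p v} : Finset V) ∈ E := Finset.mem_image.2 ⟨v, hv, rfl⟩
    have h1 := hrep ⟨_, he⟩
    have h2 := hφ' ⟨_, he⟩
    have h3 : rep ⟨_, he⟩ ∈ ({v, p v} : Finset V) := by
      have : rep ⟨_, he⟩ ∈ ({rep ⟨_, he⟩, p (rep ⟨_, he⟩)} : Finset V) := by simp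
      rwa [h1] at this
    rcases Finset.mem_insert.1 h3 with h4 | h4
    · rw [h4] at h2; exact h2
    · rw [Finset.mem_singleton.1 h4, hpp v hv] at h2; exact h2.symm

namespace IMC

variable {G : SimpleGraph V} {c : V → P} {C : Finset P} {D : Finset V}

theorem exists_partner (h : IMC G c C D) : ∃ p : V → V, (∀ v ∈ D, p v ∈ D) ∧
    (∀ v ∈ D, G.Adj v (p v)) ∧ (∀ v ∈ D, ∀ x ∈ D, G.Adj v x → x = p v) ∧
    (∀ v ∈ D, p (p v) = v) ∧ (∀ v ∈ D, p v ≠ v) := by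
  have : ∀ v, ∃ w, v ∈ D → (w ∈ D ∧ G.Adj v w ∧ ∀ x ∈ D, G.Adj v x → x = w) := by
    intro v
    by_cases hv : v ∈ D
    · obtain ⟨w, h1, h2⟩ := h.pair v hv
      exact ⟨w, fun _ => ⟨h1, h2⟩⟩
    · exact ⟨v, fun h => absurd h hv⟩
  choose p hp using this
  refine ⟨p, fun v hv => (hp v hv).1, fun v hv => (hp v hv).2.1, fun v hv => (hp v hv).2.2, ?_, ?_⟩
  · intro v hv
    exact ((hp (p v) (hp v hv).1).2.2 v hv (hp v hv).2.1.symm).symm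
  · intro v hv hh
    have := (hp v hv).2.1
    rw [hh] at this
    exact G.loopless.irrefl _ this

theorem pair_unique (h : IMC G c C D) {v x y : V} (hv : v ∈ D) (hx : x ∈ D) (hy : y ∈ D)
    (hvx : G.Adj v x) (hvy : G.Adj v y) : x = y := by
  obtain ⟨w, _, _, hw⟩ := h.pair v hv
  rw [hw x hx hvx, hw y hy hvy]

/-- If fewer than `|A|` edges met `A`, a nonzero potential supported on `A` would be constant along
all edges but vanish at `u`, against connectedness. This is the Hall condition behind `select`. -/
theorem card_touch (h : IMC G c C D) (A : Finset P) (hA : A ⊆ C) (u : P) (hu : u ∈ C)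
    (huA : u ∉ A) :
    2 * A.card ≤ (D.filter (fun v => c v ∈ A ∨ ∃ w ∈ D, G.Adj v w ∧ c w ∈ A)).card := by
  obtain ⟨p, hp, hadj, huniq, hpp, hne⟩ := h.exists_partner
  by_contra hcon
  push Not at hcon
  set D' := D.filter (fun v => c v ∈ A ∨ ∃ w ∈ D, G.Adj v w ∧ c w ∈ A) with hD'
  have hmem : ∀ v, v ∈ D' ↔ v ∈ D ∧ (c v ∈ A ∨ ∃ w ∈ D, G.Adj v w ∧ c w ∈ A) := by
    intro v; simp [hD']
  have hp' : ∀ v ∈ D', p v ∈ D' := by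
    intro v hv
    obtain ⟨hvD, hv⟩ := (hmem v).1 hv
    refine (hmem _).2 ⟨hp v hvD, ?_⟩
    rcases hv with hv | ⟨w, hw, hvw, hwA⟩
    · exact Or.inr ⟨v, hvD, (hadj v hvD).symm, hv⟩
    · left; rwa [← huniq v hvD w hw hvw]
  obtain ⟨ψ, ⟨x, hxA, hx⟩, hoff, hψ⟩ := exists_potential c D' p hp'
    (fun v hv => hpp v ((hmem v).1 hv).1) (fun v hv => hne v ((hmem v).1 hv).1) A hcon
  have := h.conn ψ (by
    intro v hv w hw hvw
    by_cases hvD : v ∈ D'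
    · rw [hψ v hvD, huniq v hv w hw hvw]
    · rw [hmem] at hvD
      push Not at hvD
      rw [hoff _ (hvD hv).1, hoff _ ((hvD hv).2 w hw hvw)]) x (hA hxA) u hu
  rw [hoff u huA] at this
  exact hx this

/-- Root the tree at `u`. Hall's theorem gives every other part an edge of its own, and the end of
the edge in that part is taken. Ends of different edges are not adjacent, because the matching is
induced. -/
theorem select (h : IMC G c C D) (u : P) (hu : u ∈ C) :
    ∃ M ⊆ D, FullIT G c (C.erase u) M := by
  obtain ⟨p, hp, hadj, huniq, hpp, hne⟩ := h.exists_partner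
  let ed : V → Finset V := fun v => {v, p v}
  let t : {x // x ∈ C.erase u} → Finset (Finset V) := fun x => (D.filter (fun v => c v = x.1)).image ed
  have hall : ∀ s : Finset {x // x ∈ C.erase u}, s.card ≤ (s.biUnion t).card := by
    intro s
    set A : Finset P := s.image Subtype.val with hA
    have hAc : A.card = s.card := Finset.card_image_of_injective _ Subtype.val_injective
    have hAC : A ⊆ C.erase u := by
      intro x hx
      obtain ⟨y, _, rfl⟩ := Finset.mem_image.1 hx
      exact y.2
    have h1 := h.card_touch A (fun x hx => Finset.mem_of_mem_erase (hAC hx)) u hu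
      (fun hx => by simpa using hAC hx)
    set D' := D.filter (fun v => c v ∈ A ∨ ∃ w ∈ D, G.Adj v w ∧ c w ∈ A) with hD'
    have hmem : ∀ v, v ∈ D' ↔ v ∈ D ∧ (c v ∈ A ∨ ∃ w ∈ D, G.Adj v w ∧ c w ∈ A) := by
      intro v; simp [hD']
    have hp' : ∀ v ∈ D', p v ∈ D' := by
      intro v hv
      obtain ⟨hvD, hv⟩ := (hmem v).1 hv
      refine (hmem _).2 ⟨hp v hvD, ?_⟩
      rcases hv with hv | ⟨w, hw, hvw, hwA⟩
      · exact Or.inr ⟨v, hvD, (hadj v hvD).symm, hv⟩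
      · left; rwa [← huniq v hvD w hw hvw]
    have h2 := card_image_pair D' p hp' (fun v hv => hpp v ((hmem v).1 hv).1)
      (fun v hv => hne v ((hmem v).1 hv).1)
    have h3 : D'.image (fun v => ({v, p v} : Finset V)) ⊆ s.biUnion t := by
      intro e he
      obtain ⟨v, hv, rfl⟩ := Finset.mem_image.1 he
      obtain ⟨hvD, hv⟩ := (hmem v).1 hv
      have key : ∀ w ∈ D, c w ∈ A → ed w ∈ s.biUnion t := by
        intro w hw hwA
        obtain ⟨y, hy, hyc⟩ := Finset.mem_image.1 hwA
        refine Finset.mem_biUnion.2 ⟨y, hy, Finset.mem_image.2 ⟨w, ?_, rfl⟩⟩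
        simp [hw, hyc]
      rcases hv with hv | ⟨w, hw, hvw, hwA⟩
      · exact key v hvD hv
      · have := key w hw hwA
        have hw' := huniq v hvD w hw hvw
        have : ed w = ({v, p v} : Finset V) := by
          simp only [ed, hw', hpp v hvD]
          rw [Finset.pair_comm]
        rw [← this]; assumption
    have := Finset.card_le_card h3
    omega
  obtain ⟨f, hfinj, hf⟩ := (Finset.all_card_le_biUnion_card_iff_exists_injective t).1 hall
  have hv : ∀ x, ∃ v ∈ D, c v = x.1 ∧ ed v = f x := by
    intro x
    obtain ⟨v, hv, hve⟩ := Finset.mem_image.1 (hf x)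
    have := Finset.mem_filter.1 hv
    exact ⟨v, this.1, this.2, hve⟩
  choose g hgD hgc hge using hv
  refine ⟨Finset.univ.image g, ?_, ?_, ?_, ?_⟩
  · intro v hv
    obtain ⟨x, _, rfl⟩ := Finset.mem_image.1 hv
    exact hgD x
  · intro v hv w hw hvw
    obtain ⟨x, _, rfl⟩ := Finset.mem_image.1 hv
    obtain ⟨y, _, rfl⟩ := Finset.mem_image.1 hw
    have h1 := huniq _ (hgD x) _ (hgD y) hvw
    have h2 : f x = f y := by
      rw [← hge, ← hge]
      simp only [ed, h1, hpp _ (hgD x)]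
      rw [Finset.pair_comm]
    rw [hfinj h2] at hvw
    exact G.loopless.irrefl _ hvw
  · intro v hv w hw hvw
    obtain ⟨x, _, rfl⟩ := Finset.mem_image.1 (Finset.mem_coe.1 hv)
    obtain ⟨y, _, rfl⟩ := Finset.mem_image.1 (Finset.mem_coe.1 hw)
    rw [hgc, hgc] at hvw
    rw [Subtype.ext hvw]
  · ext x
    simp only [Finset.mem_image, Finset.mem_univ, true_and]
    constructor
    · rintro ⟨v, ⟨y, rfl⟩, rfl⟩
      rw [hgc]; exact y.2
    · intro hx
      exact ⟨_, ⟨⟨x, hx⟩, rfl⟩, hgc _⟩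

/-- A potential which separates the two ends of the matching edge `ab` and no other edge. -/
def Cut (G : SimpleGraph V) (c : V → P) (D : Finset V) (a b : V) (φ : P → ZMod 2) : Prop :=
  (∀ v ∈ D, ∀ w ∈ D, G.Adj v w → v ≠ a → v ≠ b → φ (c v) = φ (c w)) ∧ φ (c a) ≠ φ (c b)

/-- Without `ab` there are `|C| - 2` edges for the `|C| - 1` parts other than `c a`, so a nonzero
potential vanishing at `c a` survives. It must jump along `ab`, since otherwise `conn` makes it
zero. -/
theorem exists_cut (h : IMC G c C D) {a b : V} (ha : a ∈ D) (hb : b ∈ D) (hab : G.Adj a b) :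
    ∃ φ, Cut G c D a b φ := by
  obtain ⟨p, hp, hadj, huniq, hpp, hne⟩ := h.exists_partner
  have hpa : p a = b := (huniq a ha b hb hab).symm
  have hpb : p b = a := (huniq b hb a ha hab.symm).symm
  have hu := h.color a ha
  have hne' : a ≠ b := hab.ne
  have hcard : (D.filter (fun v => v ≠ a ∧ v ≠ b)).card + 2 = D.card := by
    have h1 : D.filter (fun v => v ≠ a ∧ v ≠ b) = (D.erase a).erase b := by
      ext v; simp only [mem_filter, mem_erase]; tauto
    rw [h1, Finset.card_erase_of_mem (by simp [hb, hne'.symm]), Finset.card_erase_of_mem ha]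
    have : 1 < D.card := Finset.one_lt_card.2 ⟨a, ha, b, hb, hne'⟩
    omega
  have hC : 0 < C.card := Finset.card_pos.2 ⟨_, hu⟩
  obtain ⟨ψ, ⟨x, hxA, hx⟩, hoff, hψ⟩ := exists_potential c (D.filter (fun v => v ≠ a ∧ v ≠ b)) p
    (by
      intro v hv
      simp only [mem_filter] at hv ⊢
      refine ⟨hp v hv.1, ?_, ?_⟩
      · intro hh
        apply hv.2.2
        rw [← hpp v hv.1, hh, hpa]
      · intro hh
        apply hv.2.1
        rw [← hpp v hv.1, hh, hpb])
    (fun v hv => hpp v (mem_filter.1 hv).1) (fun v hv => hne v (mem_filter.1 hv).1)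
    (C.erase (c a)) (by
      have := h.card
      rw [Finset.card_erase_of_mem hu]
      omega)
  have h1 : ∀ v ∈ D, ∀ w ∈ D, G.Adj v w → v ≠ a → v ≠ b → ψ (c v) = ψ (c w) := by
    intro v hv w hw hvw hva hvb
    rw [hψ v (by simp [hv, hva, hvb]), huniq v hv w hw hvw]
  refine ⟨ψ, h1, ?_⟩
  intro heq
  have := h.conn ψ (by
    intro v hv w hw hvw
    by_cases hva : v = a
    · subst hva
      rw [h.pair_unique hv hw hb hvw hab, heq]
    · by_cases hvb : v = b
      · subst hvb
        rw [h.pair_unique hv hw ha hvw hab.symm, heq]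
      · exact h1 v hv w hw hvw hva hvb) x (mem_of_mem_erase hxA) (c a) hu
  rw [hoff (c a) (by simp)] at this
  exact hx this

theorem zmod2_cases (x y z : ZMod 2) (h : x ≠ y) : z = x ∨ z = y := by
  revert x y z; decide

/-- The two sides of a cut each carry exactly as many matching edges as a tree. -/
theorem card_side (h : IMC G c C D) {a b : V} (ha : a ∈ D) (hb : b ∈ D) (hab : G.Adj a b)
    {φ : P → ZMod 2} (hφ : Cut G c D a b φ) :
    (D.filter (fun v => φ (c v) = φ (c a) ∧ v ≠ a)).card + 2 =
      2 * (C.filter (fun p => φ p = φ (c a))).card := by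
  -- lower bound for both sides
  have key : ∀ {a b : V}, a ∈ D → b ∈ D → G.Adj a b → Cut G c D a b φ →
      2 * (C.filter (fun p => φ p = φ (c a))).card ≤
      (D.filter (fun v => φ (c v) = φ (c a) ∧ v ≠ a)).card + 2 := by
    intro a b ha hb hab hφ
    have h1 := h.card_touch (C.filter (fun p => φ p = φ (c a))) (filter_subset _ _) (c b)
      (h.color b hb) (by simp [hφ.2.symm])
    refine h1.trans ?_
    have h2 : (D.filter (fun v => c v ∈ C.filter (fun p => φ p = φ (c a)) ∨
        ∃ w ∈ D, G.Adj v w ∧ c w ∈ C.filter (fun p => φ p = φ (c a)))) ⊆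
        (D.filter (fun v => φ (c v) = φ (c a) ∧ v ≠ a)) ∪ {a, b} := by
      intro v hv
      simp only [mem_filter, mem_union, mem_insert, mem_singleton] at hv ⊢
      obtain ⟨hvD, hv⟩ := hv
      by_cases hva : v = a
      · simp [hva]
      by_cases hvb : v = b
      · simp [hvb]
      left
      refine ⟨hvD, ?_, hva⟩
      rcases hv with hv | ⟨w, hw, hvw, hv⟩
      · exact hv.2
      · rw [hφ.1 v hvD w hw hvw hva hvb]; exact hv.2
    refine (card_le_card h2).trans ((card_union_le _ _).trans ?_)
    have := Finset.card_le_two (a := a) (b := b)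
    omega
  have hφ' : Cut G c D b a φ := ⟨fun v hv w hw hvw h1 h2 => hφ.1 v hv w hw hvw h2 h1, hφ.2.symm⟩
  have k1 := key ha hb hab hφ
  have k2 := key hb ha hab.symm hφ'
  -- The two sides and `{a, b}` exhaust `D`, so the two lower bounds already add up to the total
  -- prescribed by `IMC.card`, and both are equalities.
  have hD : D.card = (D.filter (fun v => φ (c v) = φ (c a) ∧ v ≠ a)).card +
      (D.filter (fun v => φ (c v) = φ (c b) ∧ v ≠ b)).card + 2 := by
    have e1 : D = ((D.filter (fun v => φ (c v) = φ (c a) ∧ v ≠ a)) ∪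
      (D.filter (fun v => φ (c v) = φ (c b) ∧ v ≠ b))) ∪ {a, b} := by
      ext v
      simp only [mem_union, mem_filter, mem_insert, mem_singleton]
      constructor
      · intro hv
        by_cases hva : v = a
        · simp [hva]
        by_cases hvb : v = b
        · simp [hvb]
        rcases zmod2_cases _ _ (φ (c v)) hφ.2 with h | h
        · exact Or.inl (Or.inl ⟨hv, h, hva⟩)
        · exact Or.inl (Or.inr ⟨hv, h, hvb⟩)
      · rintro ((h | h) | (h | h))
        · exact h.1
        · exact h.1
        · rw [h]; exact ha
        · rw [h]; exact hb
    conv_lhs => rw [e1]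
    rw [card_union_of_disjoint, card_union_of_disjoint, card_pair hab.ne]
    · rw [Finset.disjoint_left]
      intro v h1 h2
      simp only [mem_filter] at h1 h2
      exact hφ.2 (h1.2.1.symm.trans h2.2.1)
    · rw [Finset.disjoint_left]
      intro v h1 h2
      simp only [mem_filter, mem_union, mem_insert, mem_singleton] at h1 h2
      rcases h2 with rfl | rfl
      · rcases h1 with h1 | h1
        · exact h1.2.2 rfl
        · exact hφ.2 h1.2.1
      · rcases h1 with h1 | h1
        · exact hφ.2 h1.2.1.symm
        · exact h1.2.2 rfl
  have hC : C.card = (C.filter (fun p => φ p = φ (c a))).card +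
      (C.filter (fun p => φ p = φ (c b))).card := by
    rw [← card_union_of_disjoint]
    · congr 1
      ext x
      simp only [mem_union, mem_filter]
      constructor
      · intro hx
        rcases zmod2_cases _ _ (φ x) hφ.2 with h | h
        · exact Or.inl ⟨hx, h⟩
        · exact Or.inr ⟨hx, h⟩
      · rintro (h | h) <;> exact h.1
    · rw [Finset.disjoint_left]
      intro v h1 h2
      simp only [mem_filter] at h1 h2
      exact hφ.2 (h1.2.symm.trans h2.2)
  have := h.card
  omega

end IMC
end PartialIT

/-! ### Swapping and growing tree matchings. -/

namespace PartialIT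

open Finset
open scoped Classical

variable {V P : Type*}

namespace IMC

variable {G : SimpleGraph V} {c : V → P} {C : Finset P} {D : Finset V}

/-- A transversal of the tree rooted at `u` picks from each edge the end away from `u`. -/
theorem not_mem_of_cut (h : IMC G c C D) {a b : V} (ha : a ∈ D) (hb : b ∈ D) (hab : G.Adj a b)
    {φ : P → ZMod 2} (hφ : Cut G c D a b φ) {u : P} (hu : φ u = φ (c b)) {M : Finset V}
    (hMD : M ⊆ D) (hM : FullIT G c (C.erase u) M) : b ∉ M := by
  intro hbM
  obtain ⟨p, hp, hadj, huniq, hpp, hne⟩ := h.exists_partner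
  have hpa : p a = b := (huniq a ha b hb hab).symm
  have hpb : p b = a := (huniq b hb a ha hab.symm).symm
  have haM : a ∉ M := fun haM => hM.1 a haM b hbM hab
  have h1 := h.card_side ha hb hab hφ
  set DY := D.filter (fun v => φ (c v) = φ (c a) ∧ v ≠ a) with hDY
  set Y := C.filter (fun p => φ p = φ (c a)) with hY
  set MY := M.filter (fun v => φ (c v) = φ (c a)) with hMY
  have h2 : MY.card = Y.card := by
    rw [← card_image_of_injOn (f := c) (s := MY)]
    · congr 1
      ext x
      simp only [hMY, hY, mem_image, mem_filter]
      constructor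
      · rintro ⟨v, ⟨hv, hvφ⟩, rfl⟩
        exact ⟨h.color v (hMD hv), hvφ⟩
      · rintro ⟨hx, hxφ⟩
        have : x ∈ M.image c := by
          rw [hM.2.2, mem_erase]
          refine ⟨?_, hx⟩
          rintro rfl
          exact hφ.2 (hxφ.symm.trans hu)
        obtain ⟨v, hv, rfl⟩ := mem_image.1 this
        exact ⟨v, ⟨hv, hxφ⟩, rfl⟩
    · exact hM.2.1.mono (by intro v hv; exact (mem_filter.1 hv).1)
  have hMYne : ∀ v ∈ MY, v ∈ D ∧ v ∈ M ∧ v ≠ a ∧ v ≠ b ∧ φ (c v) = φ (c a) := by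
    intro v hv
    obtain ⟨hvM, hvφ⟩ := mem_filter.1 hv
    refine ⟨hMD hvM, hvM, ?_, ?_, hvφ⟩
    · rintro rfl; exact haM hvM
    · rintro rfl; exact hφ.2 hvφ.symm
  -- If `b` is chosen then `a` is not, so the chosen vertices on the side of `a` and their partners
  -- all stay on that side: `2|Y|` vertices, where `card_side` allows `2|Y| - 2`.
  have h3 : MY ∪ MY.image p ⊆ DY := by
    intro v hv
    rcases mem_union.1 hv with hv | hv
    · obtain ⟨h1, _, h2, h3, h4⟩ := hMYne v hv
      exact mem_filter.2 ⟨h1, h4, h2⟩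
    · obtain ⟨w, hw, rfl⟩ := mem_image.1 hv
      obtain ⟨h1, _, h2, h3, h4⟩ := hMYne w hw
      refine mem_filter.2 ⟨hp w h1, ?_, ?_⟩
      · rw [← hφ.1 w h1 (p w) (hp w h1) (hadj w h1) h2 h3, h4]
      · intro hh
        apply h3
        rw [← hpp w h1, hh, hpa]
  have h4 : (MY ∪ MY.image p).card = 2 * MY.card := by
    rw [card_union_of_disjoint, card_image_of_injOn]
    · omega
    · intro v hv w hw hvw
      have h5 := (hMYne v hv).1
      have h6 := (hMYne w hw).1
      rw [← hpp v h5, ← hpp w h6, hvw]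
    · rw [Finset.disjoint_left]
      intro v hv hv2
      obtain ⟨w, hw, rfl⟩ := mem_image.1 hv2
      exact hM.1 _ (hMYne w hw).2.1 _ (hMYne _ hv).2.1 (hadj w (hMYne w hw).1)
  have := card_le_card h3
  omega

/-- Deleting `ab` splits the tree into two sides. The edge `a'b` reconnects them because `a'` lies
on the side opposite to `b`. -/
theorem swap (h : IMC G c C D) {a b a' : V} (ha : a ∈ D) (hb : b ∈ D) (hab : G.Adj a b)
    (ha'C : c a' ∈ C) (ha'b : G.Adj a' b) (hx : ∀ x ∈ D, G.Adj a' x → x = b)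
    {φ : P → ZMod 2} (hφ : Cut G c D a b φ) (hc : φ (c a') ≠ φ (c b)) :
    IMC G c C (insert a' (D.erase a)) := by
  by_cases ha'D : a' ∈ D
  · have : a' = a := h.pair_unique hb ha'D ha ha'b.symm hab.symm
    subst this
    rwa [insert_erase ha]
  have hbne : b ≠ a := hab.ne'
  have hpb : ∀ v ∈ D, G.Adj v b → v = a := fun v hv hvb => h.pair_unique hb hv ha hvb.symm hab.symm
  constructor
  · intro v hv
    rcases mem_insert.1 hv with rfl | hv
    · exact ha'C
    · exact h.color v (mem_of_mem_erase hv)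
  · intro v hv
    rcases mem_insert.1 hv with rfl | hv
    · refine ⟨b, by simp [hbne, hb], ha'b, ?_⟩
      intro x hxD hvx
      rcases mem_insert.1 hxD with rfl | hxD
      · exact absurd hvx (G.loopless.irrefl _)
      · exact hx x (mem_of_mem_erase hxD) hvx
    · obtain ⟨hva, hvD⟩ := mem_erase.1 hv
      obtain ⟨w, hw, hvw, huw⟩ := h.pair v hvD
      by_cases hvb : v = b
      · subst hvb
        refine ⟨a', by simp, ha'b.symm, ?_⟩
        intro x hxD hvx
        rcases mem_insert.1 hxD with rfl | hxD
        · rfl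
        · exact absurd (hpb x (mem_of_mem_erase hxD) hvx.symm) (mem_erase.1 hxD).1
      · have hwa : w ≠ a := by
          rintro rfl
          exact hvb (h.pair_unique ha hvD hb hvw.symm hab)
        refine ⟨w, by simp [hwa, hw], hvw, ?_⟩
        intro x hxD hvx
        rcases mem_insert.1 hxD with rfl | hxD
        · exact absurd (hx v hvD hvx.symm) hvb
        · exact huw x (mem_of_mem_erase hxD) hvx
  · rw [card_insert_of_notMem (by simp [ha'D]), card_erase_of_mem ha]
    have h1 := h.card
    have : 0 < D.card := card_pos.2 ⟨a, ha⟩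
    omega
  · intro ψ hψ
    have hψ' : ∀ v ∈ D, ∀ w ∈ D, G.Adj v w → v ≠ a → v ≠ b → ψ (c v) = ψ (c w) := by
      intro v hv w hw hvw hva hvb
      have hwa : w ≠ a := by
        rintro rfl
        exact hvb (h.pair_unique hw hv hb hvw.symm hab)
      exact hψ v (by simp [hv, hva]) w (by simp [hw, hwa]) hvw
    have hψa' : ψ (c a') = ψ (c b) := hψ a' (by simp) b (by simp [hb, hbne]) ha'b
    by_cases hψab : ψ (c a) = ψ (c b)
    · apply h.conn
      intro v hv w hw hvw
      by_cases hva : v = a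
      · subst hva; rw [h.pair_unique hv hw hb hvw hab, hψab]
      by_cases hvb : v = b
      · subst hvb; rw [h.pair_unique hv hw ha hvw hab.symm, hψab]
      exact hψ' v hv w hw hvw hva hvb
    · exfalso
      -- Both potentials jump along `ab`, so their sum is constant along all edges of the old tree.
      -- It is therefore constant on `C`, although between `a'` and `b` only `φ` changes.
      have hsum : ∀ x y z w : ZMod 2, x ≠ y → z ≠ w → x + z = y + w := by decide
      have := h.conn (fun x => ψ x + φ x) (by
        intro v hv w hw hvw
        by_cases hva : v = a
        · subst hva; rw [h.pair_unique hv hw hb hvw hab]; exact hsum _ _ _ _ hψab hφ.2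
        by_cases hvb : v = b
        · subst hvb; rw [h.pair_unique hv hw ha hvw hab.symm]
          exact (hsum _ _ _ _ hψab hφ.2).symm
        rw [hψ' v hv w hw hvw hva hvb, hφ.1 v hv w hw hvw hva hvb]) (c a') ha'C (c b) (h.color b hb)
      rw [hψa'] at this
      exact hc (add_left_cancel this)

theorem single (u : P) : IMC G c {u} ∅ := by
  constructor <;> simp

theorem grow (h : IMC G c C D) {x w : V} (hxC : c x ∈ C) (hwC : c w ∉ C) (hxw : G.Adj x w)
    (hx : ∀ v ∈ D, ¬ G.Adj x v) (hw : ∀ v ∈ D, ¬ G.Adj w v) :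
    IMC G c (insert (c w) C) (insert x (insert w D)) := by
  have hxD : x ∉ D := by
    intro hxD
    obtain ⟨y, hy, hxy, _⟩ := h.pair x hxD
    exact hx y hy hxy
  have hwD : w ∉ D := fun hwD => hwC (h.color w hwD)
  constructor
  · intro v hv
    simp only [mem_insert] at hv ⊢
    rcases hv with rfl | rfl | hv
    · exact Or.inr hxC
    · exact Or.inl rfl
    · exact Or.inr (h.color v hv)
  · intro v hv
    simp only [mem_insert] at hv
    rcases hv with rfl | rfl | hv
    · refine ⟨w, by simp, hxw, ?_⟩
      intro y hy hvy
      simp only [mem_insert] at hy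
      rcases hy with rfl | rfl | hy
      · exact absurd hvy (G.loopless.irrefl _)
      · rfl
      · exact absurd hvy (hx y hy)
    · refine ⟨x, by simp, hxw.symm, ?_⟩
      intro y hy hvy
      simp only [mem_insert] at hy
      rcases hy with rfl | rfl | hy
      · rfl
      · exact absurd hvy (G.loopless.irrefl _)
      · exact absurd hvy (hw y hy)
    · obtain ⟨y, hy, hvy, huy⟩ := h.pair v hv
      refine ⟨y, by simp [hy], hvy, ?_⟩
      intro z hz hvz
      simp only [mem_insert] at hz
      rcases hz with rfl | rfl | hz
      · exact absurd hvz.symm (hx v hv)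
      · exact absurd hvz.symm (hw v hv)
      · exact huy z hz hvz
  · rw [card_insert_of_notMem, card_insert_of_notMem hwD, card_insert_of_notMem hwC]
    · have := h.card
      omega
    · simp only [mem_insert, not_or]
      exact ⟨hxw.ne, hxD⟩
  · intro φ hφ
    have h1 := h.conn φ (fun v hv w hw => hφ v (by simp [hv]) w (by simp [hw]))
    have h2 : φ (c x) = φ (c w) := hφ x (by simp) w (by simp) hxw
    have h3 : ∀ p ∈ insert (c w) C, φ p = φ (c x) := by
      intro p hp
      rcases mem_insert.1 hp with rfl | hp
      · exact h2.symm
      · exact h1 p hp _ hxC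
    intro p hp p' hp'
    rw [h3 p hp, h3 p' hp']

end IMC

/-! ### Haxell's argument with stars. -/

section Run

variable (G : SimpleGraph V) (c : V → P)

/-- The vertices of the stars centred at the members of `L`, with leaves in `M`, together with
`V₀`. -/
noncomputable def starVerts (V₀ M : Finset V) : List V → Finset V
  | [] => V₀
  | x :: L => insert x (M.filter (G.Adj x)) ∪ starVerts V₀ M L

/-- The parts reached by the stars centred at the members of `L`. -/
noncomputable def starParts (S₀ : Finset P) (M : Finset V) : List V → Finset P
  | [] => S₀
  | x :: L => (M.filter (G.Adj x)).image c ∪ starParts S₀ M L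

/-- The list `L` (latest first) is a sequence of star centres, each chosen in a part reached before
and not dominated before. -/
def StarSeq (A V₀ : Finset V) (S₀ : Finset P) (M : Finset V) : List V → Prop
  | [] => True
  | x :: L => x ∈ A ∧ c x ∈ starParts G c S₀ M L ∧ (∀ v ∈ starVerts G V₀ M L, ¬ G.Adj x v) ∧
      (M.filter (G.Adj x)).Nonempty ∧ StarSeq A V₀ S₀ M L

/-- Transversals of `T` inside `A` which avoid the neighbourhood of `V₀`. -/
def GoodIT (A V₀ : Finset V) (T : Finset P) (M : Finset V) : Prop :=
  FullIT G c T M ∧ M ⊆ A ∧ ∀ m ∈ M, ∀ v ∈ V₀, ¬ G.Adj m v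

variable {G c} {A V₀ : Finset V} {S₀ T : Finset P}

theorem star_congr {M M' : Finset V} : ∀ {L : List V},
    (∀ z ∈ L, M'.filter (G.Adj z) = M.filter (G.Adj z)) →
    starVerts G V₀ M' L = starVerts G V₀ M L ∧ starParts G c S₀ M' L = starParts G c S₀ M L ∧
      (StarSeq G c A V₀ S₀ M L → StarSeq G c A V₀ S₀ M' L)
  | [], _ => ⟨rfl, rfl, fun _ => trivial⟩
  | x :: L, h => by
    obtain ⟨h1, h2, h3⟩ := star_congr (L := L)
      (fun z hz => h z (by simp [hz]))
    have hx := h x (by simp)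
    refine ⟨?_, ?_, ?_⟩
    · simp only [starVerts, hx, h1]
    · simp only [starParts, hx, h2]
    · rintro ⟨a1, a2, a3, a4, a5⟩
      refine ⟨a1, ?_, ?_, ?_, h3 a5⟩
      · rwa [h2]
      · rwa [h1]
      · rwa [hx]

theorem starVerts_subset_cons {M : Finset V} : ∀ {L : List V} {x : V}, x ∈ L →
    x ∈ starVerts G V₀ M L ∧ M.filter (G.Adj x) ⊆ starVerts G V₀ M L
  | y :: L, x, hx => by
    rcases List.mem_cons.1 hx with rfl | hx
    · refine ⟨by simp [starVerts], ?_⟩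
      intro z hz
      simp only [starVerts, mem_union, mem_insert]
      exact Or.inl (Or.inr hz)
    · obtain ⟨h1, h2⟩ := starVerts_subset_cons (L := L) hx
      exact ⟨by simp [starVerts, h1], h2.trans (by rw [starVerts]; exact subset_union_right)⟩

theorem base_subset_starVerts {M : Finset V} : ∀ {L : List V}, V₀ ⊆ starVerts G V₀ M L
  | [] => Finset.Subset.refl _
  | _ :: L => (base_subset_starVerts (L := L)).trans (by rw [starVerts]; exact subset_union_right)

/-- A reached part lies in the base or is the part of a leaf. -/
theorem mem_starParts {M : Finset V} {p : P} : ∀ {L : List V}, p ∈ starParts G c S₀ M L →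
    p ∈ S₀ ∨ ∃ L₁ x L₂, L = L₁ ++ x :: L₂ ∧ ∃ m ∈ M, G.Adj x m ∧ c m = p
  | [], h => Or.inl h
  | x :: L, h => by
    simp only [starParts, mem_union, mem_image, mem_filter] at h
    rcases h with ⟨m, ⟨hm, hxm⟩, rfl⟩ | h
    · exact Or.inr ⟨[], x, L, rfl, m, hm, hxm, rfl⟩
    · rcases mem_starParts h with h' | ⟨L₁, y, L₂, rfl, h'⟩
      · exact Or.inl h'
      · exact Or.inr ⟨x :: L₁, y, L₂, rfl, h'⟩

theorem StarSeq.suffix {M : Finset V} : ∀ {L₁ L₂ : List V}, StarSeq G c A V₀ S₀ M (L₁ ++ L₂) →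
    StarSeq G c A V₀ S₀ M L₂
  | [], _, h => h
  | _ :: L₁, L₂, h => StarSeq.suffix (L₁ := L₁) (L₂ := L₂) h.2.2.2.2

/-- Some star of `L` can be shrunk without changing the earlier ones. -/
def Shrinks (G : SimpleGraph V) (c : V → P) (A V₀ : Finset V) (T : Finset P) (M : Finset V)
    (L : List V) : Prop :=
  ∃ L₁ x L₂, L = L₁ ++ x :: L₂ ∧ ∃ M', GoodIT G c A V₀ T M' ∧
    (∀ z ∈ L₂, M'.filter (G.Adj z) = M.filter (G.Adj z)) ∧
    M'.filter (G.Adj x) ⊂ M.filter (G.Adj x)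

/-- A sequence of stars which dominates all the parts it reaches. -/
def Closed (G : SimpleGraph V) (c : V → P) (A V₀ : Finset V) (S₀ : Finset P) (M : Finset V)
    (L : List V) : Prop :=
  StarSeq G c A V₀ S₀ M L ∧ ∀ y ∈ A, c y ∈ starParts G c S₀ M L →
    ∃ v ∈ starVerts G V₀ M L, G.Adj y v

/-- By `H0` the part of `y` is not in the base, so it holds a leaf `m` of some star. Exchanging `m`
for `y` keeps a transversal and removes a leaf from that star. Earlier stars are unaffected: their
centres are adjacent neither to `y` nor to `m`, the latter because the centre `x` avoids all earlier
leaves. -/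
theorem shrinks_of_free {M : Finset V} {L : List V}
    (H0 : ∀ M, GoodIT G c A V₀ T M → ∀ x ∈ A, c x ∈ S₀ → (∀ v ∈ V₀, ¬ G.Adj x v) →
      (M.filter (G.Adj x)).Nonempty)
    (hM : GoodIT G c A V₀ T M) (hL : StarSeq G c A V₀ S₀ M L) {y : V} (hyA : y ∈ A)
    (hyc : c y ∈ starParts G c S₀ M L) (hy : ∀ v ∈ starVerts G V₀ M L, ¬ G.Adj y v)
    (hyM : M.filter (G.Adj y) = ∅) : Shrinks G c A V₀ T M L := by
  have hyM' : ∀ m ∈ M, ¬ G.Adj y m := fun m hm h => by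
    have : m ∈ M.filter (G.Adj y) := by simp [hm, h]
    rw [hyM] at this
    simp at this
  rcases mem_starParts hyc with hyS | ⟨L₁, x, L₂, rfl, m, hm, hxm, hmy⟩
  · have := H0 M hM y hyA hyS (fun v hv => hy v (base_subset_starVerts hv))
    rw [hyM] at this
    simp at this
  · have hseq := hL.suffix
    have hyx : ∀ z ∈ x :: L₂, ¬ G.Adj y z := fun z hz =>
      hy z (starVerts_subset_cons (by
        rcases List.mem_cons.1 hz with rfl | hz
        · simp
        · simp [hz])).1
    refine ⟨L₁, x, L₂, rfl, insert y (M.erase m), ⟨⟨?_, ?_, ?_⟩, ?_, ?_⟩, ?_, ?_⟩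
    · intro v hv w hw
      rcases mem_insert.1 hv with hv' | hv' <;> rcases mem_insert.1 hw with hw' | hw'
      · rw [hv', hw']; exact G.loopless.irrefl _
      · rw [hv']; exact hyM' w (mem_of_mem_erase hw')
      · rw [hw']; exact fun h => hyM' v (mem_of_mem_erase hv') h.symm
      · exact hM.1.1 v (mem_of_mem_erase hv') w (mem_of_mem_erase hw')
    · have key : ∀ v ∈ M.erase m, c v ≠ c y := by
        intro v hv h
        exact (mem_erase.1 hv).1 (hM.1.2.1 (mem_of_mem_erase hv) hm (h.trans hmy.symm))
      intro v hv w hw hvw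
      rw [mem_coe, mem_insert] at hv hw
      rcases hv with rfl | hv <;> rcases hw with rfl | hw
      · rfl
      · exact absurd hvw.symm (key w hw)
      · exact absurd hvw (key v hv)
      · exact hM.1.2.1 (mem_of_mem_erase hv) (mem_of_mem_erase hw) hvw
    · have h1 : (insert y (M.erase m)).image c = (insert m (M.erase m)).image c := by
        rw [image_insert, image_insert, hmy]
      rw [h1, insert_erase hm, hM.1.2.2]
    · intro v hv
      rcases mem_insert.1 hv with rfl | hv
      · exact hyA
      · exact hM.2.1 (mem_of_mem_erase hv)
    · intro v hv w hw
      rcases mem_insert.1 hv with rfl | hv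
      · exact hy w (base_subset_starVerts hw)
      · exact hM.2.2 v (mem_of_mem_erase hv) w hw
    · intro z hz
      have hzm : ¬ G.Adj z m := by
        intro hzm
        exact hseq.2.2.1 m ((starVerts_subset_cons hz).2 (by simp [hm, hzm])) hxm
      have hzy : ¬ G.Adj z y := fun h => hyx z (by simp [hz]) h.symm
      ext v
      simp only [mem_filter, mem_insert, mem_erase]
      constructor
      · rintro ⟨rfl | h1, h2⟩
        · exact absurd h2 hzy
        · exact ⟨h1.2, h2⟩
      · rintro ⟨h1, h2⟩
        refine ⟨Or.inr ⟨?_, h1⟩, h2⟩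
        rintro rfl
        exact hzm h2
    · rw [Finset.ssubset_iff_of_subset]
      · refine ⟨m, by simp [hm, hxm], ?_⟩
        simp only [mem_filter, mem_insert, mem_erase, not_and]
        rintro (rfl | h) _
        · exact hyx x (by simp) hxm.symm
        · exact h.1 rfl
      · intro v
        simp only [mem_filter, mem_insert, mem_erase]
        rintro ⟨rfl | h1, h2⟩
        · exact absurd h2.symm (hyx x (by simp))
        · exact ⟨h1.2, h2⟩

/-- A star has one centre and at least one leaf, and its leaves lie in parts not reached before. The
last clause carries the induction: a member of `M` in a reached part already belongs to the stars,
so the next centre is not adjacent to it. -/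
theorem StarSeq.card {M : Finset V} (hMc : Set.InjOn c (M : Set V)) (hMS : ∀ m ∈ M, c m ∉ S₀) :
    ∀ {L : List V}, StarSeq G c A V₀ S₀ M L →
    (starVerts G V₀ M L).card + S₀.card ≤ V₀.card + L.length + (starParts G c S₀ M L).card ∧
    S₀.card + L.length ≤ (starParts G c S₀ M L).card ∧
    ((starParts G c S₀ M L).card = S₀.card + L.length →
      ∀ x ∈ L, (M.filter (G.Adj x)).card = 1) ∧
    (∀ m ∈ M, c m ∈ starParts G c S₀ M L → m ∈ starVerts G V₀ M L)
  | [], _ => by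
    refine ⟨by simp [starVerts, starParts], by simp [starParts], by simp, ?_⟩
    intro m hm hmS
    exact absurd hmS (hMS m hm)
  | x :: L, h => by
    obtain ⟨h1, h2, h3, h4⟩ := StarSeq.card hMc hMS h.2.2.2.2
    have hd : Disjoint ((M.filter (G.Adj x)).image c) (starParts G c S₀ M L) := by
      rw [Finset.disjoint_left]
      intro p hp hp'
      obtain ⟨m, hm, rfl⟩ := mem_image.1 hp
      obtain ⟨hm, hxm⟩ := mem_filter.1 hm
      exact h.2.2.1 m (h4 m hm hp') hxm
    have hc1 : (starParts G c S₀ M (x :: L)).card =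
        (M.filter (G.Adj x)).card + (starParts G c S₀ M L).card := by
      rw [starParts, card_union_of_disjoint hd, card_image_of_injOn]
      exact hMc.mono (by intro v hv; exact (mem_filter.1 hv).1)
    have hpos : 0 < (M.filter (G.Adj x)).card := card_pos.2 h.2.2.2.1
    have hc2 : (starVerts G V₀ M (x :: L)).card ≤
        (M.filter (G.Adj x)).card + 1 + (starVerts G V₀ M L).card := by
      rw [starVerts]
      exact (card_union_le _ _).trans (by have := card_insert_le x (M.filter (G.Adj x)); omega)
    refine ⟨?_, ?_, ?_, ?_⟩
    · rw [List.length_cons]; omega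
    · rw [List.length_cons]; omega
    · intro heq
      rw [List.length_cons] at heq
      intro y hy
      rcases List.mem_cons.1 hy with rfl | hy
      · omega
      · exact h3 (by omega) y hy
    · intro m hm hmS
      rw [starParts, mem_union] at hmS
      rw [starVerts, mem_union]
      rcases hmS with hmS | hmS
      · obtain ⟨m', hm', hmm'⟩ := mem_image.1 hmS
        have := hMc (mem_filter.1 hm').1 hm hmm'
        subst this
        exact Or.inl (mem_insert_of_mem hm')
      · exact Or.inr (h4 m hm hmS)

theorem starParts_subset {M : Finset V} : ∀ {L : List V},
    starParts G c S₀ M L ⊆ S₀ ∪ M.image c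
  | [] => by simp [starParts]
  | x :: L => by
    rw [starParts]
    refine union_subset ?_ starParts_subset
    exact (image_subset_image (filter_subset _ _)).trans subset_union_right

/-- The induction is lexicographic. The outer one is on the number of stars that can still be added,
at most `|T|` in total; the inner one is on the size of the star at the next centre `y`. A shrinking
of the star at `y` lets that star be tried again with a smaller size, and a shrinking of an earlier
star is reported upwards. -/
theorem closed_or_shrinks
    (H0 : ∀ M, GoodIT G c A V₀ T M → ∀ x ∈ A, c x ∈ S₀ → (∀ v ∈ V₀, ¬ G.Adj x v) →
      (M.filter (G.Adj x)).Nonempty) (hST : Disjoint S₀ T) :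
    ∀ (n : ℕ) (M : Finset V) (L : List V), GoodIT G c A V₀ T M → StarSeq G c A V₀ S₀ M L →
      T.card = L.length + n →
      (∃ M' L', GoodIT G c A V₀ T M' ∧ Closed G c A V₀ S₀ M' L') ∨ Shrinks G c A V₀ T M L := by
  intro n
  induction n with
  | zero =>
    intro M L hM hL hn
    by_cases hcl : Closed G c A V₀ S₀ M L
    · exact Or.inl ⟨M, L, hM, hcl⟩
    rw [Closed, not_and] at hcl
    have hcl := hcl hL
    push Not at hcl
    obtain ⟨y, hyA, hyc, hy⟩ := hcl
    by_cases hyM : M.filter (G.Adj y) = ∅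
    · exact Or.inr (shrinks_of_free H0 hM hL hyA hyc hy hyM)
    -- One more star would reach more parts than there are in `S₀ ∪ T`.
    exfalso
    have hseq : StarSeq G c A V₀ S₀ M (y :: L) :=
      ⟨hyA, hyc, hy, nonempty_iff_ne_empty.2 hyM, hL⟩
    have h1 := (hseq.card hM.1.2.1 (fun m hm hmS => Finset.disjoint_left.1 hST hmS (by
      rw [← hM.1.2.2]; exact mem_image_of_mem c hm))).2.1
    have h2 := card_le_card (starParts_subset (G := G) (c := c) (S₀ := S₀) (M := M) (L := y :: L))
    rw [hM.1.2.2, card_union_of_disjoint hST] at h2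
    rw [List.length_cons] at h1
    omega
  | succ n ih =>
    intro M L hM hL hn
    by_cases hcl : Closed G c A V₀ S₀ M L
    · exact Or.inl ⟨M, L, hM, hcl⟩
    rw [Closed, not_and] at hcl
    have hcl := hcl hL
    push Not at hcl
    obtain ⟨y, hyA, hyc, hy⟩ := hcl
    have inner : ∀ (k : ℕ) (M : Finset V), GoodIT G c A V₀ T M → StarSeq G c A V₀ S₀ M L →
        c y ∈ starParts G c S₀ M L → (∀ v ∈ starVerts G V₀ M L, ¬ G.Adj y v) →
        (M.filter (G.Adj y)).card = k →
        (∃ M' L', GoodIT G c A V₀ T M' ∧ Closed G c A V₀ S₀ M' L') ∨ Shrinks G c A V₀ T M L := by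
      intro k
      induction k using Nat.strong_induction_on with
      | _ k ihk =>
        intro M hM hL hyc hy hk
        by_cases hyM : M.filter (G.Adj y) = ∅
        · exact Or.inr (shrinks_of_free H0 hM hL hyA hyc hy hyM)
        have hseq : StarSeq G c A V₀ S₀ M (y :: L) :=
          ⟨hyA, hyc, hy, nonempty_iff_ne_empty.2 hyM, hL⟩
        rcases ih M (y :: L) hM hseq (by rw [List.length_cons]; omega) with h | h
        · exact Or.inl h
        obtain ⟨L₁, x, L₂, hLL, M', hM', hsame, hlt⟩ := h
        cases L₁ with
        | nil =>
          simp only [List.nil_append, List.cons.injEq] at hLL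
          obtain ⟨rfl, rfl⟩ := hLL
          obtain ⟨e1, e2, e3⟩ := star_congr (A := A) (V₀ := V₀) (S₀ := S₀) (c := c) hsame
          rcases ihk _ (hk ▸ card_lt_card hlt) M' hM' (e3 hL) (by rwa [e2]) (by rwa [e1]) rfl
            with h | ⟨L₁, x, L₂, rfl, M'', hM'', hs, hl⟩
          · exact Or.inl h
          · refine Or.inr ⟨L₁, x, L₂, rfl, M'', hM'', ?_, ?_⟩
            · intro z hz
              rw [hs z hz, hsame z (by simp [hz])]
            · rwa [hsame x (by simp)] at hl
        | cons z L₁ =>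
          simp only [List.cons_append, List.cons.injEq] at hLL
          exact Or.inr ⟨L₁, x, L₂, hLL.2, M', hM', hsame, hlt⟩
    exact inner _ M hM hL hyc hy rfl

/-- Haxell's argument: starting from a base `S₀`, `V₀` that cannot be completed, stars can be added
until all the parts reached are dominated. -/
theorem exists_closed
    (H0 : ∀ M, GoodIT G c A V₀ T M → ∀ x ∈ A, c x ∈ S₀ → (∀ v ∈ V₀, ¬ G.Adj x v) →
      (M.filter (G.Adj x)).Nonempty) (hST : Disjoint S₀ T) {M : Finset V}
    (hM : GoodIT G c A V₀ T M) :
    ∃ M' L', GoodIT G c A V₀ T M' ∧ Closed G c A V₀ S₀ M' L' := by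
  rcases closed_or_shrinks H0 hST T.card M [] hM trivial (by simp) with h | ⟨L₁, x, L₂, h, _⟩
  · exact h
  · simp at h

end Run
end PartialIT

/-! ### Forests of tree matchings. -/

namespace PartialIT

open Finset
open scoped Classical

variable {V P : Type*} {G : SimpleGraph V} {c : V → P}

theorem FullIT.mem_iff {T : Finset P} {M : Finset V} (h : FullIT G c T M) {p : P} :
    p ∈ T ↔ ∃ v ∈ M, c v = p := by
  rw [← h.2.2, mem_image]

theorem FullIT.insert {T : Finset P} {M : Finset V} (h : FullIT G c T M) {y : V}
    (hy : ∀ m ∈ M, ¬ G.Adj y m) (hyT : c y ∉ T) :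
    FullIT G c (insert (c y) T) (insert y M) := by
  have key : ∀ m ∈ M, c m ≠ c y := fun m hm hh => hyT (by
    rw [← hh, ← h.2.2]; exact mem_image_of_mem c hm)
  refine ⟨?_, ?_, ?_⟩
  · intro v hv w hw
    rcases mem_insert.1 hv with hv' | hv' <;> rcases mem_insert.1 hw with hw' | hw'
    · rw [hv', hw']; exact G.loopless.irrefl _
    · rw [hv']; exact hy w hw'
    · rw [hw']; exact fun hh => hy v hv' hh.symm
    · exact h.1 v hv' w hw'
  · intro v hv w hw hvw
    rw [mem_coe, mem_insert] at hv hw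
    rcases hv with rfl | hv <;> rcases hw with rfl | hw
    · rfl
    · exact absurd hvw.symm (key w hw)
    · exact absurd hvw (key v hv)
    · exact h.2.1 hv hw hvw
  · rw [image_insert, h.2.2]

theorem FullIT.union {T T' : Finset P} {M M' : Finset V} (h : FullIT G c T M)
    (h' : FullIT G c T' M') (hT : Disjoint T T') (hadj : ∀ v ∈ M, ∀ w ∈ M', ¬ G.Adj v w) :
    FullIT G c (T ∪ T') (M ∪ M') := by
  refine ⟨?_, ?_, ?_⟩
  · intro v hv w hw
    rcases mem_union.1 hv with hv | hv <;> rcases mem_union.1 hw with hw | hw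
    · exact h.1 v hv w hw
    · exact hadj v hv w hw
    · exact fun hh => hadj w hw v hv hh.symm
    · exact h'.1 v hv w hw
  · have key : ∀ v ∈ M, ∀ w ∈ M', c v ≠ c w := fun v hv w hw hvw =>
      Finset.disjoint_left.1 hT (h.2.2 ▸ mem_image_of_mem c hv)
        (by rw [hvw, ← h'.2.2]; exact mem_image_of_mem c hw)
    intro v hv w hw hvw
    rw [mem_coe, mem_union] at hv hw
    rcases hv with hv | hv <;> rcases hw with hw | hw
    · exact h.2.1 hv hw hvw
    · exact absurd hvw (key v hv w hw)
    · exact absurd hvw.symm (key w hw v hv)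
    · exact h'.2.1 hv hw hvw
  · rw [image_union, h.2.2, h'.2.2]

theorem FullIT.biUnion {J : Type*} [Fintype J] {T : J → Finset P} {M : J → Finset V}
    (h : ∀ j, FullIT G c (T j) (M j)) (hT : ∀ i j, i ≠ j → Disjoint (T i) (T j))
    (hadj : ∀ i j, i ≠ j → ∀ v ∈ M i, ∀ w ∈ M j, ¬ G.Adj v w) :
    FullIT G c (univ.biUnion T) (univ.biUnion M) := by
  refine ⟨?_, ?_, ?_⟩
  · intro v hv w hw
    obtain ⟨i, _, hv⟩ := mem_biUnion.1 hv
    obtain ⟨j, _, hw⟩ := mem_biUnion.1 hw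
    by_cases hij : i = j
    · subst hij; exact (h i).1 v hv w hw
    · exact hadj i j hij v hv w hw
  · intro v hv w hw hvw
    obtain ⟨i, _, hv⟩ := mem_biUnion.1 (mem_coe.1 hv)
    obtain ⟨j, _, hw⟩ := mem_biUnion.1 (mem_coe.1 hw)
    by_cases hij : i = j
    · subst hij; exact (h i).2.1 hv hw hvw
    · exact absurd (hvw ▸ (h i).2.2 ▸ mem_image_of_mem c hv)
        (Finset.disjoint_right.1 (hT i j hij) ((h j).2.2 ▸ mem_image_of_mem c hw))
  · ext p
    simp only [mem_image, mem_biUnion, mem_univ, true_and]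
    constructor
    · rintro ⟨v, ⟨i, hv⟩, rfl⟩
      exact ⟨i, (h i).2.2 ▸ mem_image_of_mem c hv⟩
    · rintro ⟨i, hp⟩
      rw [← (h i).2.2] at hp
      obtain ⟨v, hv, rfl⟩ := mem_image.1 hp
      exact ⟨v, ⟨i, hv⟩, rfl⟩

/-- Disjoint tree-like induced matchings without edges between them. -/
structure Forest (G : SimpleGraph V) (c : V → P) {J : Type*} (C : J → Finset P)
    (D : J → Finset V) : Prop where
  tree : ∀ j, IMC G c (C j) (D j)
  disj : ∀ i j, i ≠ j → Disjoint (C i) (C j)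
  nadj : ∀ i j, i ≠ j → ∀ v ∈ D i, ∀ w ∈ D j, ¬ G.Adj v w

namespace Forest

variable {J : Type*} [Fintype J] {C : J → Finset P} {D : J → Finset V}

theorem verts_card (h : Forest G c C D) :
    (univ.biUnion D).card + 2 * Fintype.card J = 2 * (univ.biUnion C).card := by
  rw [card_biUnion, card_biUnion]
  · have h1 : ∀ j, (D j).card + 2 = 2 * (C j).card := fun j => (h.tree j).card
    rw [mul_sum, ← sum_congr rfl (fun j _ => h1 j), sum_add_distrib]
    simp [mul_comm]
  · intro i _ j _ hij
    exact h.disj i j hij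
  · intro i _ j _ hij
    show Disjoint _ _
    rw [Finset.disjoint_left]
    intro v hv hv'
    exact Finset.disjoint_left.1 (h.disj i j hij) ((h.tree i).color v hv) ((h.tree j).color v hv')

/-- Adding a vertex to rooted transversals of the trees gives a transversal missing one part
fewer than there are trees. -/
theorem exists_fullIT (h : Forest G c C D) {y : V} {j : J} (hyj : c y ∈ C j)
    {u : J → P} (hu : ∀ i, u i ∈ C i) (huj : u j = c y) {M : J → Finset V} (hMD : ∀ i, M i ⊆ D i)
    (hM : ∀ i, FullIT G c ((C i).erase (u i)) (M i)) (hyM : ∀ i, ∀ m ∈ M i, ¬ G.Adj y m)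
    {T : Finset P} (hT : Disjoint (univ.biUnion C) T) {N : Finset V} (hN : FullIT G c T N)
    (hND : ∀ m ∈ N, ∀ v ∈ univ.biUnion D, ¬ G.Adj m v) (hyN : ∀ m ∈ N, ¬ G.Adj y m) :
    ∃ T' M', FullIT G c T' M' ∧ T' ⊆ univ.biUnion C ∪ T ∧
      T'.card + Fintype.card J = (univ.biUnion C).card + T.card + 1 := by
  have h1 := FullIT.biUnion hM (fun i j hij => (h.disj i j hij).mono (erase_subset _ _)
    (erase_subset _ _)) (fun i j hij v hv w hw => h.nadj i j hij v (hMD i hv) w (hMD j hw))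
  have hsub : univ.biUnion (fun i => (C i).erase (u i)) ⊆ univ.biUnion C :=
    biUnion_mono (fun i _ => erase_subset _ _)
  have h2 := h1.union hN (hT.mono_left hsub) (by
    intro v hv w hw hvw
    obtain ⟨i, _, hv⟩ := mem_biUnion.1 hv
    exact hND w hw v (mem_biUnion.2 ⟨i, mem_univ _, hMD i hv⟩) hvw.symm)
  have hy1 : c y ∉ univ.biUnion (fun i => (C i).erase (u i)) := by
    intro hh
    obtain ⟨i, _, hi⟩ := mem_biUnion.1 hh
    obtain ⟨hne, hi⟩ := mem_erase.1 hi
    by_cases hij : i = j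
    · subst hij; exact hne huj.symm
    · exact Finset.disjoint_left.1 (h.disj i j hij) hi hyj
  have hy2 : c y ∉ T := fun hh =>
    Finset.disjoint_left.1 hT (mem_biUnion.2 ⟨j, mem_univ _, hyj⟩) hh
  have h3 := h2.insert (y := y) (by
    intro m hm
    rcases mem_union.1 hm with hm | hm
    · obtain ⟨i, _, hm⟩ := mem_biUnion.1 hm
      exact hyM i m hm
    · exact hyN m hm) (by simp only [mem_union, not_or]; exact ⟨hy1, hy2⟩)
  refine ⟨_, _, h3, insert_subset (mem_union_left _ (mem_biUnion.2 ⟨j, mem_univ _, hyj⟩))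
    (union_subset_union hsub (Subset.refl _)), ?_⟩
  rw [card_insert_of_notMem (by simp only [mem_union, not_or]; exact ⟨hy1, hy2⟩),
    card_union_of_disjoint (hT.mono_left hsub), card_biUnion, card_biUnion]
  · have : ∀ i, ((C i).erase (u i)).card + 1 = (C i).card := fun i =>
      card_erase_add_one (hu i)
    rw [← sum_congr rfl (fun i _ => this i), sum_add_distrib]
    simp
    omega
  · intro i _ j _ hij
    exact h.disj i j hij
  · intro i _ j _ hij
    exact (h.disj i j hij).mono (erase_subset _ _) (erase_subset _ _)

end Forest

theorem mem_starVerts {V₀ M : Finset V} {v : V} : ∀ {L : List V}, v ∈ starVerts G V₀ M L →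
    v ∈ V₀ ∨ v ∈ L ∨ v ∈ M
  | [], h => Or.inl h
  | x :: L, h => by
    simp only [starVerts, mem_union, mem_insert, mem_filter] at h
    rcases h with (rfl | h) | h
    · simp
    · exact Or.inr (Or.inr h.1)
    · rcases mem_starVerts h with h' | h' | h'
      · exact Or.inl h'
      · exact Or.inr (Or.inl (by simp [h']))
      · exact Or.inr (Or.inr h')

/-- A star with one leaf is an edge from a reached part to a new one, and neither end is adjacent to
earlier vertices. It therefore grows the tree containing the part of its centre and leaves the other
trees alone. -/
theorem Forest.extend {J : Type*} [Fintype J] {C : J → Finset P} {D : J → Finset V}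
    (h : Forest G c C D) {A M : Finset V} {T : Finset P}
    (hM : GoodIT G c A (univ.biUnion D) T M) (hT : Disjoint (univ.biUnion C) T) :
    ∀ {L : List V}, StarSeq G c A (univ.biUnion D) (univ.biUnion C) M L →
      (∀ x ∈ L, (M.filter (G.Adj x)).card = 1) →
      ∃ (C' : J → Finset P) (D' : J → Finset V), Forest G c C' D' ∧
        univ.biUnion C' = starParts G c (univ.biUnion C) M L ∧
        univ.biUnion D' = starVerts G (univ.biUnion D) M L ∧ ∀ j, C j ⊆ C' j ∧ D j ⊆ D' j
  | [], _, _ => ⟨C, D, h, rfl, rfl, fun _ => ⟨Subset.refl _, Subset.refl _⟩⟩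
  | x :: L, hL, hs => by
    obtain ⟨C', D', hF, hC, hD, hsub⟩ := Forest.extend h hM hT hL.2.2.2.2
      (fun z hz => hs z (by simp [hz]))
    obtain ⟨w, hw⟩ := card_eq_one.1 (hs x (by simp))
    have hwm : w ∈ M.filter (G.Adj x) := by rw [hw]; simp
    obtain ⟨hwM, hxw⟩ := mem_filter.1 hwm
    have hMS : ∀ m ∈ M, c m ∉ univ.biUnion C := fun m hm hmS =>
      Finset.disjoint_left.1 hT hmS (by rw [← hM.1.2.2]; exact mem_image_of_mem c hm)
    have hcard := (hL.2.2.2.2).card hM.1.2.1 hMS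
    have hwS : c w ∉ univ.biUnion C' := by
      rw [hC]
      intro hh
      exact hL.2.2.1 w (hcard.2.2.2 w hwM hh) hxw
    have hxS := hL.2.1
    rw [← hC] at hxS
    obtain ⟨j, _, hxj⟩ := mem_biUnion.1 hxS
    have hxD : ∀ i, ∀ v ∈ D' i, ¬ G.Adj x v := by
      intro i v hv
      apply hL.2.2.1
      rw [← hD]
      exact mem_biUnion.2 ⟨i, mem_univ _, hv⟩
    have hwD : ∀ i, ∀ v ∈ D' i, ¬ G.Adj w v := by
      intro i v hv hwv
      have hv' : v ∈ starVerts G (univ.biUnion D) M L := by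
        rw [← hD]
        exact mem_biUnion.2 ⟨i, mem_univ _, hv⟩
      rcases mem_starVerts hv' with hv | hv | hv
      · exact hM.2.2 w hwM v hv hwv
      · exact hL.2.2.1 w ((starVerts_subset_cons hv).2 (by simp [hwM, hwv.symm])) hxw
      · exact hM.1.1 w hwM v hv hwv
    have hwC : ∀ i, c w ∉ C' i := fun i hi => hwS (mem_biUnion.2 ⟨i, mem_univ _, hi⟩)
    refine ⟨Function.update C' j (insert (c w) (C' j)),
      Function.update D' j (insert x (insert w (D' j))), ⟨?_, ?_, ?_⟩, ?_, ?_, ?_⟩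
    · intro i
      by_cases hij : i = j
      · subst hij
        simp only [Function.update_self]
        exact (hF.tree i).grow hxj (hwC i) hxw (hxD i) (hwD i)
      · simp only [Function.update_of_ne hij]
        exact hF.tree i
    · have key : ∀ i, i ≠ j → Disjoint (C' i) (insert (c w) (C' j)) := by
        intro i hij
        rw [disjoint_insert_right]
        exact ⟨hwC i, hF.disj i j hij⟩
      intro i i' hii
      by_cases hij : i = j
      · subst hij
        rw [Function.update_self, Function.update_of_ne hii.symm]
        exact (key i' hii.symm).symm
      · by_cases hij' : i' = j
        · subst hij'
          rw [Function.update_self, Function.update_of_ne hij]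
          exact key i hij
        · rw [Function.update_of_ne hij, Function.update_of_ne hij']
          exact hF.disj i i' hii
    · have key : ∀ i, i ≠ j → ∀ v ∈ D' i, ∀ z ∈ insert x (insert w (D' j)), ¬ G.Adj v z := by
        intro i hij v hv z hz
        rcases mem_insert.1 hz with rfl | hz
        · exact fun hh => hxD i v hv hh.symm
        rcases mem_insert.1 hz with rfl | hz
        · exact fun hh => hwD i v hv hh.symm
        exact hF.nadj i j hij v hv z hz
      intro i i' hii
      by_cases hij : i = j
      · subst hij
        rw [Function.update_self, Function.update_of_ne hii.symm]
        exact fun v hv z hz hh => key i' hii.symm z hz v hv hh.symm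
      · by_cases hij' : i' = j
        · subst hij'
          rw [Function.update_self, Function.update_of_ne hij]
          exact key i hij
        · rw [Function.update_of_ne hij, Function.update_of_ne hij']
          exact hF.nadj i i' hii
    · rw [starParts, hw, ← hC]
      ext p
      simp only [mem_biUnion, mem_univ, true_and, image_singleton, mem_union, mem_singleton]
      constructor
      · rintro ⟨i, hi⟩
        by_cases hij : i = j
        · subst hij
          rw [Function.update_self, mem_insert] at hi
          exact hi.imp id (fun hi => ⟨i, hi⟩)
        · rw [Function.update_of_ne hij] at hi
          exact Or.inr ⟨i, hi⟩
      · rintro (rfl | ⟨i, hi⟩)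
        · exact ⟨j, by simp⟩
        · refine ⟨i, ?_⟩
          by_cases hij : i = j
          · subst hij; simp [hi]
          · rwa [Function.update_of_ne hij]
    · rw [starVerts, hw, ← hD]
      ext p
      simp only [mem_biUnion, mem_univ, true_and, mem_union, mem_singleton, mem_insert]
      constructor
      · rintro ⟨i, hi⟩
        by_cases hij : i = j
        · subst hij
          rw [Function.update_self, mem_insert, mem_insert] at hi
          rcases hi with hi | hi | hi
          · exact Or.inl (Or.inl hi)
          · exact Or.inl (Or.inr hi)
          · exact Or.inr ⟨i, hi⟩
        · rw [Function.update_of_ne hij] at hi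
          exact Or.inr ⟨i, hi⟩
      · rintro ((rfl | rfl) | ⟨i, hi⟩)
        · exact ⟨j, by simp⟩
        · exact ⟨j, by simp⟩
        · refine ⟨i, ?_⟩
          by_cases hij : i = j
          · subst hij; simp [hi]
          · rwa [Function.update_of_ne hij]
    · intro i
      by_cases hij : i = j
      · subst hij
        simp only [Function.update_self]
        exact ⟨(hsub i).1.trans (subset_insert _ _),
          (hsub i).2.trans ((subset_insert _ _).trans (subset_insert _ _))⟩
      · simp only [Function.update_of_ne hij]
        exact hsub i

/-! ### Deficiency and domination counts. -/

/-- The deficiency version of Haxell's theorem. -/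
theorem exists_dominated {T : Finset P} {A : Finset V} {e : ℕ}
    (hno : ∀ U ⊆ T, ∀ M ⊆ A, FullIT G c U M → U.card + e < T.card) :
    ∃ T' ⊆ T, ∃ K : Finset V, K.card + 2 * (e + 1) ≤ 2 * T'.card ∧
      ∀ y ∈ A, c y ∈ T' → ∃ v ∈ K, G.Adj y v := by
  have hex : ∃ m, ∃ U ⊆ T, ∃ M ⊆ A, FullIT G c U M ∧ T.card - U.card = m :=
    ⟨_, ∅, by simp, ∅, by simp, ⟨by simp, by simp, by simp⟩, rfl⟩
  -- Take a transversal missing as few parts of `T` as possible. The missed parts, at least `e + 1`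
  -- of them, form a base without vertices; each of them lowers the bound `2|T'|` by two.
  obtain ⟨U, hU, M, hMA, hM, hm⟩ := Nat.find_spec hex
  have hmin : ∀ U' ⊆ T, ∀ M' ⊆ A, FullIT G c U' M' → T.card - U.card ≤ T.card - U'.card := by
    intro U' hU' M' hM'A hM'
    rw [hm]
    exact Nat.find_min' hex ⟨U', hU', M', hM'A, hM', rfl⟩
  have hlt := hno U hU M hMA hM
  obtain ⟨M', L, hM', hcl⟩ := exists_closed (G := G) (c := c) (A := A) (V₀ := ∅) (S₀ := T \ U)
    (T := U) (by
      intro M hM x hxA hxc _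
      rw [nonempty_iff_ne_empty]
      intro hne
      obtain ⟨hxT, hxU⟩ := mem_sdiff.1 hxc
      have := hM.1.insert (y := x) (fun m hm hxm => by
        have : m ∈ M.filter (G.Adj x) := by simp [hm, hxm]
        rw [hne] at this
        simp at this) hxU
      have := hmin _ (insert_subset hxT hU) _ (insert_subset hxA hM.2.1) this
      rw [card_insert_of_notMem hxU] at this
      omega) sdiff_disjoint (M := M) ⟨hM, hMA, by simp⟩
  have hMS : ∀ m ∈ M', c m ∉ T \ U := fun m hm hmS =>
    (mem_sdiff.1 hmS).2 (by rw [← hM'.1.2.2]; exact mem_image_of_mem c hm)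
  have hcard := hcl.1.card hM'.1.2.1 hMS
  refine ⟨starParts G c (T \ U) M' L, ?_, starVerts G ∅ M' L, ?_, fun y hyA hyc => hcl.2 y hyA hyc⟩
  · refine starParts_subset.trans ?_
    rw [hM'.1.2.2]
    exact union_subset sdiff_subset hU
  · have h1 := card_sdiff_add_card_eq_card hU
    have h2 := hcard.1
    have h3 := hcard.2.1
    rw [card_empty] at h2
    omega

section Count

variable [Fintype V] {n Δ : ℕ}

/-- A set `K` dominates at most `Δ|K|` vertices. -/
theorem card_dominated_le (hΔ : ∀ v, (univ.filter (G.Adj v)).card ≤ Δ) (K : Finset V) :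
    (univ.filter (fun y => ∃ v ∈ K, G.Adj y v)).card ≤ Δ * K.card := by
  have : univ.filter (fun y => ∃ v ∈ K, G.Adj y v) ⊆ K.biUnion (fun v => univ.filter (G.Adj v)) := by
    intro y hy
    obtain ⟨_, v, hv, hyv⟩ := mem_filter.1 hy
    exact mem_biUnion.2 ⟨v, hv, by simp [hyv.symm]⟩
  refine (card_le_card this).trans (card_biUnion_le.trans ?_)
  rw [mul_comm]
  exact (sum_le_card_nsmul _ _ _ (fun v _ => hΔ v)).trans (by simp)

theorem card_parts_ge (hn : ∀ p, n ≤ (univ.filter (fun v => c v = p)).card) (S : Finset P) :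
    n * S.card ≤ (univ.filter (fun v => c v ∈ S)).card := by
  have : univ.filter (fun v => c v ∈ S) = S.biUnion (fun p => univ.filter (fun v => c v = p)) := by
    ext v; simp
  rw [this, card_biUnion]
  · rw [mul_comm]
    exact le_trans (by simp) (card_nsmul_le_sum S _ n (fun p _ => hn p))
  · intro p _ p' _ hpp
    show Disjoint _ _
    rw [Finset.disjoint_left]
    intro v hv hv'
    exact hpp ((mem_filter.1 hv).2.symm.trans (mem_filter.1 hv').2)

theorem count_of_dominated (hΔ : ∀ v, (univ.filter (G.Adj v)).card ≤ Δ)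
    (hn : ∀ p, n ≤ (univ.filter (fun v => c v = p)).card) {S : Finset P} {K : Finset V}
    (h : ∀ y, c y ∈ S → ∃ v ∈ K, G.Adj y v) : n * S.card ≤ Δ * K.card := by
  refine (card_parts_ge hn S).trans (le_trans (card_le_card ?_) (card_dominated_le hΔ K))
  intro y hy
  simp only [mem_filter, mem_univ, true_and] at hy ⊢
  exact h y hy

/-- The neighbours of `D` outside the parts `S`. -/
noncomputable def outNbrs (G : SimpleGraph V) (c : V → P) (S : Finset P) (D : Finset V) : Finset V :=
  univ.filter (fun y => c y ∉ S ∧ ∃ v ∈ D, G.Adj y v)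

/-- The neighbours of `D` inside the parts `S`. -/
noncomputable def inNbrs (G : SimpleGraph V) (c : V → P) (S : Finset P) (D : Finset V) : Finset V :=
  univ.filter (fun y => c y ∈ S ∧ ∃ v ∈ D, G.Adj y v)

theorem card_out_add_in (hΔ : ∀ v, (univ.filter (G.Adj v)).card ≤ Δ) (S : Finset P) (D : Finset V) :
    (outNbrs G c S D).card + (inNbrs G c S D).card ≤ Δ * D.card := by
  refine le_trans (le_of_eq ?_) (card_dominated_le hΔ D)
  rw [← card_union_of_disjoint]
  · congr 1
    ext y
    by_cases hy : c y ∈ S <;> simp [outNbrs, inNbrs, hy]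
  · rw [Finset.disjoint_left]
    intro y h1 h2
    exact (mem_filter.1 h1).2.1 (mem_filter.1 h2).2.1

/-- Apply `exists_dominated` to the non-neighbours of `D`. A bad family of `t` parts would have its
at least `n t` vertices among the outside neighbours of `D` and the neighbours of at most `2(t - e -
1)` further vertices, which `h` excludes. -/
theorem exists_outer [Fintype P] (hΔ : ∀ v, (univ.filter (G.Adj v)).card ≤ Δ)
    (hn : ∀ p, n ≤ (univ.filter (fun v => c v = p)).card) (S : Finset P) (D : Finset V) (e : ℕ)
    (h : ∀ t, e + 1 ≤ t → t + S.card ≤ Fintype.card P →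
      (outNbrs G c S D).card + 2 * Δ * t < n * t + 2 * Δ * (e + 1)) :
    ∃ U M, Disjoint S U ∧ Fintype.card P ≤ S.card + U.card + e ∧ FullIT G c U M ∧
      ∀ m ∈ M, ∀ v ∈ D, ¬ G.Adj m v := by
  by_contra hcon
  push Not at hcon
  obtain ⟨T', hT', K, hK, hdom⟩ := exists_dominated (G := G) (c := c) (T := Sᶜ)
    (A := univ.filter (fun y => ∀ v ∈ D, ¬ G.Adj y v)) (e := e) (by
      intro U hU M hM hF
      by_contra hlt
      push Not at hlt
      rw [card_compl] at hlt
      obtain ⟨m, hm, v, hv, hmv⟩ := hcon U M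
        (Finset.disjoint_left.2 (fun p hp hpU => (mem_compl.1 (hU hpU)) hp)) (by omega) hF
      exact (mem_filter.1 (hM hm)).2 v hv hmv)
  have h1 := h T'.card (by omega) (by
    have := card_le_card hT'
    rw [card_compl] at this
    have := card_le_univ S
    omega)
  have h2 := card_parts_ge hn T'
  have h3 : univ.filter (fun v => c v ∈ T') ⊆ outNbrs G c S D ∪
      univ.filter (fun y => ∃ v ∈ K, G.Adj y v) := by
    intro y hy
    have hyT := (mem_filter.1 hy).2
    by_cases hyD : ∃ v ∈ D, G.Adj y v
    · exact mem_union_left _ (by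
        simp only [outNbrs, mem_filter, mem_univ, true_and]
        exact ⟨mem_compl.1 (hT' hyT), hyD⟩)
    · push Not at hyD
      exact mem_union_right _ (by
        simp only [mem_filter, mem_univ, true_and]
        exact hdom y (by simpa using hyD) hyT)
  have h4 := (card_le_card h3).trans (card_union_le _ _)
  have h5 := card_dominated_le hΔ K
  have h6 : Δ * K.card + 2 * Δ * (e + 1) ≤ 2 * Δ * T'.card := by nlinarith
  omega

end Count
end PartialIT

/-! ### Edge-critical graphs on an odd number of parts. -/

namespace PartialIT

open Finset
open scoped Classical

/-- If every element of a finite set has a predecessor in it, then some nonempty subset is permuted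
by taking predecessors, which are unique there. -/
theorem exists_cycle_set {ι : Type*} (R : ι → ι → Prop) (E : Finset ι) (hE : E.Nonempty)
    (hR : ∀ e ∈ E, ∃ f ∈ E, R e f) :
    ∃ E' ⊆ E, E'.Nonempty ∧ ∃ f : ι → ι, (∀ e ∈ E', f e ∈ E' ∧ R e (f e)) ∧
      (∀ g ∈ E', ∃ e ∈ E', f e = g) ∧ ∀ e ∈ E', ∀ g ∈ E', R e g → g = f e := by
  have hex : ∃ m, ∃ E' ⊆ E, E'.Nonempty ∧ (∀ e ∈ E', ∃ f ∈ E', R e f) ∧ E'.card = m :=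
    ⟨_, E, Subset.refl _, hE, hR, rfl⟩
  -- In a smallest subset closed under having predecessors, every choice of predecessors is onto,
  -- since its image is again such a subset.
  obtain ⟨E', hE', hne, hcl, hcard⟩ := Nat.find_spec hex
  have himg : ∀ f : ι → ι, (∀ e ∈ E', f e ∈ E' ∧ R e (f e)) → E'.image f = E' := by
    intro f hf
    have hsub : E'.image f ⊆ E' := by
      intro x hx
      obtain ⟨e, he, rfl⟩ := mem_image.1 hx
      exact (hf e he).1
    apply eq_of_subset_of_card_le hsub
    rw [hcard]
    apply Nat.find_min' hex
    refine ⟨_, hsub.trans hE', hne.image f, ?_, rfl⟩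
    intro e he
    have := hsub he
    exact ⟨f e, mem_image_of_mem f this, (hf e this).2⟩
  choose! f hf using hcl
  refine ⟨E', hE', hne, f, hf, ?_, ?_⟩
  · intro g hg
    rw [← himg f hf] at hg
    exact mem_image.1 hg
  · intro e he g hg hR
    by_contra hgf
    -- A second predecessor of `e` would give another choice of predecessors, whose image no longer
    -- contains `f e`.
    have h2 := himg (Function.update f e g) (by
      intro x hx
      by_cases hxe : x = e
      · subst hxe; simp [hg, hR]
      · rw [Function.update_of_ne hxe]; exact hf x hx)
    have hinj : Set.InjOn f (E' : Set ι) := by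
      apply Finset.injOn_of_card_image_eq
      rw [himg f hf]
    have h3 := (hf e he).1
    rw [← h2] at h3
    obtain ⟨x, hx, hxe⟩ := mem_image.1 h3
    by_cases hxe' : x = e
    · subst hxe'
      simp at hxe
      exact hgf hxe
    · rw [Function.update_of_ne hxe'] at hxe
      exact hxe' (hinj hx he hxe)

theorem card_inter_gt {V : Type*} {A B N : Finset V} {Δ : ℕ} (hA : A ⊆ N) (hB : B ⊆ N) (hN : N.card ≤ Δ)
    (h1 : 2 * Δ < 3 * A.card) (h2 : 2 * Δ < 3 * B.card) : Δ < 3 * (A ∩ B).card := by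
  have h3 := card_union_add_card_inter A B
  have h4 := card_le_card (union_subset hA hB)
  omega

variable {V P : Type*} [Fintype V]

/-- A graph without transversal of the `2h+1` parts `C` in which every edge is critical. -/
structure Critical (G : SimpleGraph V) (c : V → P) (C : Finset P) (n Δ h : ℕ) : Prop where
  deg : ∀ v, (univ.filter (G.Adj v)).card ≤ Δ
  size : ∀ p, n ≤ (univ.filter (fun v => c v = p)).card
  proper : ∀ v w, G.Adj v w → c v ≠ c w
  card : C.card = 2 * h + 1
  three : 3 ≤ h
  large : 2 * Δ * h < n * h + Δ
  no : ∀ J : Finset V, ¬ FullIT G c C J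
  edge : ∀ v w, G.Adj v w → ∃ J : Finset V, v ∈ J ∧ w ∈ J ∧ Set.InjOn c (J : Set V) ∧ J.image c = C ∧
    ∀ x ∈ J, ∀ y ∈ J, G.Adj x y → (x = v ∧ y = w) ∨ (x = w ∧ y = v)

/-- The vertices in the parts `C` whose only neighbour in `D` is `v`. -/
noncomputable def excl (G : SimpleGraph V) (c : V → P) (C : Finset P) (D : Finset V) (v : V) :
    Finset V :=
  univ.filter (fun y => c y ∈ C ∧ G.Adj y v ∧ ∀ x ∈ D, G.Adj y x → x = v)

theorem mem_excl {G : SimpleGraph V} {c : V → P} {C : Finset P} {D : Finset V} {v y : V} :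
    y ∈ excl G c C D v ↔ c y ∈ C ∧ G.Adj y v ∧ ∀ x ∈ D, G.Adj y x → x = v := by
  simp [excl]

theorem card_excl_ge {G : SimpleGraph V} {c : V → P} {C : Finset P} {D : Finset V} {n Δ : ℕ}
    (hΔ : ∀ v, (univ.filter (G.Adj v)).card ≤ Δ)
    (hn : ∀ p, n ≤ (univ.filter (fun v => c v = p)).card)
    (hdom : ∀ y, c y ∈ C → ∃ v ∈ D, G.Adj y v) (v : V) :
    n * C.card ≤ (excl G c C D v).card + Δ * (D.erase v).card := by
  have h2 : univ.filter (fun v => c v ∈ C) ⊆ excl G c C D v ∪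
      univ.filter (fun y => ∃ x ∈ D.erase v, G.Adj y x) := by
    intro y hy
    have hyC := (mem_filter.1 hy).2
    by_cases hyv : ∃ x ∈ D.erase v, G.Adj y x
    · exact mem_union_right _ (by simpa using hyv)
    · push Not at hyv
      obtain ⟨x, hx, hyx⟩ := hdom y hyC
      have hun : ∀ x ∈ D, G.Adj y x → x = v := by
        intro x hx hyx
        by_contra hne
        exact hyv x (mem_erase.2 ⟨hne, hx⟩) hyx
      refine mem_union_left _ (mem_excl.2 ⟨hyC, ?_, hun⟩)
      rwa [← hun x hx hyx]
  exact ((card_parts_ge hn C).trans ((card_le_card h2).trans (card_union_le _ _))).trans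
    (Nat.add_le_add_left (card_dominated_le hΔ _) _)

namespace Critical

variable {G : SimpleGraph V} {c : V → P} {C : Finset P} {n Δ h : ℕ} {D : Finset V}

theorem dominates (H : Critical G c C n Δ h) (hD : IMC G c C D) {y : V} (hy : c y ∈ C) :
    ∃ v ∈ D, G.Adj y v := by
  by_contra hcon
  push Not at hcon
  obtain ⟨M, hMD, hM⟩ := hD.select (c y) hy
  have := hM.insert (y := y) (fun m hm => hcon m (hMD hm)) (by simp)
  rw [insert_erase hy] at this
  exact H.no _ this

/-- The `4h` vertices of `D` dominate `2h + 1` parts of more than `(2 - 1/h)Δ` vertices each. Hence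
each vertex of `D` privately dominates more than `(1 - 1/h)Δ`, and `h ≥ 3`. -/
theorem card_excl (H : Critical G c C n Δ h) (hD : IMC G c C D) {v : V} (hv : v ∈ D) :
    2 * Δ < 3 * (excl G c C D v).card := by
  have h1 := card_excl_ge H.deg H.size (fun y hy => H.dominates hD hy) v
  have h5 : (D.erase v).card + 1 = 4 * h := by
    rw [card_erase_add_one hv]
    have := hD.card
    rw [H.card] at this
    omega
  rw [H.card] at h1
  have h6 : n * (2 * h + 1) + Δ ≤ (excl G c C D v).card + Δ * (4 * h) := by
    have : Δ * (4 * h) = Δ * (D.erase v).card + Δ := by rw [← h5]; ring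
    omega
  have h7 := H.large
  have h8 := H.three
  have h9 : Δ * h < h * (excl G c C D v).card + Δ := by nlinarith
  nlinarith

/-- If `a'` were on the side of `b`, the transversal rooted at the part of `a'` would not use `b`,
the only neighbour of `a'` in `D`, and adding `a'` would complete it. -/
theorem cut_ne (H : Critical G c C n Δ h) (hD : IMC G c C D) {a b a' : V} (ha : a ∈ D) (hb : b ∈ D)
    (hab : G.Adj a b) (ha' : a' ∈ excl G c C D b) {φ : P → ZMod 2}
    (hφ : IMC.Cut G c D a b φ) : φ (c a') ≠ φ (c b) := by
  intro heq
  obtain ⟨hC, _, hu⟩ := mem_excl.1 ha'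
  obtain ⟨M, hMD, hM⟩ := hD.select (c a') hC
  have hbM := hD.not_mem_of_cut ha hb hab hφ heq hMD hM
  have := hM.insert (y := a') (fun m hm hadj => hbM (hu m (hMD hm) hadj ▸ hm)) (by simp)
  rw [insert_erase hC] at this
  exact H.no _ this

theorem swap (H : Critical G c C n Δ h) (hD : IMC G c C D) {a b a' : V} (ha : a ∈ D) (hb : b ∈ D)
    (hab : G.Adj a b) (ha' : a' ∈ excl G c C D b) : IMC G c C (insert a' (D.erase a)) := by
  obtain ⟨φ, hφ⟩ := hD.exists_cut ha hb hab
  obtain ⟨hC, hadj, hu⟩ := mem_excl.1 ha'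
  exact hD.swap ha hb hab hC hadj hu hφ (H.cut_ne hD ha hb hab ha' hφ)

/-- After `a` is exchanged for `a'` the matching still dominates. The vertex `b'` has lost its only
neighbour `a` in `D`, so it must be adjacent to `a'`. -/
theorem complete (H : Critical G c C n Δ h) (hD : IMC G c C D) {a b a' b' : V} (ha : a ∈ D)
    (hb : b ∈ D) (hab : G.Adj a b) (ha' : a' ∈ excl G c C D b) (hb' : b' ∈ excl G c C D a) :
    G.Adj a' b' := by
  obtain ⟨hC, hadj, hu⟩ := mem_excl.1 hb'
  obtain ⟨v, hv, hbv⟩ := H.dominates (H.swap hD ha hb hab ha') hC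
  rcases mem_insert.1 hv with rfl | hv
  · exact hbv.symm
  · exact absurd (hu v (mem_of_mem_erase hv) hbv) (mem_erase.1 hv).1

/-- Criticality gives a set with one vertex in each part and `vw` as its only edge. Haxell's
argument starts from the tree `vw` and the rest of this set; the count permits neither a star with
two leaves nor an end before all of `C` is reached. -/
theorem exists_imc_of_adj (H : Critical G c C n Δ h) {v w : V} (hvw : G.Adj v w) :
    ∃ D, IMC G c C D ∧ v ∈ D ∧ w ∈ D := by
  obtain ⟨J, hvJ, hwJ, hinj, himg, hJ⟩ := H.edge v w hvw
  have hcv : c v ∈ C := himg ▸ mem_image_of_mem c hvJ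
  have hcw : c w ∈ C := himg ▸ mem_image_of_mem c hwJ
  have hne := H.proper v w hvw
  have h0 : IMC G c (insert (c w) {c v}) (insert v (insert w ∅)) :=
    (IMC.single (G := G) (c := c) (c v)).grow (by simp) (by simp [hne.symm]) hvw (by simp) (by simp)
  set C₀ : Finset P := insert (c w) {c v} with hC₀
  set D₀ : Finset V := insert v (insert w ∅) with hD₀
  have hC₀C : C₀ ⊆ C := by
    rw [hC₀]
    exact insert_subset hcw (singleton_subset_iff.2 hcv)
  have hF : Forest G c (fun _ : Unit => C₀) (fun _ : Unit => D₀) :=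
    ⟨fun _ => h0, fun i j hij => absurd rfl hij, fun i j hij => absurd rfl hij⟩
  have hUC : (univ : Finset Unit).biUnion (fun _ => C₀) = C₀ := by simp
  have hUD : (univ : Finset Unit).biUnion (fun _ => D₀) = D₀ := by simp
  set T := C \ C₀ with hT
  have hdis : Disjoint C₀ T := disjoint_sdiff
  have hgood : GoodIT G c univ D₀ T (J \ D₀) := by
    refine ⟨⟨?_, ?_, ?_⟩, subset_univ _, ?_⟩
    · intro x hx y hy hxy
      rcases hJ x (mem_sdiff.1 hx).1 y (mem_sdiff.1 hy).1 hxy with ⟨rfl, rfl⟩ | ⟨rfl, rfl⟩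
      · exact (mem_sdiff.1 hx).2 (by simp [hD₀])
      · exact (mem_sdiff.1 hx).2 (by simp [hD₀])
    · exact hinj.mono (by intro x hx; exact (mem_sdiff.1 (mem_coe.1 hx)).1)
    · ext p
      simp only [mem_image, mem_sdiff, hT]
      constructor
      · rintro ⟨x, ⟨hx, hx'⟩, rfl⟩
        refine ⟨himg ▸ mem_image_of_mem c hx, ?_⟩
        intro hh
        apply hx'
        simp only [hC₀, mem_insert, mem_singleton] at hh
        rcases hh with hh | hh
        · rw [hinj hx hwJ hh]; simp [hD₀]
        · rw [hinj hx hvJ hh]; simp [hD₀]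
      · rintro ⟨hp, hp'⟩
        rw [← himg] at hp
        obtain ⟨x, hx, rfl⟩ := mem_image.1 hp
        refine ⟨x, ⟨hx, ?_⟩, rfl⟩
        intro hxD
        exact hp' (h0.color x hxD)
    · intro m hm x hx hmx
      obtain ⟨hmJ, hmD⟩ := mem_sdiff.1 hm
      have hxJ : x ∈ J := by
        simp only [hD₀, mem_insert, notMem_empty, or_false] at hx
        rcases hx with rfl | rfl <;> assumption
      rcases hJ m hmJ x hxJ hmx with ⟨rfl, rfl⟩ | ⟨rfl, rfl⟩
      · exact hmD (by simp [hD₀])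
      · exact hmD (by simp [hD₀])
  obtain ⟨M, L, hM, hcl⟩ := exists_closed (S₀ := C₀) (by
    intro M hM x _ hxc hxD
    rw [nonempty_iff_ne_empty]
    intro hempty
    obtain ⟨M₁, hM₁D, hM₁⟩ := h0.select (c x) hxc
    have h1 := hM₁.union hM.1 (hdis.mono_left (erase_subset _ _))
      (fun a ha b hb hab => hM.2.2 b hb a (hM₁D ha) hab.symm)
    have hxT : c x ∉ T := Finset.disjoint_left.1 hdis hxc
    have h2 := h1.insert (y := x) (by
      intro m hm
      rcases mem_union.1 hm with hm | hm
      · exact hxD m (hM₁D hm)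
      · intro hxm
        have : m ∈ M.filter (G.Adj x) := by simp [hm, hxm]
        rw [hempty] at this
        simp at this) (by simp [hxT])
    rw [← insert_union, insert_erase hxc, hT, union_sdiff_of_subset hC₀C] at h2
    exact H.no _ h2) hdis hgood
  have hMS : ∀ m ∈ M, c m ∉ C₀ := fun m hm hmS =>
    Finset.disjoint_left.1 hdis hmS (by rw [← hM.1.2.2]; exact mem_image_of_mem c hm)
  obtain ⟨k1, k2, k3, _⟩ := hcl.1.card hM.1.2.1 hMS
  set S := starParts G c C₀ M L with hS
  have hSC : S ⊆ C := by
    refine starParts_subset.trans ?_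
    rw [hM.1.2.2]
    exact union_subset hC₀C sdiff_subset
  have hcount := count_of_dominated H.deg H.size (S := S) (K := starVerts G D₀ M L)
    (fun y hy => hcl.2 y (mem_univ _) hy)
  have e1 : C₀.card = 2 := by rw [hC₀]; exact card_pair hne.symm
  have e2 : D₀.card = 2 := by rw [hD₀]; exact card_pair hvw.ne
  have hs : S.card ≤ 2 * h + 1 := by rw [← H.card]; exact card_le_card hSC
  have hlarge := H.large
  have hthree := H.three
  -- the stars are single edges
  have hlen : S.card = C₀.card + L.length := by
    by_contra hne
    have h1 : (starVerts G D₀ M L).card + 3 ≤ 2 * S.card := by omega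
    have h2 : Δ * (starVerts G D₀ M L).card + 3 * Δ ≤ 2 * Δ * S.card := by nlinarith
    have h3 : n * S.card + 3 * Δ ≤ 2 * Δ * S.card := by omega
    have h4 : 0 < S.card := by omega
    have h5 : h * (n * S.card + 3 * Δ) ≤ h * (2 * Δ * S.card) := Nat.mul_le_mul_left _ h3
    have h6 : S.card * (2 * Δ * h) < S.card * (n * h + Δ) := Nat.mul_lt_mul_of_pos_left hlarge h4
    have h7 : S.card * Δ ≤ 3 * h * Δ := Nat.mul_le_mul_right _ (by omega)
    nlinarith
  -- A set of `2(s - 1)` vertices cannot dominate `s ≤ 2h` parts of more than `(2 - 1/h)Δ` vertices.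
  have hSC' : S = C := by
    apply eq_of_subset_of_card_le hSC
    rw [H.card]
    by_contra hlt
    have h1 : (starVerts G D₀ M L).card + 2 ≤ 2 * S.card := by omega
    have h2 : Δ * (starVerts G D₀ M L).card + 2 * Δ ≤ 2 * Δ * S.card := by nlinarith
    have h3 : n * S.card + 2 * Δ ≤ 2 * Δ * S.card := by omega
    have h4 : 0 < S.card := by omega
    have h5 : h * (n * S.card + 2 * Δ) ≤ h * (2 * Δ * S.card) := Nat.mul_le_mul_left _ h3
    have h6 : S.card * (2 * Δ * h) < S.card * (n * h + Δ) := Nat.mul_lt_mul_of_pos_left hlarge h4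
    have h7 : S.card * Δ ≤ 2 * h * Δ := Nat.mul_le_mul_right _ (by omega)
    nlinarith
  obtain ⟨C', D', hF', hC', hD', hsub⟩ := hF.extend (A := univ) (M := M) (T := T) (L := L)
    (by rwa [hUD]) (by rwa [hUC]) (by rw [hUD, hUC]; exact hcl.1) (k3 hlen)
  have hC'' : C' () = C := by
    rw [← hSC', hS, ← hUC, ← hC']; simp
  refine ⟨D' (), hC'' ▸ hF'.tree (), (hsub ()).2 ?_, (hsub ()).2 ?_⟩
  · simp [hD₀]
  · simp [hD₀]

/-- Two subsets of one neighbourhood, each above two thirds of `Δ`, share more than a third. This is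
used first in the neighbourhood of `a`. A common private neighbour `d'` found there is, by
`complete` in both matchings, joined to all private neighbours of `y` in `D'` and of `d` in `D`, and
the argument repeats in the neighbourhood of `d'`. -/
theorem card_inter_excl (H : Critical G c C n Δ h) (hD : IMC G c C D) {D' : Finset V}
    (hD' : IMC G c C D') {y a d : V} (ha : a ∈ D) (hd : d ∈ D) (had : G.Adj a d) (hy : y ∈ D')
    (haD' : a ∈ D') (hya : G.Adj y a) :
    Δ < 3 * (excl G c C D a ∩ excl G c C D' a).card ∧
      Δ < 3 * ((univ.filter (G.Adj y)) ∩ excl G c C D d).card := by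
  have h1 : Δ < 3 * (excl G c C D a ∩ excl G c C D' a).card := by
    refine card_inter_gt (N := univ.filter (G.Adj a)) ?_ ?_ (H.deg a) (H.card_excl hD ha)
      (H.card_excl hD' haD')
    · intro z hz; simpa using (mem_excl.1 hz).2.1.symm
    · intro z hz; simpa using (mem_excl.1 hz).2.1.symm
  refine ⟨h1, ?_⟩
  have hne : (excl G c C D a ∩ excl G c C D' a).Nonempty := card_pos.1 (by omega)
  obtain ⟨d', hd'⟩ := hne
  obtain ⟨hd1, hd2⟩ := mem_inter.1 hd'
  have h2 : Δ < 3 * (excl G c C D' y ∩ excl G c C D d).card := by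
    refine card_inter_gt (N := univ.filter (G.Adj d')) ?_ ?_ (H.deg d') (H.card_excl hD' hy)
      (H.card_excl hD hd)
    · intro z hz; simpa using H.complete hD' hy haD' hya hd2 hz
    · intro z hz; simpa using H.complete hD hd ha had.symm hd1 hz
  refine lt_of_lt_of_le h2 (Nat.mul_le_mul_left _ (card_le_card (inter_subset_inter_right ?_)))
  intro z hz; simpa using (mem_excl.1 hz).2.1.symm

/-- With two neighbours `a` and `g` in `D`, the vertex `y` sees its own private neighbours in `D'`
(over `2Δ/3`) and over `Δ/3` private neighbours of the partner `g'` of `g`. These sets are disjoint,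
since a common member would be joined both to the private neighbours of `g` and to over `Δ/3`
private neighbours of `a`. In either case a degree exceeds `Δ`. -/
theorem nbr_unique (H : Critical G c C n Δ h) (hD : IMC G c C D) {y a g : V}
    (ha : a ∈ D) (hg : g ∈ D) (hya : G.Adj y a) (hyg : G.Adj y g) : a = g := by
  by_contra hne
  obtain ⟨d, hd, had, _⟩ := hD.pair a ha
  obtain ⟨g', hg', hgg', _⟩ := hD.pair g hg
  obtain ⟨D', hD', hyD', haD'⟩ := H.exists_imc_of_adj hya
  obtain ⟨D'', hD'', hyD'', hgD''⟩ := H.exists_imc_of_adj hyg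
  have h1 := (H.card_inter_excl hD hD' ha hd had hyD' haD' hya).1
  have h2 := (H.card_inter_excl hD hD'' hg hg' hgg' hyD'' hgD'' hyg).2
  have h3 := H.card_excl hD' hyD'
  have hdisj : Disjoint (excl G c C D' y) (univ.filter (G.Adj y) ∩ excl G c C D g') := by
    rw [Finset.disjoint_left]
    intro z hz1 hz2
    have hz2 := (mem_inter.1 hz2).2
    have hsub : excl G c C D g ∪ (excl G c C D a ∩ excl G c C D' a) ⊆ univ.filter (G.Adj z) := by
      intro x hx
      rcases mem_union.1 hx with hx | hx
      · simpa using (H.complete hD hg' hg hgg'.symm hx hz2).symm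
      · simpa using (H.complete hD' hyD' haD' hya (mem_inter.1 hx).2 hz1).symm
    have h4 := (card_le_card hsub).trans (H.deg z)
    rw [card_union_of_disjoint] at h4
    · have := H.card_excl hD hg
      omega
    · rw [Finset.disjoint_left]
      intro x hx1 hx2
      exact hne ((mem_excl.1 hx1).2.2 a ha (mem_excl.1 (mem_inter.1 hx2).1).2.1)
  have hsub : excl G c C D' y ∪ (univ.filter (G.Adj y) ∩ excl G c C D g') ⊆
      univ.filter (G.Adj y) := by
    refine union_subset ?_ inter_subset_left
    intro z hz; simpa using (mem_excl.1 hz).2.1.symm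
  have h4 := (card_le_card hsub).trans (H.deg y)
  rw [card_union_of_disjoint hdisj] at h4
  omega

theorem exists_excl (H : Critical G c C n Δ h) (hD : IMC G c C D) {y : V} (hy : c y ∈ C) :
    ∃ v ∈ D, y ∈ excl G c C D v := by
  obtain ⟨v, hv, hyv⟩ := H.dominates hD hy
  exact ⟨v, hv, mem_excl.2 ⟨hy, hyv, fun x hx hyx => H.nbr_unique hD hx hv hyx hyv⟩⟩

end Critical
end PartialIT

/-! ### An edge whose cut is respected, and the odd case. -/

namespace PartialIT

open Finset
open scoped Classical

variable {V P : Type*}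

theorem IMC.exists_reps {G : SimpleGraph V} {c : V → P} {C : Finset P} {D : Finset V}
    (h : IMC G c C D) (hC : C.Nonempty) {p : V → V} (hp : ∀ v ∈ D, p v ∈ D)
    (hadj : ∀ v ∈ D, G.Adj v (p v)) (hpp : ∀ v ∈ D, p (p v) = v) :
    ∃ R ⊆ D, 2 * R.card = D.card ∧ (∀ v ∈ R, p v ∉ R) ∧ ∀ v ∈ D, v ∈ R ∨ p v ∈ R := by
  obtain ⟨u, hu⟩ := hC
  obtain ⟨R, hRD, hR⟩ := h.select u hu
  have hcard : R.card + 1 = C.card := by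
    rw [← card_image_of_injOn hR.2.1, hR.2.2, card_erase_add_one hu]
  have h2 := h.card
  have hn : ∀ v ∈ R, p v ∉ R := fun v hv hpv => hR.1 v hv _ hpv (hadj v (hRD hv))
  refine ⟨R, hRD, by omega, hn, ?_⟩
  have hinj : Set.InjOn p (R : Set V) := by
    intro v hv w hw hvw
    rw [← hpp v (hRD hv), ← hpp w (hRD hw), hvw]
  have hdis : Disjoint R (R.image p) := by
    rw [Finset.disjoint_left]
    intro v hv hv'
    obtain ⟨w, hw, rfl⟩ := mem_image.1 hv'
    exact hn w hw hv
  have heq : R ∪ R.image p = D := by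
    apply eq_of_subset_of_card_le
    · refine union_subset hRD ?_
      intro v hv
      obtain ⟨w, hw, rfl⟩ := mem_image.1 hv
      exact hp w (hRD hw)
    · rw [card_union_of_disjoint hdis, card_image_of_injOn hinj]
      omega
  intro v hv
  rw [← heq] at hv
  rcases mem_union.1 hv with hv | hv
  · exact Or.inl hv
  · obtain ⟨w, hw, rfl⟩ := mem_image.1 hv
    right
    rwa [hpp w (hRD hw)]

namespace Critical

variable [Fintype V] {G : SimpleGraph V} {c : V → P} {C : Finset P} {n Δ h : ℕ} {D : Finset V}

/-- Swaps can be made one after another because, by `nbr_unique`, a vertex with a neighbour in the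
current matching has no other one there, so private neighbours stay private. -/
theorem swaps (H : Critical G c C n Δ h) (hD : IMC G c C D) {ι : Type*} (F : Finset ι)
    {d b y : ι → V} (hd : ∀ g ∈ F, d g ∈ D) (hb : ∀ g ∈ F, b g ∈ D)
    (hdb : ∀ g ∈ F, G.Adj (d g) (b g)) (hinj : Set.InjOn d (F : Set ι))
    (hne : ∀ g ∈ F, ∀ g' ∈ F, b g ≠ d g')
    (hy : ∀ g ∈ F, y g ∈ excl G c C D (b g)) (hyD : ∀ g ∈ F, y g ∉ D) :
    IMC G c C ((D \ F.image d) ∪ F.image y) := by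
  induction F using Finset.induction_on with
  | empty => simpa using hD
  | insert g F hgF ih =>
    have hg : g ∈ insert g F := mem_insert_self _ _
    have hs : ∀ x ∈ F, x ∈ insert g F := fun x hx => mem_insert_of_mem hx
    have ih := ih (fun x hx => hd x (hs x hx)) (fun x hx => hb x (hs x hx))
      (fun x hx => hdb x (hs x hx)) (hinj.mono (by simp)) (fun x hx x' hx' =>
      hne x (hs x hx) x' (hs x' hx')) (fun x hx => hy x (hs x hx)) (fun x hx => hyD x (hs x hx))
    set D' := (D \ F.image d) ∪ F.image y with hD'
    have hdD : d g ∈ D' := by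
      refine mem_union_left _ (mem_sdiff.2 ⟨hd g hg, ?_⟩)
      intro hh
      obtain ⟨x, hx, hxg⟩ := mem_image.1 hh
      have := hinj (hs x hx) hg hxg
      exact hgF (this ▸ hx)
    have hbD : b g ∈ D' := by
      refine mem_union_left _ (mem_sdiff.2 ⟨hb g hg, ?_⟩)
      intro hh
      obtain ⟨x, hx, hxg⟩ := mem_image.1 hh
      exact hne g hg x (hs x hx) hxg.symm
    obtain ⟨h1, h2, _⟩ := mem_excl.1 (hy g hg)
    have := H.swap ih hdD hbD (hdb g hg) (a' := y g)
      (mem_excl.2 ⟨h1, h2, fun x hx hyx => H.nbr_unique ih hx hbD hyx h2⟩)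
    convert this using 1
    ext v
    simp only [hD', image_insert, mem_union, mem_sdiff, mem_insert, mem_erase]
    constructor
    · rintro (⟨h1, h2⟩ | h1 | h1)
      · push Not at h2
        exact Or.inr ⟨h2.1, Or.inl ⟨h1, h2.2⟩⟩
      · exact Or.inl h1
      · refine Or.inr ⟨?_, Or.inr h1⟩
        rintro rfl
        obtain ⟨x, hx, hxg⟩ := mem_image.1 h1
        exact hyD x (hs x hx) (hxg ▸ hd g hg)
    · rintro (h1 | ⟨h1, h2 | h2⟩)
      · exact Or.inr (Or.inl h1)
      · refine Or.inl ⟨h2.1, ?_⟩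
        rintro (h3 | h3)
        · exact h1 h3
        · exact h2.2 h3
      · exact Or.inr (Or.inr h2)

/-- If every edge `e` had its cut violated by a private neighbour at another edge `g`, there would
be a cyclic set of such violations. Carrying out all swaps of the cycle at once yields a tree
matching, but the sum of the cut potentials shows that it is not connected. -/
theorem exists_top (H : Critical G c C n Δ h) (hD : IMC G c C D) :
    ∃ a ∈ D, ∃ b ∈ D, G.Adj a b ∧ ∃ φ, IMC.Cut G c D a b φ ∧
      ∀ v ∈ D, v ≠ a → v ≠ b → ∀ y ∈ excl G c C D v, φ (c y) = φ (c v) := by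
  obtain ⟨p, hp, hadj, huniq, hpp, hpne⟩ := hD.exists_partner
  have hCn : C.Nonempty := card_pos.1 (by rw [H.card]; omega)
  obtain ⟨R, hRD, hRcard, hRp, hRcov⟩ := hD.exists_reps hCn hp hadj hpp
  have hcut : ∀ e, ∃ φ, e ∈ D → IMC.Cut G c D e (p e) φ := by
    intro e
    by_cases he : e ∈ D
    · obtain ⟨φ, hφ⟩ := hD.exists_cut he (hp e he) (hadj e he)
      exact ⟨φ, fun _ => hφ⟩
    · exact ⟨0, fun h => absurd h he⟩
  choose φ hφ using hcut
  -- An edge is represented by its end in `R`. The relation says that the edge `g` has an end `d`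
  -- for which some replacement `y` lies across the cut of `e` from `d`.
  let Rel : V → V → Prop := fun e g => g ≠ e ∧ ∃ d ∈ D, (d = g ∨ p d = g) ∧
    ∃ y ∈ excl G c C D (p d), φ e (c y) ≠ φ e (c d)
  by_cases hall : ∀ e ∈ R, ∃ g ∈ R, Rel e g
  swap
  · push Not at hall
    obtain ⟨e, he, hno⟩ := hall
    have heD := hRD he
    refine ⟨e, heD, p e, hp e heD, hadj e heD, φ e, hφ e heD, ?_⟩
    intro v hv hve hvp y hy
    by_contra hne
    have hcutv := (hφ e heD).1 v hv (p v) (hp v hv) (hadj v hv) hve hvp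
    have key : φ e (c y) ≠ φ e (c (p v)) := by rwa [← hcutv]
    have hy' : y ∈ excl G c C D (p (p v)) := by rwa [hpp v hv]
    rcases hRcov v hv with hR | hR
    · exact hno v hR ⟨hve, p v, hp v hv, Or.inr (hpp v hv), y, hy', key⟩
    · refine hno (p v) hR ⟨?_, p v, hp v hv, Or.inl rfl, y, hy', key⟩
      intro hh
      exact hvp (by rw [← hh, hpp v hv])
  exfalso
  have hRn : R.Nonempty := by
    rw [nonempty_iff_ne_empty]
    rintro rfl
    have h1 := hD.card
    have h2 := H.card
    have h3 := H.three
    rw [card_empty] at hRcard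
    omega
  obtain ⟨E, hER, hEn, f, hf, hsurj, hfuniq⟩ := exists_cycle_set Rel R hRn hall
  have hfinj : Set.InjOn f (E : Set V) := by
    apply Finset.injOn_of_card_image_eq
    congr 1
    ext g
    simp only [mem_image]
    constructor
    · rintro ⟨e, he, rfl⟩; exact (hf e he).1
    · exact hsurj g
  have hdata : ∀ g, ∃ e d y, g ∈ E → (e ∈ E ∧ f e = g ∧ g ≠ e ∧ d ∈ D ∧ (d = g ∨ p d = g) ∧
      y ∈ excl G c C D (p d) ∧ φ e (c y) ≠ φ e (c d)) := by
    intro g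
    by_cases hg : g ∈ E
    · obtain ⟨e, he, hfe⟩ := hsurj g hg
      obtain ⟨_, hne, d, hd, hdg, y, hy, hyd⟩ := hf e he
      rw [hfe] at hne hdg
      exact ⟨e, d, y, fun _ => ⟨he, hfe, hne, hd, hdg, hy, hyd⟩⟩
    · exact ⟨g, g, g, fun h => absurd h hg⟩
  choose e d y hdat using hdata
  have hED : ∀ g ∈ E, g ∈ D := fun g hg => hRD (hER hg)
  have hd : ∀ g ∈ E, d g ∈ D := fun g hg => (hdat g hg).2.2.2.1
  have hdg : ∀ g ∈ E, (d g = g ∧ p (d g) = p g) ∨ (d g = p g ∧ p (d g) = g) := by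
    intro g hg
    rcases (hdat g hg).2.2.2.2.1 with h | h
    · exact Or.inl ⟨h, by rw [h]⟩
    · exact Or.inr ⟨(hpp _ (hd g hg)).symm.trans (congrArg p h), h⟩
  have hRR : ∀ g ∈ E, ∀ g' ∈ E, g ≠ p g' := fun g hg g' hg' hh =>
    hRp g' (hER hg') (hh ▸ hER hg)
  have hpinj : ∀ v ∈ D, ∀ w ∈ D, p v = p w → v = w := fun v hv w hw hh => by
    rw [← hpp v hv, ← hpp w hw, hh]
  have hdinj : Set.InjOn d (E : Set V) := by
    intro g hg g' hg' hh
    rcases hdg g hg with ⟨h1, _⟩ | ⟨h1, _⟩ <;> rcases hdg g' hg' with ⟨h2, _⟩ | ⟨h2, _⟩ <;>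
      rw [h1, h2] at hh
    · exact hh
    · exact absurd hh (hRR g hg g' hg')
    · exact absurd hh.symm (hRR g' hg' g hg)
    · exact hpinj g (hED g hg) g' (hED g' hg') hh
  have hbd : ∀ g ∈ E, ∀ g' ∈ E, p (d g) ≠ d g' := by
    intro g hg g' hg' hh
    have hgg : g = g' := by
      rcases hdg g hg with ⟨_, h1⟩ | ⟨_, h1⟩ <;> rcases hdg g' hg' with ⟨h2, _⟩ | ⟨h2, _⟩ <;>
        rw [h1, h2] at hh
      · exact absurd hh.symm (hRR g' hg' g hg)
      · exact hpinj g (hED g hg) g' (hED g' hg') hh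
      · exact hh
      · exact absurd hh (hRR g hg g' hg')
    subst hgg
    exact hpne _ (hd g hg) hh
  have hy : ∀ g ∈ E, y g ∈ excl G c C D (p (d g)) := fun g hg => (hdat g hg).2.2.2.2.2.1
  have hyD : ∀ g ∈ E, y g ∉ D := by
    intro g hg hyD
    have h1 := huniq _ (hp _ (hd g hg)) _ hyD (mem_excl.1 (hy g hg)).2.1.symm
    rw [hpp _ (hd g hg)] at h1
    exact (hdat g hg).2.2.2.2.2.2 (by rw [h1])
  have hI := H.swaps hD E (d := d) (b := fun g => p (d g)) (y := y) hd
    (fun g hg => hp _ (hd g hg)) (fun g hg => hadj _ (hd g hg)) hdinj hbd hy hyD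
  set D' := (D \ E.image d) ∪ E.image y with hD'
  -- values of the potentials
  have hcutg : ∀ g ∈ E, IMC.Cut G c D (d g) (p (d g)) (φ g) := by
    intro g hg
    have := hφ g (hED g hg)
    rcases hdg g hg with ⟨h1, h2⟩ | ⟨h1, h2⟩
    · rw [h2, h1]; exact this
    · rw [h2, h1]
      exact ⟨fun v hv w hw hvw h3 h4 => this.1 v hv w hw hvw h4 h3, this.2.symm⟩
  have hother : ∀ e' ∈ E, ∀ v ∈ D, ∀ w ∈ D, G.Adj v w → v ≠ d e' → w ≠ d e' →
      φ e' (c v) = φ e' (c w) := by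
    intro e' he' v hv w hw hvw h1 h2
    refine (hcutg e' he').1 v hv w hw hvw h1 ?_
    rintro rfl
    apply h2
    rw [huniq _ hv _ hw hvw, hpp _ (hd e' he')]
  have hself : ∀ e' ∈ E, ∀ g ∈ E, e' ≠ g → φ e' (c (d g)) = φ e' (c (p (d g))) := by
    intro e' he' g hg hne
    exact hother e' he' _ (hd g hg) _ (hp _ (hd g hg)) (hadj _ (hd g hg))
      (fun hh => hne (hdinj hg he' hh).symm) (hbd g hg e' he')
  -- A new edge at `g` crosses exactly two cuts of the cycle, that of `g` itself and that of the
  -- unique `e` with `f e = g`, so the jumps cancel modulo two. An old edge that survives crosses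
  -- none.
  have hψ : ∀ v ∈ D', ∀ w ∈ D', G.Adj v w → ∑ e' ∈ E, φ e' (c v) = ∑ e' ∈ E, φ e' (c w) := by
    have key : ∀ g ∈ E, ∀ w ∈ D', G.Adj (y g) w →
        ∑ e' ∈ E, φ e' (c (y g)) = ∑ e' ∈ E, φ e' (c w) := by
      intro g hg w hw hyw
      have hw' : w = p (d g) := by
        refine H.nbr_unique hI hw ?_ hyw (mem_excl.1 (hy g hg)).2.1
        refine mem_union_left _ (mem_sdiff.2 ⟨hp _ (hd g hg), ?_⟩)
        intro hh
        obtain ⟨g', hg', hgg⟩ := mem_image.1 hh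
        exact hbd g hg g' hg' hgg.symm
      subst hw'
      obtain ⟨he0, hfe0, hne0, _, _, _, hyd⟩ := hdat g hg
      rw [← sub_eq_zero, ← sum_sub_distrib]
      have hone : ∀ a b : ZMod 2, a ≠ b → a - b = 1 := by decide
      have : ∀ e' ∈ E, φ e' (c (y g)) - φ e' (c (p (d g))) =
          (if e' = g then 1 else 0) + (if e' = e g then 1 else 0) := by
        intro e' he'
        by_cases h1 : e' = g
        · subst h1
          rw [if_pos rfl, if_neg hne0, add_zero]
          exact hone _ _ (H.cut_ne hD (hd e' hg) (hp _ (hd e' hg)) (hadj _ (hd e' hg)) (hy e' hg)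
            (hcutg e' hg))
        · rw [if_neg h1, zero_add, ← hself e' he' g hg h1]
          by_cases h2 : e' = e g
          · rw [if_pos h2, h2]
            exact hone _ _ hyd
          · rw [if_neg h2, sub_eq_zero]
            by_contra h3
            have h4 : Rel e' g := ⟨fun hh => h1 hh.symm, d g, hd g hg,
              (hdat g hg).2.2.2.2.1, y g, hy g hg, h3⟩
            have h5 := hfuniq e' he' g hg h4
            exact h2 (hfinj he' he0 (by rw [← h5, hfe0]))
      rw [sum_congr rfl this, sum_add_distrib, sum_ite_eq', sum_ite_eq', if_pos hg, if_pos he0]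
      decide
    intro v hv w hw hvw
    rcases mem_union.1 hv with hv' | hv'
    · rcases mem_union.1 hw with hw' | hw'
      · obtain ⟨hvD, hvd⟩ := mem_sdiff.1 hv'
        obtain ⟨hwD, hwd⟩ := mem_sdiff.1 hw'
        refine sum_congr rfl (fun e' he' => hother e' he' v hvD w hwD hvw ?_ ?_)
        · rintro rfl; exact hvd (mem_image_of_mem d he')
        · rintro rfl; exact hwd (mem_image_of_mem d he')
      · obtain ⟨g, hg, rfl⟩ := mem_image.1 hw'
        exact (key g hg v hv hvw.symm).symm
    · obtain ⟨g, hg, rfl⟩ := mem_image.1 hv'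
      exact key g hg w hw hvw
  -- Between the parts of the removed edge at `g` only the potential of `g` jumps, so the sum is not
  -- constant on `C`.
  have hconst := hI.conn (fun x => ∑ e' ∈ E, φ e' x) hψ
  obtain ⟨g, hg⟩ := hEn
  have h1 := hconst _ (hD.color _ (hd g hg)) _ (hD.color _ (hp _ (hd g hg)))
  rw [← add_sum_erase E _ hg, ← add_sum_erase E (fun e' => φ e' (c (p (d g)))) hg,
    sum_congr rfl (g := fun e' => φ e' (c (p (d g)))) (fun e' he' =>
      hself e' (mem_of_mem_erase he') g hg (ne_of_mem_erase he'))] at h1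
  exact (hcutg g hg).2 (add_right_cancel h1)

/-- Private neighbours of `a` lie across the cut and those of `b` on the side of `a`; all others
stay on the side of their matching vertex. So the side of `a`, with `s` parts, is dominated by `b`
and the `2s - 2` vertices of its own edges, which forces `s > h`. -/
theorem side_card (H : Critical G c C n Δ h) (hD : IMC G c C D) {a b : V} (ha : a ∈ D) (hb : b ∈ D)
    (hab : G.Adj a b) {φ : P → ZMod 2} (hφ : IMC.Cut G c D a b φ)
    (htop : ∀ v ∈ D, v ≠ a → v ≠ b → ∀ y ∈ excl G c C D v, φ (c y) = φ (c v)) :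
    h < (C.filter (fun p => φ p = φ (c a))).card := by
  have hφ' : IMC.Cut G c D b a φ :=
    ⟨fun v hv w hw hvw h1 h2 => hφ.1 v hv w hw hvw h2 h1, hφ.2.symm⟩
  have h1 := hD.card_side ha hb hab hφ
  set X := C.filter (fun p => φ p = φ (c a)) with hX
  set K := D.filter (fun v => φ (c v) = φ (c a) ∧ v ≠ a) with hK
  have h2 := count_of_dominated H.deg H.size (S := X) (K := insert b K) (by
    intro y hy
    obtain ⟨hyC, hyφ⟩ := mem_filter.1 hy
    obtain ⟨v, hv, hyv⟩ := H.exists_excl hD hyC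
    refine ⟨v, ?_, (mem_excl.1 hyv).2.1⟩
    by_cases hvb : v = b
    · exact mem_insert.2 (Or.inl hvb)
    · refine mem_insert_of_mem (mem_filter.2 ⟨hv, ?_⟩)
      by_cases hva : v = a
      · subst hva
        exact absurd hyφ (H.cut_ne hD hb hv hab.symm hyv hφ')
      · exact ⟨by rw [← htop v hv hva hvb y hyv, hyφ], hva⟩)
  have h3 := card_insert_le b K
  by_contra hlt
  push Not at hlt
  have hlarge := H.large
  have h4 : 0 < X.card := card_pos.2 ⟨c a, mem_filter.2 ⟨hD.color a ha, rfl⟩⟩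
  have h5 : (insert b K).card + 1 ≤ 2 * X.card := by omega
  have h6 : Δ * (insert b K).card + Δ ≤ 2 * Δ * X.card := by nlinarith
  have h7 : n * X.card + Δ ≤ 2 * Δ * X.card := by omega
  have h8 : h * (n * X.card + Δ) ≤ h * (2 * Δ * X.card) := Nat.mul_le_mul_left _ h7
  have h9 : X.card * (2 * Δ * h) < X.card * (n * h + Δ) := Nat.mul_lt_mul_of_pos_left hlarge h4
  have h10 : X.card * Δ ≤ h * Δ := Nat.mul_le_mul_right _ hlt
  nlinarith

theorem no_edge (H : Critical G c C n Δ h) {v w : V} (hvw : G.Adj v w) : False := by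
  obtain ⟨D, hD, _, _⟩ := H.exists_imc_of_adj hvw
  obtain ⟨a, ha, b, hb, hab, φ, hφ, htop⟩ := H.exists_top hD
  have h1 := H.side_card hD ha hb hab hφ htop
  have h2 := H.side_card hD hb ha hab.symm
    ⟨fun v hv w hw hvw h1 h2 => hφ.1 v hv w hw hvw h2 h1, hφ.2.symm⟩
    (fun v hv h3 h4 => htop v hv h4 h3)
  have h3 : (C.filter (fun p => φ p = φ (c a))).card + (C.filter (fun p => φ p = φ (c b))).card ≤
      C.card := by
    rw [← card_union_of_disjoint]
    · exact card_le_card (union_subset (filter_subset _ _) (filter_subset _ _))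
    · rw [Finset.disjoint_left]
      intro x hx hx'
      exact hφ.2 ((mem_filter.1 hx).2.symm.trans (mem_filter.1 hx').2)
  have := H.card
  omega

end Critical

/-- A graph with an odd number `2h+1` of large parts has a full transversal. -/
theorem exists_full_of_odd [Fintype V] (G : SimpleGraph V) (c : V → P) (C : Finset P) {n Δ h : ℕ}
    (hdeg : ∀ v, (univ.filter (G.Adj v)).card ≤ Δ)
    (hsize : ∀ p, n ≤ (univ.filter (fun v => c v = p)).card)
    (hproper : ∀ v w, G.Adj v w → c v ≠ c w) (hC : C.card = 2 * h + 1) (h3 : 3 ≤ h)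
    (hlarge : 2 * Δ * h < n * h + Δ) : ∃ J, FullIT G c C J := by
  by_contra hno
  have hex : ∃ m, ∃ G' ≤ G, (¬ ∃ J, FullIT G' c C J) ∧ G'.edgeFinset.card = m :=
    ⟨_, G, le_rfl, hno, rfl⟩
  obtain ⟨G', hG', hno', hm⟩ := Nat.find_spec hex
  have hmin : ∀ v w, G'.Adj v w → ∃ J, FullIT (G'.deleteEdges {s(v, w)}) c C J := by
    intro v w hvw
    by_contra hcon
    have h1 : (G'.deleteEdges {s(v, w)}).edgeFinset.card < Nat.find hex := by
      rw [← hm]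
      apply card_lt_card
      rw [SimpleGraph.edgeFinset_ssubset_edgeFinset]
      refine lt_of_le_of_ne (SimpleGraph.deleteEdges_le _) ?_
      intro heq
      rw [← heq] at hvw
      simp at hvw
    exact Nat.find_min hex h1 ⟨_, (SimpleGraph.deleteEdges_le _).trans hG', hcon, by congr!⟩
  have H : Critical G' c C n Δ h := by
    refine ⟨?_, hsize, fun v w hvw => hproper v w (hG' hvw), hC, h3, hlarge,
      fun J hJ => hno' ⟨J, hJ⟩, ?_⟩
    · intro v
      refine le_trans (card_le_card ?_) (hdeg v)
      intro w hw
      simp only [mem_filter, mem_univ, true_and] at hw ⊢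
      exact hG' hw
    · intro v w hvw
      obtain ⟨J, hJ1, hJ2, hJ3⟩ := hmin v w hvw
      have key : ∀ x ∈ J, ∀ z ∈ J, G'.Adj x z → (x = v ∧ z = w) ∨ (x = w ∧ z = v) := by
        intro x hx z hz hxz
        have := hJ1 x hx z hz
        rw [SimpleGraph.deleteEdges_adj] at this
        push Not at this
        have := this hxz
        simpa using this
      by_cases hvJ : v ∈ J ∧ w ∈ J
      · exact ⟨J, hvJ.1, hvJ.2, hJ2, hJ3, key⟩
      · exfalso
        refine hno' ⟨J, ?_, hJ2, hJ3⟩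
        intro x hx z hz hxz
        rcases key x hx z hz hxz with ⟨rfl, rfl⟩ | ⟨rfl, rfl⟩
        · exact hvJ ⟨hx, hz⟩
        · exact hvJ ⟨hz, hx⟩
  by_cases hedge : ∃ v w, G'.Adj v w
  · obtain ⟨v, w, hvw⟩ := hedge
    exact H.no_edge hvw
  · push Not at hedge
    have hn : 0 < n := by
      rcases Nat.eq_zero_or_pos n with rfl | h
      · exfalso; nlinarith
      · exact h
    have hv : ∀ p, ∃ v, c v = p := by
      intro p
      obtain ⟨v, hv⟩ := card_pos.1 (lt_of_lt_of_le hn (hsize p))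
      exact ⟨v, (mem_filter.1 hv).2⟩
    choose s hs using hv
    refine hno' ⟨C.image s, fun v _ w _ => hedge v w, ?_, ?_⟩
    · intro v hv w hw hvw
      obtain ⟨p, _, rfl⟩ := mem_image.1 (mem_coe.1 hv)
      obtain ⟨p', _, rfl⟩ := mem_image.1 (mem_coe.1 hw)
      rw [hs, hs] at hvw
      rw [hvw]
    · rw [image_image]
      ext p; simp [hs]

end PartialIT

/-! ### Transversals with few outside neighbours. -/

namespace PartialIT

open Finset
open scoped Classical

variable {V P : Type*} [Fintype V]

section Out

variable {G : SimpleGraph V} {c : V → P} {C : Finset P}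

theorem outNbrs_mono {A B : Finset V} (h : A ⊆ B) : outNbrs G c C A ⊆ outNbrs G c C B := by
  intro y hy
  simp only [outNbrs, mem_filter, mem_univ, true_and] at hy ⊢
  exact ⟨hy.1, hy.2.imp fun v hv => ⟨h hv.1, hv.2⟩⟩

theorem card_outNbrs_union (A B : Finset V) : (outNbrs G c C (A ∪ B)).card ≤
    (outNbrs G c C A).card + (outNbrs G c C B).card := by
  refine le_trans (card_le_card ?_) (card_union_le _ _)
  intro y hy
  simp only [outNbrs, mem_filter, mem_univ, true_and, mem_union] at hy ⊢
  obtain ⟨h1, v, hv | hv, h2⟩ := hy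
  · exact Or.inl ⟨h1, v, hv, h2⟩
  · exact Or.inr ⟨h1, v, hv, h2⟩

theorem card_outNbrs_le {A : Finset V} {w : ℕ} (h : ∀ v ∈ A, (outNbrs G c C {v}).card ≤ w) :
    (outNbrs G c C A).card ≤ A.card * w := by
  have : outNbrs G c C A ⊆ A.biUnion (fun v => outNbrs G c C {v}) := by
    intro y hy
    simp only [outNbrs, mem_filter, mem_univ, true_and, mem_biUnion, mem_singleton,
      exists_eq_left] at hy ⊢
    obtain ⟨h1, v, hv, h2⟩ := hy
    exact ⟨v, hv, h1, h2⟩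
  refine (card_le_card this).trans (card_biUnion_le.trans ?_)
  exact (sum_le_card_nsmul _ _ _ h).trans (by simp)

end Out

/-- A class of dominating tree-like matchings on the `2h+1` parts `C` which is closed under
replacing an end of an edge by a private neighbour of the other end. -/
structure SwapClass (G : SimpleGraph V) (c : V → P) (C : Finset P) (n Δ h : ℕ)
    (I : Finset V → Prop) : Prop where
  deg : ∀ v, (univ.filter (G.Adj v)).card ≤ Δ
  size : ∀ p, n ≤ (univ.filter (fun v => c v = p)).card
  card : C.card = 2 * h + 1
  three : 3 ≤ h
  large : 2 * Δ * h < n * h + Δ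
  imc : ∀ D, I D → IMC G c C D
  dom : ∀ D, I D → ∀ y, c y ∈ C → ∃ v ∈ D, G.Adj y v
  swap : ∀ D, I D → ∀ a ∈ D, ∀ b ∈ D, G.Adj a b → ∀ z ∈ excl G c C D b, I (insert z (D.erase a))

namespace SwapClass

variable {G : SimpleGraph V} {c : V → P} {C : Finset P} {n Δ h : ℕ} {I : Finset V → Prop}
  {D : Finset V}

theorem card_verts (H : SwapClass G c C n Δ h I) (hD : I D) : D.card = 4 * h := by
  have := (H.imc D hD).card
  rw [H.card] at this
  omega

theorem card_out (H : SwapClass G c C n Δ h I) (hD : I D) :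
    n * (2 * h + 1) + (outNbrs G c C D).card ≤ Δ * (4 * h) := by
  have h1 := card_out_add_in H.deg (c := c) C D
  have h2 := card_parts_ge H.size C
  have h3 : univ.filter (fun v => c v ∈ C) ⊆ inNbrs G c C D := by
    intro y hy
    have hy' := (mem_filter.1 hy).2
    simp only [inNbrs, mem_filter, mem_univ, true_and]
    exact ⟨hy', H.dom D hD y hy'⟩
  have h4 := card_le_card h3
  rw [H.card_verts hD] at h1
  rw [H.card] at h2
  omega

/-- The waste `w` is the slack in the domination of the `2h + 1` parts by `4h` vertices. The bound
on `w` is `large` multiplied by `2h + 1`, with `(2h + 1)(2h - 1) = 4h² - 1`. -/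
theorem exists_waste (H : SwapClass G c C n Δ h I) (hD : I D) :
    ∃ w, n * (2 * h + 1) + w = Δ * (4 * h) ∧ w * h < Δ := by
  have h1 := H.card_out hD
  refine ⟨Δ * (4 * h) - n * (2 * h + 1), by omega, ?_⟩
  obtain ⟨w, hw⟩ := Nat.exists_eq_add_of_le (le_trans (Nat.le_add_right _ _) h1)
  rw [hw, Nat.add_sub_cancel_left]
  have h2 := H.large
  have h3 : (2 * Δ * h) * (2 * h + 1) < (n * h + Δ) * (2 * h + 1) :=
    Nat.mul_lt_mul_of_pos_right h2 (by omega)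
  have h4 : Δ * (4 * h) * h = (n * (2 * h + 1) + w) * h := by rw [hw]
  nlinarith

theorem card_excl (H : SwapClass G c C n Δ h I) (hD : I D) {v : V} (hv : v ∈ D) {w : ℕ}
    (hw : n * (2 * h + 1) + w = Δ * (4 * h)) : Δ ≤ (excl G c C D v).card + w := by
  have h1 := card_excl_ge H.deg H.size (H.dom D hD) v
  have h5 : (D.erase v).card + 1 = 4 * h := by
    rw [card_erase_add_one hv, H.card_verts hD]
  rw [H.card] at h1
  have : Δ * (4 * h) = Δ * (D.erase v).card + Δ := by rw [← h5]; ring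
  omega

/-- Take a matching containing `J` with as few neighbours of `y` as possible. For each neighbour `g`
of `y` in it, the private neighbours of the partner of `g` are all adjacent to `y`, since otherwise
a swap would remove `g`. Two such `g` would give `y` at least `2(Δ - w) > Δ` neighbours. -/
theorem exists_single (H : SwapClass G c C n Δ h I) {y : V} (hy : c y ∈ C) {J : Finset V}
    (hJ : ∀ v ∈ J, ¬ G.Adj y v) (hne : ∃ D, I D ∧ J ⊆ D) :
    ∃ D, I D ∧ J ⊆ D ∧ ∃ g ∈ D, ∃ g' ∈ D, G.Adj g g' ∧ y ∈ excl G c C D g ∧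
      excl G c C D g' ⊆ univ.filter (G.Adj y) := by
  have hex : ∃ m, ∃ D, I D ∧ J ⊆ D ∧ (D.filter (G.Adj y)).card = m := by
    obtain ⟨D, hD, hJD⟩ := hne
    exact ⟨_, D, hD, hJD, rfl⟩
  obtain ⟨D, hD, hJD, hm⟩ := Nat.find_spec hex
  have hmin : ∀ D', I D' → J ⊆ D' → (D.filter (G.Adj y)).card ≤ (D'.filter (G.Adj y)).card := by
    intro D' hD' hJD'
    rw [hm]
    exact Nat.find_min' hex ⟨D', hD', hJD', rfl⟩
  obtain ⟨p, hp, hadj, huniq, hpp, hpne⟩ := (H.imc D hD).exists_partner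
  have key : ∀ g ∈ D, G.Adj y g → excl G c C D (p g) ⊆ univ.filter (G.Adj y) := by
    intro g hg hyg z hz
    simp only [mem_filter, mem_univ, true_and]
    by_contra hyz
    have h1 := hmin _ (H.swap D hD g hg (p g) (hp g hg) (hadj g hg) z hz) (by
      intro v hv
      refine mem_insert_of_mem (mem_erase.2 ⟨?_, hJD hv⟩)
      rintro rfl
      exact hJ v hv hyg)
    have h2 : (insert z (D.erase g)).filter (G.Adj y) ⊆ (D.filter (G.Adj y)).erase g := by
      intro v hv
      simp only [mem_filter, mem_insert, mem_erase] at hv ⊢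
      obtain ⟨rfl | hv, hyv⟩ := hv
      · exact absurd hyv hyz
      · exact ⟨hv.1, hv.2, hyv⟩
    have h3 := card_le_card h2
    have h4 := card_erase_add_one (s := D.filter (G.Adj y)) (a := g) (by simp [hg, hyg])
    omega
  obtain ⟨g, hg, hyg⟩ := H.dom D hD y hy
  refine ⟨D, hD, hJD, g, hg, p g, hp g hg, hadj g hg, mem_excl.2 ⟨hy, hyg, ?_⟩, key g hg hyg⟩
  intro x hx hyx
  by_contra hne
  obtain ⟨w, hw, hwΔ⟩ := H.exists_waste hD
  have h1 := H.card_excl hD (hp g hg) hw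
  have h2 := H.card_excl hD (hp x hx) hw
  have h3 : (excl G c C D (p g) ∪ excl G c C D (p x)).card ≤ Δ :=
    (card_le_card (union_subset (key g hg hyg) (key x hx hyx))).trans (H.deg y)
  rw [card_union_of_disjoint] at h3
  · have := H.three
    have : w * 3 ≤ w * h := Nat.mul_le_mul_left _ this
    omega
  · rw [Finset.disjoint_left]
    intro z hz hz'
    have := (mem_excl.1 hz').2.2 _ (hp g hg) (mem_excl.1 hz).2.1
    exact hne (by rw [← hpp x hx, ← this, hpp g hg])

theorem card_out_single (H : SwapClass G c C n Δ h I) (hD : I D) {y : V} (hy : c y ∈ C) {w : ℕ}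
    (hw : n * (2 * h + 1) + w = Δ * (4 * h)) : (outNbrs G c C {y}).card ≤ w := by
  obtain ⟨D, hD, _, g, hg, g', hg', hgg, hyg, hsub⟩ := H.exists_single hy (J := ∅) (by simp)
    ⟨D, hD, by simp⟩
  have h1 := H.card_excl hD hg' hw
  have h2 : (excl G c C D g' ∪ outNbrs G c C {y}).card ≤ Δ := by
    refine le_trans (card_le_card (union_subset hsub ?_)) (H.deg y)
    intro z hz
    simp only [outNbrs, mem_filter, mem_univ, true_and, mem_singleton, exists_eq_left] at hz ⊢
    exact hz.2.symm
  rw [card_union_of_disjoint] at h2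
  · omega
  · rw [Finset.disjoint_left]
    intro z hz hz'
    exact (mem_filter.1 hz').2.1 (mem_excl.1 hz).1

/-- A transversal of `C` can be modified so that few vertices outside `C` are adjacent to it. -/
theorem exists_small_out (H : SwapClass G c C n Δ h I) (hne : ∃ D, I D) {J : Finset V}
    (hJ : FullIT G c C J) {s : ℕ} (hs : 3 * (s + 1) ≤ h) :
    ∃ J', FullIT G c C J' ∧ (outNbrs G c C J').card * h + Δ * s ≤ 2 * Δ * h := by
  obtain ⟨Dw, hDw⟩ := hne
  obtain ⟨w, hw, hwΔ⟩ := H.exists_waste hDw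
  have hJC : ∀ y ∈ J, c y ∈ C := fun y hy => hJ.2.2 ▸ mem_image_of_mem c hy
  have hJcard : J.card = 2 * h + 1 := by
    rw [← H.card, ← hJ.2.2, card_image_of_injOn hJ.2.1]
  -- a matching of the class meeting `J` as often as possible
  obtain ⟨D₁, hD₁, hmax⟩ : ∃ D, I D ∧ ∀ D', I D' → (J ∩ D').card ≤ (J ∩ D).card := by
    obtain ⟨D, hD, hm⟩ := exists_max_image (univ.filter I) (fun D => (J ∩ D).card)
      ⟨Dw, by simp [hDw]⟩
    exact ⟨D, by simpa using hD, fun D' hD' => hm D' (by simp [hD'])⟩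
  set J₀ := J ∩ D₁ with hJ₀
  have hJ₀J : J₀ ⊆ J := inter_subset_left
  have hJ₀D : ∀ D, I D → J₀ ⊆ D → J ∩ D = J₀ := by
    intro D hD hsub
    exact (eq_of_subset_of_card_le (subset_inter hJ₀J hsub) (hmax D hD)).symm
  have hout : ∀ D, I D → (outNbrs G c C D).card ≤ w := by
    intro D hD
    have := H.card_out hD
    omega
  -- When `J₀` is large, `J` itself works: `J₀` lies in one matching and costs at most `w`
  -- altogether, while every other member of `J` costs at most `w`.
  by_cases hm : s + 2 ≤ J₀.card
  · refine ⟨J, hJ, ?_⟩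
    have h1 : J = J₀ ∪ (J \ J₀) := (union_sdiff_of_subset hJ₀J).symm
    have h2 : (outNbrs G c C J).card ≤ w + (J \ J₀).card * w := by
      rw [h1]
      refine (card_outNbrs_union _ _).trans (add_le_add ?_ ?_)
      · exact (card_le_card (outNbrs_mono inter_subset_right)).trans (hout D₁ hD₁)
      · rw [← h1]
        exact card_outNbrs_le fun v hv => H.card_out_single hD₁ (hJC v (mem_sdiff.1 hv).1) hw
    have h3 := card_sdiff_add_card_eq_card hJ₀J
    have h4 : (J \ J₀).card + 1 + s ≤ 2 * h := by omega
    have h5 : (outNbrs G c C J).card * h ≤ ((J \ J₀).card + 1) * Δ := by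
      calc (outNbrs G c C J).card * h ≤ (w + (J \ J₀).card * w) * h := Nat.mul_le_mul_right _ h2
        _ = ((J \ J₀).card + 1) * (w * h) := by ring
        _ ≤ _ := Nat.mul_le_mul_left _ hwΔ.le
    calc _ ≤ ((J \ J₀).card + 1) * Δ + Δ * s := Nat.add_le_add_right h5 _
      _ = Δ * ((J \ J₀).card + 1 + s) := by ring
      _ ≤ Δ * (2 * h) := Nat.mul_le_mul_left _ h4
      _ = _ := by ring
  push Not at hm
  -- the other vertices of `J` have few neighbours not adjacent to `J₀`
  have hnew : ∀ y ∈ J \ J₀, (univ.filter (fun z => G.Adj y z ∧ ∀ v ∈ J₀, ¬ G.Adj v z)).card ≤ w := by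
    intro y hy
    obtain ⟨hyJ, hyJ₀⟩ := mem_sdiff.1 hy
    obtain ⟨D, hD, hJD, g, hg, g', hg', hgg, hyg, hsub⟩ := H.exists_single (hJC y hyJ) (J := J₀)
      (fun v hv => hJ.1 y hyJ v (hJ₀J hv)) ⟨D₁, hD₁, inter_subset_right⟩
    -- Otherwise exchanging `g'` for `y` gives a matching of the class that meets `J` more often.
    have hg'J : g' ∈ J₀ := by
      by_contra hg'J
      have h1 := H.swap D hD g' hg' g hg hgg.symm y hyg
      have h2 := hJ₀D _ h1 (by
        intro v hv
        refine mem_insert_of_mem (mem_erase.2 ⟨?_, hJD hv⟩)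
        rintro rfl
        exact hg'J hv)
      exact hyJ₀ (by rw [← h2]; simp [hyJ])
    have h1 := H.card_excl hD hg' hw
    have h2 : (excl G c C D g' ∪ univ.filter (fun z => G.Adj y z ∧ ∀ v ∈ J₀, ¬ G.Adj v z)).card ≤
        Δ := by
      refine le_trans (card_le_card (union_subset hsub ?_)) (H.deg y)
      intro z hz
      simp only [mem_filter, mem_univ, true_and] at hz ⊢
      exact hz.1
    rw [card_union_of_disjoint] at h2
    · omega
    · rw [Finset.disjoint_left]
      intro z hz hz'
      exact (mem_filter.1 hz').2.2 g' hg'J (mem_excl.1 hz).2.1.symm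
  set N := univ.filter (fun z => (∃ y ∈ J, G.Adj y z) ∧ ∀ v ∈ J₀, ¬ G.Adj v z) with hN
  have hNcard : N.card ≤ (2 * h + 1) * w := by
    have : N ⊆ (J \ J₀).biUnion
        (fun y => univ.filter (fun z => G.Adj y z ∧ ∀ v ∈ J₀, ¬ G.Adj v z)) := by
      intro z hz
      obtain ⟨⟨y, hy, hyz⟩, hz0⟩ := (mem_filter.1 hz).2
      refine mem_biUnion.2 ⟨y, mem_sdiff.2 ⟨hy, fun hy0 => hz0 y hy0 hyz⟩, ?_⟩
      simp only [mem_filter, mem_univ, true_and]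
      exact ⟨hyz, hz0⟩
    refine (card_le_card this).trans (card_biUnion_le.trans ?_)
    refine (sum_le_card_nsmul _ _ _ hnew).trans ?_
    rw [smul_eq_mul]
    exact Nat.mul_le_mul_right _ ((card_le_card sdiff_subset).trans hJcard.le)
  -- a matching containing `J₀` with few bad vertices
  let bad : Finset V → Finset V := fun D => D.filter (fun g => g ∉ J₀ ∧
    (∀ v ∈ J₀, ¬ G.Adj v g) ∧ ∃ y ∈ J, G.Adj y g)
  obtain ⟨D, hD, hJD, hbmin⟩ : ∃ D, I D ∧ J₀ ⊆ D ∧ ∀ D', I D' → J₀ ⊆ D' →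
      (bad D).card ≤ (bad D').card := by
    obtain ⟨D, hD, hm⟩ := exists_min_image (univ.filter (fun D => I D ∧ J₀ ⊆ D))
      (fun D => (bad D).card) ⟨D₁, by simp [hD₁, hJ₀]⟩
    simp only [mem_filter, mem_univ, true_and] at hD
    exact ⟨D, hD.1, hD.2, fun D' hD' hJD' => hm D' (by simp [hD', hJD'])⟩
  obtain ⟨p, hp, hadj, huniq, hpp, hpne⟩ := (H.imc D hD).exists_partner
  have hbad : ∀ g ∈ bad D, g ∈ D ∧ p g ∈ D ∧ p g ∉ J₀ ∧ excl G c C D (p g) ⊆ N := by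
    intro g hg
    obtain ⟨hgD, hgJ, hgJ', hgN⟩ := mem_filter.1 hg
    have hpJ : p g ∉ J₀ := fun hh => hgJ' _ hh (hadj g hgD).symm
    refine ⟨hgD, hp g hgD, hpJ, ?_⟩
    intro z hz
    have hzJ : ∀ v ∈ J₀, ¬ G.Adj v z := by
      intro v hv hvz
      have := (mem_excl.1 hz).2.2 v (hJD hv) hvz.symm
      exact hpJ (this ▸ hv)
    simp only [hN, mem_filter, mem_univ, true_and]
    refine ⟨?_, hzJ⟩
    by_contra hzN
    have h1 := hbmin _ (H.swap D hD g hgD (p g) (hp g hgD) (hadj g hgD) z hz) (by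
      intro v hv
      refine mem_insert_of_mem (mem_erase.2 ⟨?_, hJD hv⟩)
      rintro rfl
      exact hgJ hv)
    have h2 : bad (insert z (D.erase g)) ⊆ (bad D).erase g := by
      intro v hv
      simp only [bad, mem_filter, mem_insert, mem_erase] at hv ⊢
      obtain ⟨rfl | hv, h3⟩ := hv
      · exact absurd h3.2.2 hzN
      · exact ⟨hv.1, hv.2, h3⟩
    have h3 := card_le_card h2
    have h4 := card_erase_add_one hg
    omega
  -- Each bad vertex accounts for at least `Δ - w` vertices of `N`, disjointly. Four of them would
  -- need `4Δ ≤ (2h + 5) w`, hence `4h < 2h + 5`, which fails for `h ≥ 3`.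
  have hbcard : (bad D).card ≤ 3 := by
    have h1 : ((bad D).biUnion (fun g => excl G c C D (p g))).card ≤ N.card :=
      card_le_card (biUnion_subset.2 fun g hg => (hbad g hg).2.2.2)
    rw [card_biUnion] at h1
    · have h2 : (bad D).card * Δ ≤ N.card + (bad D).card * w := by
        refine le_trans ?_ (Nat.add_le_add_right h1 _)
        rw [← smul_eq_mul (bad D).card w, ← sum_const, ← sum_add_distrib, ← smul_eq_mul]
        exact card_nsmul_le_sum _ _ _ fun g hg => H.card_excl hD (hbad g hg).2.1 hw
      by_contra h4
      push Not at h4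
      have h3 := H.three
      have hwle : w ≤ Δ := by
        have : w * 1 ≤ w * h := Nat.mul_le_mul_left _ (by omega)
        omega
      obtain ⟨b, hb⟩ := Nat.exists_eq_add_of_le h4
      have h5 : 4 * Δ ≤ (2 * h + 5) * w := by
        have : b * w ≤ b * Δ := Nat.mul_le_mul_left _ hwle
        rw [hb] at h2
        nlinarith
      have h6 : 4 * Δ * h ≤ (2 * h + 5) * (w * h) := by nlinarith
      have h7 : (2 * h + 5) * (w * h) < (2 * h + 5) * Δ :=
        Nat.mul_lt_mul_of_pos_left hwΔ (by omega)
      nlinarith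
    · intro g hg g' hg' hne
      show Disjoint _ _
      rw [Finset.disjoint_left]
      intro z hz hz'
      have := (mem_excl.1 hz').2.2 _ (hbad g hg).2.1 (mem_excl.1 hz).2.1
      exact hne (by rw [← hpp g (hbad g hg).1, this, hpp g' (hbad g' hg').1])
  -- combine
  obtain ⟨u, hu⟩ : C.Nonempty := card_pos.1 (by rw [H.card]; omega)
  obtain ⟨M, hMD, hM⟩ := (H.imc D hD).select u hu
  set X := J₀ ∪ bad D with hX
  have hXD : X ⊆ D := union_subset hJD (filter_subset _ _)
  -- Keep from the matching transversal only vertices whose edge avoids `J₀` and the bad vertices;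
  -- these have no neighbours in `J`, so `J` can supply the remaining parts.
  set M' := M.filter (fun v => v ∉ X ∧ p v ∉ X) with hM'
  have hM'M : M' ⊆ M := filter_subset _ _
  have hremoved : (M \ M').card ≤ X.card := by
    refine card_le_card_of_injOn (fun v => if v ∈ X then v else p v) ?_ ?_
    · intro v hv
      obtain ⟨hvM, hv'⟩ := mem_sdiff.1 (mem_coe.1 hv)
      by_cases hvX : v ∈ X
      · simp [hvX]
      · simp only [hvX, if_false]
        by_contra hpX
        exact hv' (mem_filter.2 ⟨hvM, hvX, hpX⟩)
    · intro v hv v' hv' hvv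
      have hvM := (mem_sdiff.1 (mem_coe.1 hv)).1
      have hvM' := (mem_sdiff.1 (mem_coe.1 hv')).1
      have hind : ∀ a ∈ M, p a ∉ M := fun a ha hpa => hM.1 a ha _ hpa (hadj a (hMD ha))
      by_cases h1 : v ∈ X <;> by_cases h2 : v' ∈ X <;> simp only [h1, h2, if_true, if_false] at hvv
      · exact hvv
      · exact absurd (hvv ▸ hvM) (hind v' hvM')
      · exact absurd (hvv.symm ▸ hvM') (hind v hvM)
      · rw [← hpp v (hMD hvM), hvv, hpp v' (hMD hvM')]
  have hXcard : X.card ≤ J₀.card + 3 := (card_union_le _ _).trans (by omega)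
  set U := C \ M'.image c with hU
  set J₁ := J.filter (fun y => c y ∈ U) with hJ₁
  have hM'C : M'.image c ⊆ C := by
    intro x hx
    obtain ⟨v, hv, rfl⟩ := mem_image.1 hx
    exact (H.imc D hD).color v (hMD (hM'M hv))
  have hF1 : FullIT G c U J₁ := by
    refine ⟨fun v hv v' hv' => hJ.1 v (mem_filter.1 hv).1 v' (mem_filter.1 hv').1,
      hJ.2.1.mono (by intro v hv; exact (mem_filter.1 (mem_coe.1 hv)).1), ?_⟩
    ext x
    constructor
    · intro hx
      obtain ⟨v, hv, rfl⟩ := mem_image.1 hx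
      exact (mem_filter.1 hv).2
    · intro hx
      have hxC := (mem_sdiff.1 hx).1
      rw [← hJ.2.2] at hxC
      obtain ⟨v, hv, rfl⟩ := mem_image.1 hxC
      exact mem_image_of_mem c (mem_filter.2 ⟨hv, hx⟩)
  have hF2 : FullIT G c (M'.image c) M' :=
    ⟨fun v hv v' hv' => hM.1 v (hM'M hv) v' (hM'M hv'), hM.2.1.mono (by exact_mod_cast hM'M), rfl⟩
  have hF := hF1.union hF2 sdiff_disjoint (by
    intro v hv m hm hvm
    obtain ⟨hmM, hmX, hpX⟩ := mem_filter.1 hm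
    apply hmX
    refine mem_union_right _ (mem_filter.2 ⟨hMD hmM, fun hh => hmX (mem_union_left _ hh), ?_,
      v, (mem_filter.1 hv).1, hvm⟩)
    intro a ha ham
    apply hpX
    rw [← huniq m (hMD hmM) a (hJD ha) ham.symm]
    exact mem_union_left _ ha)
  rw [hU, sdiff_union_of_subset hM'C] at hF
  refine ⟨_, hF, ?_⟩
  -- The members of `J` used are at most one for the root, three for bad vertices and one for each
  -- member of `J₀`.
  have h1 : J₁.card ≤ J₀.card + 4 := by
    have e1 : J₁.card = U.card := by rw [← hF1.2.2, card_image_of_injOn hF1.2.1]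
    have e2 : U.card + M'.card = C.card := by
      rw [← card_image_of_injOn hF2.2.1]
      exact card_sdiff_add_card_eq_card hM'C
    have e3 : M.card + 1 = C.card := by
      rw [← card_image_of_injOn hM.2.1, hM.2.2, card_erase_add_one hu]
    have e4 := card_sdiff_add_card_eq_card hM'M
    omega
  have h2 : (outNbrs G c C (J₁ ∪ M')).card ≤ (s + 6) * w := by
    refine (card_outNbrs_union _ _).trans ?_
    have e1 : (outNbrs G c C J₁).card ≤ J₁.card * w :=
      card_outNbrs_le fun v hv => H.card_out_single hD (hJC v (mem_filter.1 hv).1) hw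
    have e2 : (outNbrs G c C M').card ≤ w :=
      (card_le_card (outNbrs_mono (hM'M.trans hMD))).trans (hout D hD)
    have e3 : J₁.card * w ≤ (s + 5) * w := Nat.mul_le_mul_right _ (by omega)
    calc _ ≤ (s + 5) * w + w := add_le_add (e1.trans e3) e2
      _ = _ := by ring
  calc _ ≤ (s + 6) * w * h + Δ * s := Nat.add_le_add_right (Nat.mul_le_mul_right _ h2) _
    _ = (s + 6) * (w * h) + Δ * s := by ring
    _ ≤ (s + 6) * Δ + Δ * s := Nat.add_le_add_right (Nat.mul_le_mul_left _ hwΔ.le) _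
    _ = Δ * (2 * s + 6) := by ring
    _ ≤ Δ * (2 * h) := Nat.mul_le_mul_left _ (by omega)
    _ = _ := by ring

end SwapClass
end PartialIT

/-! ### Dominating forests with `d + 1` trees, and the upper bound. -/

namespace PartialIT

open Finset
open scoped Classical

/-- A forest of `d+1` trees which dominates its parts. -/
structure DomForest (G : SimpleGraph V) (c : V → P) {d : ℕ} (C : Fin (d + 1) → Finset P)
    (D : Fin (d + 1) → Finset V) : Prop extends Forest G c C D where
  dom : ∀ y, c y ∈ univ.biUnion C → ∃ v ∈ univ.biUnion D, G.Adj y v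

section

variable {V P : Type*} {G : SimpleGraph V} {c : V → P} {d : ℕ} {C : Fin (d + 1) → Finset P}
  {D : Fin (d + 1) → Finset V}

namespace Forest

theorem tree_nonempty (F : Forest G c C D) (i : Fin (d + 1)) : (C i).Nonempty := by
  have := (F.tree i).card
  exact card_pos.1 (by omega)

theorem union_nonempty (F : Forest G c C D) : 1 ≤ (univ.biUnion C).card := by
  obtain ⟨p, hp⟩ := F.tree_nonempty 0
  exact card_pos.2 ⟨p, mem_biUnion.2 ⟨0, mem_univ _, hp⟩⟩

theorem mem_unique (F : Forest G c C D) {i j : Fin (d + 1)} {v : V} (hi : v ∈ D i) (hj : v ∈ D j) :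
    i = j := by
  by_contra hij
  exact Finset.disjoint_left.1 (F.disj i j hij) ((F.tree i).color v hi) ((F.tree j).color v hj)

theorem biUnion_swap (F : Forest G c C D) {j : Fin (d + 1)} {a z : V} (ha : a ∈ D j) :
    univ.biUnion (Function.update D j (insert z ((D j).erase a))) =
      insert z ((univ.biUnion D).erase a) := by
  ext v
  simp only [mem_biUnion, mem_univ, true_and, mem_insert, mem_erase]
  constructor
  · rintro ⟨i, hi⟩
    by_cases hij : i = j
    · subst hij
      rw [Function.update_self, mem_insert, mem_erase] at hi
      exact hi.imp id fun hi => ⟨hi.1, i, hi.2⟩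
    · rw [Function.update_of_ne hij] at hi
      refine Or.inr ⟨?_, i, hi⟩
      rintro rfl
      exact hij (F.mem_unique hi ha)
  · rintro (rfl | ⟨hne, i, hi⟩)
    · exact ⟨j, by simp⟩
    · refine ⟨i, ?_⟩
      by_cases hij : i = j
      · subst hij; simp [hne, hi]
      · rwa [Function.update_of_ne hij]

/-- Swapping a neighbour of `y` for a non-neighbour lowers the number of neighbours of `y`. -/
theorem card_nbrs_swap (F : Forest G c C D) {i : Fin (d + 1)} {g y z : V} (hg : g ∈ D i)
    (hyg : G.Adj y g) (hyz : ¬ G.Adj y z) :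
    ((univ.biUnion (Function.update D i (insert z ((D i).erase g)))).filter (G.Adj y)).card <
      ((univ.biUnion D).filter (G.Adj y)).card := by
  rw [F.biUnion_swap hg]
  apply card_lt_card
  rw [ssubset_iff_of_subset]
  · refine ⟨g, mem_filter.2 ⟨mem_biUnion.2 ⟨i, mem_univ _, hg⟩, hyg⟩, ?_⟩
    intro hh
    obtain ⟨h1, _⟩ := mem_filter.1 hh
    rcases mem_insert.1 h1 with rfl | h1
    · exact hyz hyg
    · simp at h1
  · intro v hv
    obtain ⟨h1, h2⟩ := mem_filter.1 hv
    rcases mem_insert.1 h1 with rfl | h1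
    · exact absurd h2 hyz
    · exact mem_filter.2 ⟨mem_of_mem_erase h1, h2⟩

end Forest

theorem DomForest.card_verts (F : DomForest G c C D) :
    (univ.biUnion D).card + 2 * (d + 1) = 2 * (univ.biUnion C).card := by
  have := F.toForest.verts_card
  rwa [Fintype.card_fin] at this

end

variable {V P : Type*} [Fintype V]

/-- Double counting of the edges between `Y` and `K`, with the members of `X` counted twice. -/
theorem card_add_card_le {G : SimpleGraph V} {Δ : ℕ} (hΔ : ∀ v, (univ.filter (G.Adj v)).card ≤ Δ)
    {X Y K : Finset V} (hXY : X ⊆ Y) (h1 : ∀ y ∈ Y, ∃ v ∈ K, G.Adj y v)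
    (h2 : ∀ y ∈ X, ∃ v ∈ K, ∃ w ∈ K, v ≠ w ∧ G.Adj y v ∧ G.Adj y w) :
    Y.card + X.card ≤ Δ * K.card := by
  have e1 : Y.card + X.card = ∑ y ∈ Y, (1 + if y ∈ X then 1 else 0) := by
    rw [sum_add_distrib, ← sum_filter, filter_mem_eq_inter, inter_eq_right.2 hXY]
    simp
  have e2 : ∑ y ∈ Y, (1 + if y ∈ X then 1 else 0) ≤ ∑ y ∈ Y, (K.filter (G.Adj y)).card := by
    refine sum_le_sum fun y hy => ?_
    split_ifs with hyX
    · obtain ⟨v, hv, w, hw, hne, hyv, hyw⟩ := h2 y hyX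
      exact one_lt_card.2 ⟨v, by simp [hv, hyv], w, by simp [hw, hyw], hne⟩
    · obtain ⟨v, hv, hyv⟩ := h1 y hy
      exact card_pos.2 ⟨v, by simp [hv, hyv]⟩
  have e3 := sum_card_bipartiteAbove_eq_sum_card_bipartiteBelow (s := Y) (t := K) G.Adj
  have e4 : ∑ v ∈ K, (Y.bipartiteBelow G.Adj v).card ≤ K.card * Δ := by
    rw [← smul_eq_mul]
    refine sum_le_card_nsmul _ _ _ fun v _ => le_trans (card_le_card ?_) (hΔ v)
    intro y hy
    simp only [mem_filter, mem_univ, true_and, bipartiteBelow] at hy ⊢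
    exact hy.2.symm
  rw [mul_comm Δ]
  exact e1.trans_le (e2.trans (e3.trans_le e4))

variable [Fintype P]

/-- A graph with large parts but without a transversal missing `d` parts. -/
structure Counter (G : SimpleGraph V) (c : V → P) (n Δ h d k : ℕ) : Prop where
  deg : ∀ v, (univ.filter (G.Adj v)).card ≤ Δ
  size : ∀ p, n ≤ (univ.filter (fun v => c v = p)).card
  proper : ∀ v w, G.Adj v w → c v ≠ c w
  large : 2 * Δ * h < n * h + Δ
  card : Fintype.card P = (2 * h + 1) * (d + 1) + k
  rem : k ≤ d
  height : 3 * (d + k + 1) ≤ h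
  no : ∀ T M, FullIT G c T M → T.card + d < Fintype.card P

namespace Counter

variable {G : SimpleGraph V} {c : V → P} {n Δ h d k : ℕ} {C : Fin (d + 1) → Finset P}
  {D : Fin (d + 1) → Finset V}

/-- Each part falls short of `2Δ` by less than `Δ/h`, and `height` gives `r ≤ (2(d + 1) + 1/3) h`.
The spare third of `Δ` is the margin in all later counts. -/
theorem count (H : Counter G c n Δ h d k) {s : ℕ} (h1 : 1 ≤ s) (h2 : s ≤ Fintype.card P) :
    6 * Δ * s < 3 * n * s + 6 * Δ * (d + 1) + Δ := by
  have e1 : s * (2 * Δ * h) < s * (n * h + Δ) := Nat.mul_lt_mul_of_pos_left H.large h1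
  have e2 : Δ * s ≤ Δ * ((2 * h + 1) * (d + 1) + k) := Nat.mul_le_mul_left _ (H.card ▸ h2)
  have e3 : Δ * (3 * (d + k + 1)) ≤ Δ * h := Nat.mul_le_mul_left _ H.height
  have e4 : h * (6 * Δ * s) < h * (3 * n * s + 6 * Δ * (d + 1) + Δ) := by nlinarith
  exact lt_of_mul_lt_mul_left e4 (Nat.zero_le _)

theorem combine (H : Counter G c n Δ h d k) (F : Forest G c C D) {y : V} {j : Fin (d + 1)}
    (hyj : c y ∈ C j)
    (hsel : ∀ i, ∃ p ∈ C i, (i = j → p = c y) ∧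
      ∃ M ⊆ D i, FullIT G c ((C i).erase p) M ∧ ∀ m ∈ M, ¬ G.Adj y m)
    {N : Finset V} (hN : FullIT G c (univ.biUnion C)ᶜ N)
    (hND : ∀ m ∈ N, ∀ v ∈ univ.biUnion D, ¬ G.Adj m v) (hyN : ∀ m ∈ N, ¬ G.Adj y m) : False := by
  choose u hu huj M hMD hM hyM using hsel
  obtain ⟨T', M', hF, _, hcard⟩ := F.exists_fullIT hyj hu (huj j rfl) hMD hM hyM
    disjoint_compl_right hN hND hyN
  have h1 := H.no _ _ hF
  rw [Fintype.card_fin, card_compl] at hcard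
  have h2 := card_le_univ (univ.biUnion C)
  omega

theorem combine_free (H : Counter G c n Δ h d k) (F : Forest G c C D) {y : V}
    (hy : c y ∈ univ.biUnion C) (hyD : ∀ v ∈ univ.biUnion D, ¬ G.Adj y v)
    {N : Finset V} (hN : FullIT G c (univ.biUnion C)ᶜ N)
    (hND : ∀ m ∈ N, ∀ v ∈ univ.biUnion D, ¬ G.Adj m v) (hyN : ∀ m ∈ N, ¬ G.Adj y m)
    (hne : ∀ i, (C i).Nonempty) : False := by
  obtain ⟨j, _, hyj⟩ := mem_biUnion.1 hy
  refine H.combine F hyj (fun i => ?_) hN hND hyN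
  have : ∃ p ∈ C i, i = j → p = c y := by
    by_cases hij : i = j
    · subst hij; exact ⟨_, hyj, fun _ => rfl⟩
    · obtain ⟨p, hp⟩ := hne i
      exact ⟨p, hp, fun h => absurd h hij⟩
  obtain ⟨p, hp, hpj⟩ := this
  obtain ⟨M, hMD, hM⟩ := (F.tree i).select p hp
  exact ⟨p, hp, hpj, M, hMD, hM, fun m hm =>
    hyD m (mem_biUnion.2 ⟨i, mem_univ _, hMD hm⟩)⟩

/-- A forest can be extended to a dominating one. -/
theorem extend (H : Counter G c n Δ h d k) (F : Forest G c C D) {N : Finset V}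
    (hN : FullIT G c (univ.biUnion C)ᶜ N)
    (hND : ∀ m ∈ N, ∀ v ∈ univ.biUnion D, ¬ G.Adj m v) :
    ∃ C' D', DomForest G c C' D' ∧ ∀ j, C j ⊆ C' j ∧ D j ⊆ D' j := by
  obtain ⟨M, L, hM, hcl⟩ := exists_closed (G := G) (c := c) (A := univ) (V₀ := univ.biUnion D)
    (S₀ := univ.biUnion C) (T := (univ.biUnion C)ᶜ) (by
      intro M hM x _ hxc hxD
      rw [nonempty_iff_ne_empty]
      intro hempty
      refine H.combine_free F hxc hxD hM.1 hM.2.2 (fun m hm hxm => ?_) (F.tree_nonempty)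
      have : m ∈ M.filter (G.Adj x) := by simp [hm, hxm]
      rw [hempty] at this
      simp at this) disjoint_compl_right (M := N) ⟨hN, subset_univ _, hND⟩
  have hMS : ∀ m ∈ M, c m ∉ univ.biUnion C := fun m hm hmS =>
    (mem_compl.1 (hM.1.2.2 ▸ mem_image_of_mem c hm)) hmS
  obtain ⟨k1, k2, k3, _⟩ := hcl.1.card hM.1.2.1 hMS
  have hv := F.verts_card
  rw [Fintype.card_fin] at hv
  have hSne := F.union_nonempty
  set S := starParts G c (univ.biUnion C) M L with hS
  set K := starVerts G (univ.biUnion D) M L with hK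
  have hcount := count_of_dominated H.deg H.size (S := S) (K := K)
    (fun y hy => hcl.2 y (mem_univ _) hy)
  have hlen : S.card = (univ.biUnion C).card + L.length := by
    by_contra hne
    have h1 : K.card + 1 + 2 * (d + 1) ≤ 2 * S.card := by omega
    have h2 := H.count (s := S.card) (by omega) (card_le_univ S)
    have h3 : Δ * (K.card + 1 + 2 * (d + 1)) ≤ Δ * (2 * S.card) := Nat.mul_le_mul_left _ h1
    nlinarith
  obtain ⟨C', D', hF, hC', hD', hsub⟩ := F.extend hM disjoint_compl_right hcl.1 (k3 hlen)
  refine ⟨C', D', ⟨hF, ?_⟩, hsub⟩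
  intro y hy
  rw [hC'] at hy
  rw [hD']
  exact hcl.2 y (mem_univ _) hy

/-- The deficiency theorem gives a transversal missing at most `d + 1` parts, hence exactly `d + 1`.
The missed parts are trees without edges, and `extend` does the rest. -/
theorem exists_domForest (H : Counter G c n Δ h d k) :
    ∃ (C : Fin (d + 1) → Finset P) (D : Fin (d + 1) → Finset V), DomForest G c C D := by
  obtain ⟨U, N, _, hU, hN, _⟩ := exists_outer (G := G) (c := c) H.deg H.size ∅ ∅ (d + 1) (by
    intro t ht htP
    have h1 := H.count (s := t) (by omega) (by simpa using htP)
    have h2 : outNbrs G c ∅ ∅ = ∅ := by simp [outNbrs]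
    rw [h2, card_empty]
    nlinarith)
  have h1 := H.no _ _ hN
  simp only [card_empty, zero_add] at hU
  have h2 : Fintype.card (Fin (d + 1)) = Fintype.card {p // p ∈ Uᶜ} := by
    rw [Fintype.card_fin, Fintype.card_coe, card_compl]
    omega
  obtain ⟨f⟩ := Fintype.card_eq.1 h2
  have hUC : univ.biUnion (fun j => ({(f j).1} : Finset P)) = Uᶜ := by
    ext p
    simp only [mem_biUnion, mem_univ, true_and, mem_singleton]
    constructor
    · rintro ⟨j, rfl⟩; exact (f j).2
    · intro hp
      exact ⟨f.symm ⟨p, hp⟩, by simp⟩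
  have F : Forest G c (fun j => ({(f j).1} : Finset P)) (fun _ => ∅) := by
    refine ⟨fun j => IMC.single _, fun i j hij => ?_, fun i j _ v hv => by simp at hv⟩
    rw [disjoint_singleton]
    exact fun hh => hij (f.injective (Subtype.ext hh))
  obtain ⟨C', D', hF, _⟩ := H.extend F (N := N) (by rw [hUC, compl_compl]; exact hN) (by simp)
  exact ⟨C', D', hF⟩

theorem exists_max (H : Counter G c n Δ h d k) :
    ∃ (C : Fin (d + 1) → Finset P) (D : Fin (d + 1) → Finset V), DomForest G c C D ∧
      ∀ C' D', DomForest G c (d := d) C' D' → (univ.biUnion C').card ≤ (univ.biUnion C).card := by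
  have hex : ∃ m, ∃ (C : Fin (d + 1) → Finset P) (D : Fin (d + 1) → Finset V),
      DomForest G c C D ∧ Fintype.card P - (univ.biUnion C).card = m := by
    obtain ⟨C, D, hF⟩ := H.exists_domForest
    exact ⟨_, C, D, hF, rfl⟩
  obtain ⟨C, D, hF, hm⟩ := Nat.find_spec hex
  refine ⟨C, D, hF, fun C' D' hF' => ?_⟩
  have h1 := Nat.find_min' hex ⟨C', D', hF', rfl⟩
  rw [← hm] at h1
  have h2 := card_le_univ (univ.biUnion C)
  have h3 := card_le_univ (univ.biUnion C')
  omega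

/-- The forest spends most of its degree on dominating its own parts. Even with `Δ` more for the
neighbours of `y`, too few vertices outside are blocked to obstruct a transversal of all the other
parts. -/
theorem rest (H : Counter G c n Δ h d k) (F : DomForest G c C D) (y : V) :
    ∃ N, FullIT G c (univ.biUnion C)ᶜ N ∧ (∀ m ∈ N, ∀ v ∈ univ.biUnion D, ¬ G.Adj m v) ∧
      ∀ m ∈ N, ¬ G.Adj y m := by
  have h0 := F.union_nonempty
  have h1 := F.card_verts
  have h2 := card_out_add_in H.deg (c := c) (univ.biUnion C) (insert y (univ.biUnion D))
  have h3 : n * (univ.biUnion C).card ≤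
      (inNbrs G c (univ.biUnion C) (insert y (univ.biUnion D))).card := by
    refine (card_parts_ge H.size _).trans (card_le_card ?_)
    intro z hz
    have hz' := (mem_filter.1 hz).2
    obtain ⟨v, hv, hzv⟩ := F.dom z hz'
    simp only [inNbrs, mem_filter, mem_univ, true_and]
    exact ⟨hz', v, mem_insert_of_mem hv, hzv⟩
  have h4 := card_insert_le y (univ.biUnion D)
  have h5 : Δ * ((insert y (univ.biUnion D)).card + 2 * (d + 1)) ≤
      Δ * (2 * (univ.biUnion C).card + 1) := Nat.mul_le_mul_left _ (by omega)
  obtain ⟨U, N, hd, hU, hN, hND⟩ := exists_outer (G := G) (c := c) H.deg H.size (univ.biUnion C)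
    (insert y (univ.biUnion D)) 0 (by
      intro t ht htP
      have h6 := H.count (s := t + (univ.biUnion C).card) (by omega) htP
      nlinarith)
  have hUeq : U = (univ.biUnion C)ᶜ := by
    apply eq_of_subset_of_card_le
    · intro p hp
      exact mem_compl.2 (Finset.disjoint_right.1 hd hp)
    · rw [card_compl]; omega
  rw [← hUeq]
  exact ⟨N, hN, fun m hm v hv => hND m hm v (mem_insert_of_mem hv),
    fun m hm hh => hND m hm y (mem_insert_self _ _) hh.symm⟩

/-- A private neighbour of `b` lies in the tree of `b`. -/
theorem excl_color (H : Counter G c n Δ h d k) (F : DomForest G c C D) {j : Fin (d + 1)} {b z : V}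
    (hb : b ∈ D j) (hz : z ∈ excl G c (univ.biUnion C) (univ.biUnion D) b) : c z ∈ C j := by
  obtain ⟨hzC, hzb, hzu⟩ := mem_excl.1 hz
  obtain ⟨i, _, hi⟩ := mem_biUnion.1 hzC
  by_cases hij : i = j
  · rwa [hij] at hi
  exfalso
  obtain ⟨N, hN, hND, hzN⟩ := H.rest F z
  refine H.combine F.toForest hi (fun l => ?_) hN hND hzN
  -- The tree of `b` is rooted at the part of `b`, so that `b`, the only forest neighbour of `z`, is
  -- not selected.
  have : ∃ p ∈ C l, (l = i → p = c z) ∧ (l = j → p = c b) := by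
    by_cases hl : l = i
    · subst hl; exact ⟨_, hi, fun _ => rfl, fun hh => absurd hh hij⟩
    · by_cases hl' : l = j
      · subst hl'; exact ⟨c b, (F.tree l).color b hb, fun hh => absurd hh hl, fun _ => rfl⟩
      · obtain ⟨p, hp⟩ := F.tree_nonempty l
        exact ⟨p, hp, fun hh => absurd hh hl, fun hh => absurd hh hl'⟩
  obtain ⟨p, hp, hpi, hpj⟩ := this
  obtain ⟨M, hMD, hM⟩ := (F.tree l).select p hp
  refine ⟨p, hp, hpi, M, hMD, hM, fun m hm hzm => ?_⟩
  have hmb := hzu m (mem_biUnion.2 ⟨l, mem_univ _, hMD hm⟩) hzm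
  subst hmb
  have hlj := F.mem_unique (hMD hm) hb
  have := hM.2.2 ▸ mem_image_of_mem c hm
  rw [hpj hlj] at this
  simp at this

/-- In a maximal dominating forest, an end of an edge can be replaced by a private neighbour of
the other end. -/
theorem swap (H : Counter G c n Δ h d k) (F : DomForest G c C D)
    (hmax : ∀ C' D', DomForest G c (d := d) C' D' → (univ.biUnion C').card ≤ (univ.biUnion C).card)
    {j : Fin (d + 1)} {a b z : V} (ha : a ∈ D j) (hb : b ∈ D j) (hab : G.Adj a b)
    (hz : z ∈ excl G c (univ.biUnion C) (univ.biUnion D) b) :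
    DomForest G c C (Function.update D j (insert z ((D j).erase a))) := by
  obtain ⟨hzC, hzb, hzu⟩ := mem_excl.1 hz
  have hzj := H.excl_color F hb hz
  obtain ⟨N, hN, hND, hzN⟩ := H.rest F z
  obtain ⟨φ, hφ⟩ := (F.tree j).exists_cut ha hb hab
  have hzu' : ∀ i, ∀ x ∈ D i, G.Adj z x → x = b := fun i x hx hzx =>
    hzu x (mem_biUnion.2 ⟨i, mem_univ _, hx⟩) hzx
  have hcut : φ (c z) ≠ φ (c b) := by
    intro heq
    refine H.combine F.toForest hzj (fun i => ?_) hN hND hzN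
    by_cases hij : i = j
    · subst hij
      obtain ⟨M, hMD, hM⟩ := (F.tree i).select (c z) hzj
      have hbM := (F.tree i).not_mem_of_cut ha hb hab hφ heq hMD hM
      exact ⟨c z, hzj, fun _ => rfl, M, hMD, hM, fun m hm hzm =>
        hbM (hzu' i m (hMD hm) hzm ▸ hm)⟩
    · obtain ⟨p, hp⟩ := F.tree_nonempty i
      obtain ⟨M, hMD, hM⟩ := (F.tree i).select p hp
      refine ⟨p, hp, fun hh => absurd hh hij, M, hMD, hM, fun m hm hzm => ?_⟩
      have := hzu' i m (hMD hm) hzm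
      subst this
      exact hij (F.mem_unique (hMD hm) hb)
  have htree := (F.tree j).swap ha hb hab hzj hzb (hzu' j) hφ hcut
  have F' : Forest G c C (Function.update D j (insert z ((D j).erase a))) := by
    have key : ∀ i, i ≠ j → ∀ v ∈ D i, ∀ w ∈ insert z ((D j).erase a), ¬ G.Adj v w := by
      intro i hij v hv w hw hvw
      rcases mem_insert.1 hw with rfl | hw
      · have := hzu' i v hv hvw.symm
        subst this
        exact hij (F.mem_unique hv hb)
      · exact F.nadj i j hij v hv w (mem_of_mem_erase hw) hvw
    refine ⟨fun i => ?_, F.disj, fun i i' hii v hv w hw => ?_⟩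
    · by_cases hij : i = j
      · subst hij; rwa [Function.update_self]
      · rw [Function.update_of_ne hij]; exact F.tree i
    · by_cases hij : i = j
      · subst hij
        rw [Function.update_self] at hv
        rw [Function.update_of_ne hii.symm] at hw
        exact fun hh => key i' hii.symm w hw v hv hh.symm
      · rw [Function.update_of_ne hij] at hv
        by_cases hij' : i' = j
        · subst hij'
          rw [Function.update_self] at hw
          exact key i hij v hv w hw
        · rw [Function.update_of_ne hij'] at hw
          exact F.nadj i i' hii v hv w hw
  -- The swapped forest extends to a dominating one. By maximality no part is added, so by the
  -- vertex count no vertex is, and it dominates already.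
  obtain ⟨C', D', hF', hsub⟩ := H.extend F' hN (by
    rw [F.biUnion_swap ha]
    intro m hm v hv hmv
    rcases mem_insert.1 hv with rfl | hv
    · exact hzN m hm hmv.symm
    · exact hND m hm v (mem_of_mem_erase hv) hmv)
  have hCC : univ.biUnion C ⊆ univ.biUnion C' := biUnion_mono fun i _ => (hsub i).1
  have hCeq := eq_of_subset_of_card_le hCC (hmax C' D' hF')
  have h1 := hF'.card_verts
  have h2 := F'.verts_card
  rw [Fintype.card_fin] at h2
  have hDeq := eq_of_subset_of_card_le (biUnion_mono (s := univ) fun i _ => (hsub i).2)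
    (by rw [← hCeq] at h1; omega)
  exact ⟨F', fun y hy => by rw [hDeq]; exact hF'.dom y (hCC hy)⟩

theorem card_excl (H : Counter G c n Δ h d k) (F : DomForest G c C D) {v : V}
    (hv : v ∈ univ.biUnion D) :
    2 * Δ < 3 * (excl G c (univ.biUnion C) (univ.biUnion D) v).card := by
  have h1 := card_excl_ge H.deg H.size F.dom v
  have h5 := card_erase_add_one hv
  have h6 := F.card_verts
  have h7 : Δ * (((univ.biUnion D).erase v).card + 1 + 2 * (d + 1)) =
      Δ * (2 * (univ.biUnion C).card) := by rw [h5, h6]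
  have h8 := H.count F.union_nonempty (card_le_univ _)
  nlinarith

/-- Every tree of a dominating forest dominates its own parts. -/
theorem dom_tree (H : Counter G c n Δ h d k) (F : DomForest G c C D) {j : Fin (d + 1)} {y : V}
    (hy : c y ∈ C j) : ∃ v ∈ D j, G.Adj y v := by
  by_contra hcon
  push Not at hcon
  set S := univ.biUnion C with hS
  have hS1 := F.union_nonempty
  set X := univ.filter (fun x => c x ∈ C j ∧ ∀ v ∈ D j, ¬ G.Adj x v) with hX
  have hjS : C j ⊆ S := subset_biUnion_of_mem C (mem_univ j)
  -- A vertex not dominated by its own tree has two neighbours in the forest, since with only one it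
  -- would lie in the tree of that neighbour by `excl_color`. Double counting then leaves fewer than
  -- `Δ/3` such vertices.
  have hXcard : 3 * X.card < Δ := by
    have h1 := card_add_card_le H.deg (X := X) (Y := univ.filter (fun x => c x ∈ S))
      (K := univ.biUnion D) (by
        intro x hx
        exact mem_filter.2 ⟨mem_univ _, hjS (mem_filter.1 hx).2.1⟩)
      (fun x hx => F.dom x (mem_filter.1 hx).2) (by
        intro x hx
        obtain ⟨hxj, hxD⟩ := (mem_filter.1 hx).2
        obtain ⟨v, hv, hxv⟩ := F.dom x (hjS hxj)
        by_contra hno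
        push Not at hno
        obtain ⟨i, _, hi⟩ := mem_biUnion.1 hv
        have hex : x ∈ excl G c (univ.biUnion C) (univ.biUnion D) v := by
          refine mem_excl.2 ⟨hjS hxj, hxv, fun w hw hxw => ?_⟩
          by_contra hne
          exact hno v hv w hw (Ne.symm hne) hxv hxw
        have hxi := H.excl_color F hi hex
        by_cases hij : i = j
        · subst hij; exact hxD v hi hxv
        · exact Finset.disjoint_left.1 (F.disj i j hij) hxi hxj)
    have h2 := card_parts_ge H.size S
    have h3 := F.card_verts
    have h4 := H.count hS1 (card_le_univ _)
    have h5 : Δ * ((univ.biUnion D).card + 2 * (d + 1)) = Δ * (2 * (univ.biUnion C).card) := by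
      rw [h3]
    nlinarith
  have h1 := card_out_add_in H.deg (c := c) (C j) (insert y (D j))
  have h2 : n * (C j).card ≤ (inNbrs G c (C j) (insert y (D j))).card + X.card := by
    refine (card_parts_ge H.size (C j)).trans (le_trans (card_le_card ?_) (card_union_le _ _))
    intro x hx
    have hxj := (mem_filter.1 hx).2
    by_cases hxD : ∃ v ∈ D j, G.Adj x v
    · obtain ⟨v, hv, hxv⟩ := hxD
      exact mem_union_left _ (mem_filter.2 ⟨mem_univ _, hxj, v, mem_insert_of_mem hv, hxv⟩)
    · push Not at hxD
      exact mem_union_right _ (mem_filter.2 ⟨mem_univ _, hxj, hxD⟩)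
  have h3 := (F.tree j).card
  have h4 := card_insert_le y (D j)
  have h5 : Δ * ((insert y (D j)).card + 1) ≤ Δ * (2 * (C j).card) :=
    Nat.mul_le_mul_left _ (by omega)
  -- Together with `y`, the transversal rooted at its part covers all of `C j`. It remains to miss
  -- at most `d` parts elsewhere, avoiding the neighbours of `y` and `D j`.
  obtain ⟨U, N, hdis, hU, hN, hND⟩ := exists_outer (G := G) (c := c) H.deg H.size (C j)
    (insert y (D j)) d (by
      intro t ht htP
      have h6 := H.count (s := t + (C j).card) (by omega) htP
      nlinarith)
  obtain ⟨M, hMD, hM⟩ := (F.tree j).select (c y) hy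
  have h6 := hM.insert (y := y) (fun m hm => hcon m (hMD hm)) (by simp)
  rw [insert_erase hy] at h6
  have h7 := h6.union hN hdis (fun v hv w hw hvw => hND w hw v (insert_subset_insert _ hMD hv)
    hvw.symm)
  have h8 := H.no _ _ h7
  rw [card_union_of_disjoint hdis] at h8
  omega

theorem tree_card (H : Counter G c n Δ h d k) (F : DomForest G c C D) (j : Fin (d + 1)) :
    2 * h + 1 ≤ (C j).card := by
  have h1 := count_of_dominated H.deg H.size (S := C j) (K := D j) (fun y hy => H.dom_tree F hy)
  have h2 := (F.tree j).card
  have h3 : 1 ≤ (C j).card := card_pos.2 (F.tree_nonempty j)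
  have h4 : (C j).card * (2 * Δ * h) < (C j).card * (n * h + Δ) :=
    Nat.mul_lt_mul_of_pos_left H.large h3
  have h5 : h * (n * (C j).card) ≤ h * (Δ * (D j).card) := Nat.mul_le_mul_left _ h1
  have h6 : Δ * h * ((D j).card + 2) = Δ * h * (2 * (C j).card) := by rw [h2]
  have h7 : Δ * (2 * h) < Δ * (C j).card := by nlinarith
  exact lt_of_mul_lt_mul_left h7 (Nat.zero_le _)

/-- If every tree had at least `2h + 2` parts, there would be at least `(2h + 2)(d + 1)` parts, more
than `r` because `k ≤ d`. -/
theorem exists_small_tree (H : Counter G c n Δ h d k) (F : DomForest G c C D) :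
    ∃ j, (C j).card = 2 * h + 1 := by
  by_contra hcon
  push Not at hcon
  have h1 : ∀ j ∈ (univ : Finset (Fin (d + 1))), 2 * h + 2 ≤ (C j).card := by
    intro j _
    have := H.tree_card F j
    have := hcon j
    omega
  have h2 := card_nsmul_le_sum _ _ _ h1
  rw [← card_biUnion (fun i _ j _ hij => F.disj i j hij)] at h2
  have h3 := card_le_univ (univ.biUnion C)
  rw [H.card] at h3
  simp only [card_univ, Fintype.card_fin, smul_eq_mul] at h2
  have := H.rem
  nlinarith

theorem exists_min_nbrs {Q : (Fin (d + 1) → Finset V) → Prop} (hQ : ∃ D, Q D) (y : V) :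
    ∃ D, Q D ∧ ∀ D', Q D' → ((univ.biUnion D).filter (G.Adj y)).card ≤
      ((univ.biUnion D').filter (G.Adj y)).card := by
  obtain ⟨D₀, hD₀⟩ := hQ
  obtain ⟨D, hD, hm⟩ := exists_min_image (univ.filter Q)
    (fun D => ((univ.biUnion D).filter (G.Adj y)).card) ⟨D₀, by simp [hD₀]⟩
  exact ⟨D, by simpa using hD, fun D' hD' => hm D' (by simp [hD'])⟩

/-- Take the dominating forest on the same parts with the fewest neighbours of `y`. If `g` is a
neighbour of `y` in tree `j`, all private neighbours of its partner are adjacent to `y`, since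
otherwise a swap would lower the number. -/
theorem card_nbrs_inside (H : Counter G c n Δ h d k) (F : DomForest G c C D)
    (hmax : ∀ C' D', DomForest G c (d := d) C' D' → (univ.biUnion C').card ≤ (univ.biUnion C).card)
    {j : Fin (d + 1)} {y : V} (hy : c y ∈ C j) :
    2 * Δ < 3 * (univ.filter (fun z => G.Adj y z ∧ c z ∈ C j)).card := by
  obtain ⟨D', F', hmin⟩ := exists_min_nbrs (G := G) (Q := fun D => DomForest G c C D) ⟨D, F⟩ y
  obtain ⟨g, hg, hyg⟩ := H.dom_tree F' hy
  obtain ⟨g', hg', hgg, _⟩ := (F'.tree j).pair g hg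
  refine lt_of_lt_of_le (H.card_excl F' (mem_biUnion.2 ⟨j, mem_univ _, hg'⟩))
    (Nat.mul_le_mul_left _ (card_le_card ?_))
  intro z hz
  refine mem_filter.2 ⟨mem_univ _, ?_, H.excl_color F' hg' hz⟩
  by_contra hyz
  have h1 := hmin _ (H.swap F' hmax hg hg' hgg hz)
  have h2 := F'.card_nbrs_swap hg hyg hyz
  omega

/-- The other trees can be changed so that they avoid the neighbourhood of a given vertex. -/
theorem exists_avoiding (H : Counter G c n Δ h d k) (F : DomForest G c C D)
    (hmax : ∀ C' D', DomForest G c (d := d) C' D' → (univ.biUnion C').card ≤ (univ.biUnion C).card)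
    {j : Fin (d + 1)} {y : V} (hy : c y ∈ C j) :
    ∃ D', DomForest G c C D' ∧ D' j = D j ∧ ∀ i, i ≠ j → ∀ v ∈ D' i, ¬ G.Adj y v := by
  obtain ⟨D', ⟨F', hj⟩, hmin⟩ := exists_min_nbrs (G := G)
    (Q := fun D' => DomForest G c C D' ∧ D' j = D j) ⟨D, F, rfl⟩ y
  refine ⟨D', F', hj, fun i hij g hg hyg => ?_⟩
  obtain ⟨g', hg', hgg, _⟩ := (F'.tree i).pair g hg
  have h1 := H.card_excl F' (mem_biUnion.2 ⟨i, mem_univ _, hg'⟩)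
  have h2 := H.card_nbrs_inside F hmax hy
  -- A neighbour in tree `i` would force over `2Δ/3` neighbours of `y` in `C i`, in addition to
  -- those in `C j`.
  have h3 : (excl G c (univ.biUnion C) (univ.biUnion D') g' ∪
      univ.filter (fun z => G.Adj y z ∧ c z ∈ C j)).card ≤ Δ := by
    refine le_trans (card_le_card (union_subset ?_ ?_)) (H.deg y)
    · intro z hz
      simp only [mem_filter, mem_univ, true_and]
      by_contra hyz
      have h1 := hmin _ ⟨H.swap F' hmax hg hg' hgg hz, by rw [Function.update_of_ne hij.symm, hj]⟩
      have h2 := F'.card_nbrs_swap hg hyg hyz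
      omega
    · intro z hz
      simp only [mem_filter, mem_univ, true_and] at hz ⊢
      exact hz.1
  rw [card_union_of_disjoint] at h3
  · omega
  · rw [Finset.disjoint_left]
    intro z hz hz'
    exact Finset.disjoint_left.1 (F.disj i j hij) (H.excl_color F' hg' hz) (mem_filter.1 hz').2.2

/-- A vertex private with respect to tree `j` may have neighbours in other trees. `exists_avoiding`
clears them without changing tree `j`, after which the swap in the whole forest applies. -/
theorem swapClass (H : Counter G c n Δ h d k) 
    (hmax : ∀ C' D', DomForest G c (d := d) C' D' → (univ.biUnion C').card ≤ (univ.biUnion C).card)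
    {j : Fin (d + 1)} (hj : (C j).card = 2 * h + 1) :
    SwapClass G c (C j) n Δ h (fun X => ∃ D, DomForest G c C D ∧ D j = X) := by
  refine ⟨H.deg, H.size, hj, by have := H.height; omega, H.large, ?_, ?_, ?_⟩
  · rintro _ ⟨D, F, rfl⟩
    exact F.tree j
  · rintro _ ⟨D, F, rfl⟩ y hy
    exact H.dom_tree F hy
  · rintro _ ⟨D, F, rfl⟩ a ha b hb hab z hz
    obtain ⟨hzj, hzb, hzu⟩ := mem_excl.1 hz
    obtain ⟨D', F', hjj, hav⟩ := H.exists_avoiding F hmax hzj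
    rw [← hjj] at ha hb hzu ⊢
    refine ⟨_, H.swap F' hmax ha hb hab (z := z) (mem_excl.2
      ⟨mem_biUnion.2 ⟨j, mem_univ _, hzj⟩, hzb, fun x hx hzx => ?_⟩), Function.update_self _ _ _⟩
    obtain ⟨i, _, hi⟩ := mem_biUnion.1 hx
    by_cases hij : i = j
    · subst hij; exact hzu x hi hzx
    · exact absurd hzx (hav i hij x hi)

theorem false (H : Counter G c n Δ h d k) : False := by
  obtain ⟨C, D, F, hmax⟩ := H.exists_max
  obtain ⟨j, hj⟩ := H.exists_small_tree F
  have hh := H.height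
  obtain ⟨J₀, hJ₀⟩ := exists_full_of_odd G c (C j) H.deg H.size H.proper hj (by omega) H.large
  obtain ⟨J, hJ, hout⟩ := (H.swapClass hmax hj).exists_small_out ⟨_, D, F, rfl⟩ hJ₀
    (s := d + k) (by omega)
  obtain ⟨U, N, hdis, hU, hN, hND⟩ := exists_outer (G := G) (c := c) H.deg H.size (C j) J d (by
    intro t ht htP
    rw [hj, H.card] at htP
    have h1 : t * (2 * Δ * h) < t * (n * h + Δ) := Nat.mul_lt_mul_of_pos_left H.large (by omega)
    -- Outside `C j` there are `2hd + d + k` parts. Their shortfall, below `Δ/h` each, exceeds the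
    -- allowance `2Δd` by less than `(d + k)Δ/h`, which is what the choice `s = d + k` saves.
    have h2 : t ≤ 2 * h * d + d + k := by nlinarith
    have h3 : Δ * t ≤ Δ * (2 * h * d + d + k) := Nat.mul_le_mul_left _ h2
    have h4 : h * ((outNbrs G c (C j) J).card + 2 * Δ * t) < h * (n * t + 2 * Δ * (d + 1)) := by
      nlinarith
    exact lt_of_mul_lt_mul_left h4 (Nat.zero_le _))
  have h1 := hJ.union hN hdis (fun v hv w hw hvw => hND w hw v hv hvw.symm)
  have h2 := H.no _ _ h1
  rw [card_union_of_disjoint hdis] at h2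
  omega

end Counter
end PartialIT

/-! ### The extremal graph. -/

namespace PartialIT

open Finset
open scoped Classical

/-- The vertices of the extremal graph: `2(d+1)` sides, each with a stream of `hΔ` vertices and
`h-1` further blocks, and `d+1+k` parts of isolated vertices. -/
abbrev ExtVert (d k h n Δ : ℕ) : Type :=
  ((Fin (d + 1) × Bool) × (Fin (h * Δ) ⊕ Fin (h - 1) × Fin Δ)) ⊕ (Fin (d + 1 + k) × Fin n)

/-- The parts of the extremal graph. -/
abbrev ExtPart (d k h : ℕ) : Type := ((Fin (d + 1) × Bool) × Fin h) ⊕ Fin (d + 1 + k)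

/-- The part of its side in which a member of the stream lies. -/
def streamPart (h m t : ℕ) : ℕ := if t < (h - 1) * m then t / m else h - 1

theorem streamPart_lt {h m t : ℕ} (hh : 0 < h) : streamPart h m t < h := by
  rw [streamPart]
  split_ifs with ht
  · have := Nat.div_lt_of_lt_mul (m := t) (n := m) (k := h - 1) (by rwa [mul_comm])
    omega
  · omega

theorem pos_of_stream {h Δ : ℕ} (t : Fin (h * Δ)) : 0 < h ∧ 0 < Δ := by
  have := t.2
  constructor <;> (apply Nat.pos_of_ne_zero; rintro rfl; simp at this)

/-- The partition of the extremal graph. -/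
def extColor (d k h n Δ : ℕ) : ExtVert d k h n Δ → ExtPart d k h
  | .inl (s, .inl t) => .inl (s, ⟨streamPart h (n - Δ) t, streamPart_lt (pos_of_stream t).1⟩)
  | .inl (s, .inr (w, _)) => .inl (s, ⟨w, by omega⟩)
  | .inr (j, _) => .inr j

/-- Adjacency in the extremal graph. -/
def extAdj (d k h n Δ : ℕ) : ExtVert d k h n Δ → ExtVert d k h n Δ → Prop
  | .inl (s, .inl t), .inl (s', .inl t') => s.1 = s'.1 ∧ s.2 ≠ s'.2 ∧ t.1 < Δ ∧ t'.1 < Δ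
  | .inl (s, .inl t), .inl (s', .inr (w, _)) => s = s' ∧ t.1 / Δ = w.1 + 1
  | .inl (s, .inr (w, _)), .inl (s', .inl t) => s = s' ∧ t.1 / Δ = w.1 + 1
  | _, _ => False

/-- The extremal graph. -/
def extGraph (d k h n Δ : ℕ) : SimpleGraph (ExtVert d k h n Δ) where
  Adj := extAdj d k h n Δ
  symm := ⟨by
    rintro (⟨s, t | ⟨w, i⟩⟩ | ⟨j, i⟩) (⟨s', t' | ⟨w', i'⟩⟩ | ⟨j', i'⟩) hh <;>
      simp only [extAdj] at hh ⊢
    · exact ⟨hh.1.symm, hh.2.1.symm, hh.2.2.2, hh.2.2.1⟩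
    · exact ⟨hh.1.symm, hh.2⟩
    · exact ⟨hh.1.symm, hh.2⟩⟩
  loopless := ⟨by
    rintro (⟨s, t | ⟨w, i⟩⟩ | ⟨j, i⟩) hh <;> simp only [extAdj] at hh
    exact hh.2.1 rfl⟩

section Ext

variable {d k h n Δ : ℕ}

/-- Parts take `m ≤ Δ` stream vertices at a time, so the index of the part runs ahead of the index
of the block until the last part takes all the rest. -/
theorem streamPart_ge {m t : ℕ} (hh : 0 < h) (hm : m ≤ Δ) (ht : t < h * Δ) :
    t / Δ ≤ streamPart h m t := by
  rw [streamPart]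
  split_ifs with htm
  · have hm0 : 0 < m := by
      apply Nat.pos_of_ne_zero
      rintro rfl
      simp at htm
    exact Nat.div_le_div_left hm hm0
  · have := Nat.div_lt_of_lt_mul (m := t) (n := Δ) (k := h) (by rwa [mul_comm])
    omega

theorem ext_proper (hm : n - Δ ≤ Δ) (x y : ExtVert d k h n Δ) (hxy : (extGraph d k h n Δ).Adj x y) :
    extColor d k h n Δ x ≠ extColor d k h n Δ y := by
  have key : ∀ (t : Fin (h * Δ)) (w : Fin (h - 1)), t.1 / Δ = w.1 + 1 →
      streamPart h (n - Δ) t ≠ w := by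
    intro t w htw heq
    have := streamPart_ge (pos_of_stream t).1 hm t.2
    omega
  change extAdj d k h n Δ x y at hxy
  rcases x with ⟨s, t | ⟨w, i⟩⟩ | ⟨j, i⟩ <;> rcases y with ⟨s', t' | ⟨w', i'⟩⟩ | ⟨j', i'⟩ <;>
    simp only [extAdj] at hxy <;> simp only [extColor, ne_eq, Sum.inl.injEq, Prod.mk.injEq, not_and,
      Fin.mk.injEq]
  · rintro rfl
    exact absurd rfl hxy.2.1
  · intro _
    exact key t w' hxy.2
  · intro _ hh
    exact key t' w hxy.2 hh.symm

/-- All neighbours of a vertex lie in a single block of `Δ` vertices, so the position in the block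
is injective on them. -/
theorem ext_degree (x : ExtVert d k h n Δ) :
    (univ.filter ((extGraph d k h n Δ).Adj x)).card ≤ Δ := by
  let f : ExtVert d k h n Δ → ℕ := fun x => match x with
    | .inl (_, .inl t) => t.1 % Δ
    | .inl (_, .inr (_, i)) => i.1
    | .inr _ => 0
  refine (card_le_card_of_injOn (t := range Δ) f ?_ ?_).trans (card_range Δ).le
  · intro y hy
    have hxy : extAdj d k h n Δ x y := (mem_filter.1 (mem_coe.1 hy)).2
    simp only [coe_range, Set.mem_Iio]
    rcases y with ⟨s', t' | ⟨w', i'⟩⟩ | ⟨j', i'⟩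
    · exact Nat.mod_lt _ (pos_of_stream t').2
    · exact i'.2
    · rcases x with ⟨s, t | ⟨w, i⟩⟩ | ⟨j, i⟩ <;> simp [extAdj] at hxy
  · intro y hy z hz hyz
    have hxy : extAdj d k h n Δ x y := (mem_filter.1 (mem_coe.1 hy)).2
    have hxz : extAdj d k h n Δ x z := (mem_filter.1 (mem_coe.1 hz)).2
    rcases x with ⟨s, t | ⟨w, i⟩⟩ | ⟨j, i⟩ <;> rcases y with ⟨s', t' | ⟨w', i'⟩⟩ | ⟨j', i'⟩ <;>
      rcases z with ⟨s'', t'' | ⟨w'', i''⟩⟩ | ⟨j'', i''⟩ <;>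
      simp only [extAdj] at hxy hxz <;> simp only [f] at hyz
    · rw [Nat.mod_eq_of_lt hxy.2.2.2, Nat.mod_eq_of_lt hxz.2.2.2] at hyz
      have h1 : s' = s'' := by
        refine Prod.ext (hxy.1.symm.trans hxz.1) ?_
        have h1 := hxy.2.1
        have h2 := hxz.2.1
        revert h1 h2
        cases s.2 <;> cases s'.2 <;> cases s''.2 <;> simp
      rw [h1, Fin.ext hyz]
    · have := Nat.div_eq_of_lt hxy.2.2.1
      omega
    · have := Nat.div_eq_of_lt hxz.2.2.1
      omega
    · have h1 : w' = w'' := Fin.ext (by omega)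
      rw [← hxy.1, ← hxz.1, h1, Fin.ext hyz]
    · have h1 : t' = t'' := by
        apply Fin.ext
        rw [← Nat.div_add_mod t'.1 Δ, ← Nat.div_add_mod t''.1 Δ, hyz, hxy.2, hxz.2]
      rw [← hxy.1, ← hxz.1, h1]

theorem ext_degree_eq (hh : 0 < h) (hΔ : 0 < Δ) :
    ∃ x, (univ.filter ((extGraph d k h n Δ).Adj x)).card = Δ := by
  have hle : Δ ≤ h * Δ := Nat.le_mul_of_pos_left _ hh
  refine ⟨.inl ((0, false), .inl ⟨0, by omega⟩), le_antisymm (ext_degree _) ?_⟩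
  conv_lhs => rw [← Fintype.card_fin Δ, ← card_univ]
  refine card_le_card_of_injOn
    (fun j => (.inl ((0, true), .inl ⟨j.1, by omega⟩) : ExtVert d k h n Δ)) ?_ ?_
  · intro j _
    rw [mem_coe, mem_filter]
    exact ⟨mem_univ _, rfl, by simp, hΔ, j.2⟩
  · intro i _ j _ hij
    simpa [Fin.ext_iff] using hij

/-- Every part of a side but the last has a block of `Δ` vertices and `n - Δ` of the stream. The
last one keeps the remaining `hΔ - (h - 1)(n - Δ)`, which `hn` makes at least `n`; for `n < Δ` the
truncated difference is zero. -/
theorem ext_size (hn : n * h + Δ ≤ 2 * Δ * h) (p : ExtPart d k h) :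
    n ≤ (univ.filter (fun x => extColor d k h n Δ x = p)).card := by
  rcases p with ⟨s, u⟩ | j
  · have hh : 0 < h := by have := u.2; omega
    have hm : n - Δ ≤ Δ := by
      have : n * h ≤ 2 * Δ * h := by omega
      have := Nat.le_of_mul_le_mul_right this hh
      omega
    obtain ⟨g, rfl⟩ : ∃ g, h = g + 1 := ⟨h - 1, by omega⟩
    have hgm : g * (n - Δ) ≤ g * Δ := Nat.mul_le_mul_left _ hm
    have hgh : (g + 1) * Δ = g * Δ + Δ := by ring
    by_cases hu : u.1 < g
    · have hb : ∀ j : Fin (n - Δ), u.1 * (n - Δ) + j.1 < g * (n - Δ) := by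
        intro j
        calc u.1 * (n - Δ) + j.1 < u.1 * (n - Δ) + (n - Δ) := by omega
          _ = (u.1 + 1) * (n - Δ) := by ring
          _ ≤ _ := Nat.mul_le_mul_right _ hu
      have h1 : n ≤ Fintype.card (Fin Δ ⊕ Fin (n - Δ)) := by
        simp only [Fintype.card_sum, Fintype.card_fin]; omega
      refine h1.trans ?_
      rw [← card_univ]
      refine card_le_card_of_injOn (fun x => match x with
        | .inl i => (.inl (s, .inr (⟨u.1, by simpa using hu⟩, i)) : ExtVert d k (g + 1) n Δ)
        | .inr j => .inl (s, .inl ⟨u.1 * (n - Δ) + j.1, by have := hb j; omega⟩)) ?_ ?_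
      · rintro (i | j) _
        · exact mem_coe.2 (mem_filter.2 ⟨mem_univ _, rfl⟩)
        · have h2 : streamPart (g + 1) (n - Δ) (u.1 * (n - Δ) + j.1) = u.1 := by
            rw [streamPart, Nat.add_sub_cancel, if_pos (hb j), mul_comm,
              Nat.mul_add_div (by have := j.2; omega), Nat.div_eq_of_lt j.2, add_zero]
          refine mem_coe.2 (mem_filter.2 ⟨mem_univ _, ?_⟩)
          exact congrArg (fun u => Sum.inl (s, u)) (Fin.ext h2)
      · rintro (i | j) _ (i' | j') _ hij
        · simpa using hij
        · simp at hij
        · simp at hij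
        · simpa [Fin.ext_iff] using hij
    · have hug : u.1 = g := by have := u.2; omega
      have h1 : n ≤ Fintype.card (Fin ((g + 1) * Δ - g * (n - Δ))) := by
        rw [Fintype.card_fin]
        rcases le_total n Δ with hle | hle
        · rw [Nat.sub_eq_zero_of_le hle]
          simp only [mul_zero, Nat.sub_zero]
          omega
        · obtain ⟨m, rfl⟩ := Nat.exists_eq_add_of_le hle
          rw [Nat.add_sub_cancel_left] at hgm ⊢
          apply Nat.le_sub_of_add_le
          nlinarith
      refine h1.trans ?_
      rw [← card_univ]
      refine card_le_card_of_injOn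
        (fun j => (.inl (s, .inl ⟨g * (n - Δ) + j.1, by have := j.2; omega⟩) :
          ExtVert d k (g + 1) n Δ)) ?_ ?_
      · intro j _
        have h2 : streamPart (g + 1) (n - Δ) (g * (n - Δ) + j.1) = u.1 := by
          rw [hug, streamPart, Nat.add_sub_cancel, if_neg (by omega)]
        refine mem_coe.2 (mem_filter.2 ⟨mem_univ _, ?_⟩)
        exact congrArg (fun u => Sum.inl (s, u)) (Fin.ext h2)
      · intro i _ j _ hij
        simpa [Fin.ext_iff] using hij
  · have h1 : n = Fintype.card (Fin n) := by simp
    conv_lhs => rw [h1, ← card_univ]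
    refine card_le_card_of_injOn (fun i => (.inr (j, i) : ExtVert d k h n Δ)) ?_ ?_
    · intro i _
      exact mem_coe.2 (mem_filter.2 ⟨mem_univ _, rfl⟩)
    · intro i _ i' _ hij
      simpa using hij

/-- A transversal of a side contains one of the first `Δ` members of its stream. -/
theorem ext_side (hh : 0 < h) (hm : n - Δ ≤ Δ) {T : Finset (ExtPart d k h)}
    {M : Finset (ExtVert d k h n Δ)} (hM : FullIT (extGraph d k h n Δ) (extColor d k h n Δ) T M)
    {s : Fin (d + 1) × Bool} (hs : ∀ u, .inl (s, u) ∈ T) :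
    ∃ t : Fin (h * Δ), t.1 < Δ ∧ .inl (s, .inl t) ∈ M := by
  have hmem : ∀ u : Fin h, (∃ t : Fin (h * Δ), streamPart h (n - Δ) t = u.1 ∧
      .inl (s, .inl t) ∈ M) ∨ ∃ (w : Fin (h - 1)) (i : Fin Δ), w.1 = u.1 ∧
      .inl (s, .inr (w, i)) ∈ M := by
    intro u
    obtain ⟨x, hx, hxu⟩ := hM.mem_iff.1 (hs u)
    rcases x with ⟨s', t | ⟨w, i⟩⟩ | ⟨j, i⟩ <;> simp only [extColor, Sum.inl.injEq, Prod.mk.injEq,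
      reduceCtorEq] at hxu
    · obtain ⟨rfl, rfl⟩ := hxu
      exact Or.inl ⟨t, rfl, hx⟩
    · obtain ⟨rfl, rfl⟩ := hxu
      exact Or.inr ⟨w, i, rfl, hx⟩
  -- A chosen stream vertex of block `v > 0` excludes the further block in part `v - 1`. That part
  -- must then use a stream vertex, whose block has index at most `v - 1`. The descent starts in the
  -- last part, which contains only stream vertices.
  have hdesc : ∀ v, (∃ t : Fin (h * Δ), t.1 / Δ = v ∧ .inl (s, .inl t) ∈ M) →
      ∃ t : Fin (h * Δ), t.1 < Δ ∧ .inl (s, .inl t) ∈ M := by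
    intro v
    induction v using Nat.strong_induction_on with
    | _ v ih =>
      rintro ⟨t, htv, ht⟩
      have hΔ := (pos_of_stream t).2
      rcases Nat.eq_zero_or_pos v with rfl | hv
      · exact ⟨t, (Nat.div_eq_zero_iff_lt hΔ).1 htv, ht⟩
      have hvh : v < h := by
        rw [← htv]
        exact Nat.div_lt_of_lt_mul (t.2.trans_eq (mul_comm h Δ))
      rcases hmem ⟨v - 1, by omega⟩ with ⟨t', ht', htM⟩ | ⟨w, i, hw, hwM⟩
      · refine ih (t'.1 / Δ) ?_ ⟨t', rfl, htM⟩
        have := streamPart_ge hh hm t'.2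
        simp only at ht'
        omega
      · exfalso
        refine hM.1 _ ht _ hwM ?_
        simp only at hw
        exact ⟨rfl, by omega⟩
  rcases hmem ⟨h - 1, by omega⟩ with ⟨t, _, htM⟩ | ⟨w, i, hw, hwM⟩
  · exact hdesc _ ⟨t, rfl, htM⟩
  · have := w.2
    simp only at hw
    omega

theorem ext_no (hh : 0 < h) (hm : n - Δ ≤ Δ) {T : Finset (ExtPart d k h)}
    {M : Finset (ExtVert d k h n Δ)} (hM : FullIT (extGraph d k h n Δ) (extColor d k h n Δ) T M) :
    T.card + d < Fintype.card (ExtPart d k h) := by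
  have hmiss : ∀ g : Fin (d + 1), ∃ b u, (.inl ((g, b), u) : ExtPart d k h) ∉ T := by
    intro g
    by_contra hcon
    push Not at hcon
    obtain ⟨t, ht, htM⟩ := ext_side hh hm hM (s := (g, false)) (hcon false)
    obtain ⟨t', ht', htM'⟩ := ext_side hh hm hM (s := (g, true)) (hcon true)
    exact hM.1 _ htM _ htM' ⟨rfl, by simp, ht, ht'⟩
  choose b u hbu using hmiss
  have h1 : Fintype.card (Fin (d + 1)) ≤ Tᶜ.card := by
    rw [← card_univ]
    refine card_le_card_of_injOn (fun g => .inl ((g, b g), u g)) ?_ ?_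
    · intro g _
      simpa using hbu g
    · intro g _ g' _ hgg
      simp only [Sum.inl.injEq, Prod.mk.injEq] at hgg
      exact hgg.1.1
  rw [Fintype.card_fin, card_compl] at h1
  omega

end Ext
end PartialIT

/-! ### From transversals to the two extremal functions. -/

namespace PartialIT

open Finset
open scoped Classical

theorem FullIT.card_eq {V P : Type*} {G : SimpleGraph V} {c : V → P} {T : Finset P} {M : Finset V}
    (h : FullIT G c T M) : T.card = M.card := by
  rw [← h.2.2, card_image_of_injOn h.2.1]

theorem exists_fullIT_of_injOn {V P : Type*} {G : SimpleGraph V} {c : V → P} {M : Finset V}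
    (h : ∀ v ∈ M, ∀ w ∈ M, ¬ G.Adj v w) (hc : Set.InjOn c (M : Set V)) : ∃ T, FullIT G c T M :=
  ⟨_, h, hc, rfl⟩

theorem exists_extremal {h d k r n Δ : ℕ} (hh : 0 < h) (hr : r = (2 * h + 1) * (d + 1) + k)
    (hn : n * h + Δ ≤ 2 * Δ * h) :
    ∃ (V : Type) (_ : Fintype V) (G : SimpleGraph V) (c : V → Fin r),
      (∀ v w, G.Adj v w → c v ≠ c w) ∧ (∀ p, n ≤ (univ.filter (fun v => c v = p)).card) ∧
      (∀ v, (univ.filter (G.Adj v)).card ≤ Δ) ∧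
      (0 < Δ → ∃ v, (univ.filter (G.Adj v)).card = Δ) ∧
      ∀ T M, FullIT G c T M → T.card + d < r := by
  have hm : n - Δ ≤ Δ := by
    have : n * h ≤ 2 * Δ * h := by omega
    have := Nat.le_of_mul_le_mul_right this hh
    omega
  have hcard : Fintype.card (ExtPart d k h) = r := by
    simp only [Fintype.card_sum, Fintype.card_prod, Fintype.card_fin, Fintype.card_bool]
    rw [hr]
    ring
  let e := Fintype.equivFinOfCardEq hcard
  refine ⟨ExtVert d k h n Δ, inferInstance, extGraph d k h n Δ, fun v => e (extColor d k h n Δ v),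
    fun v w hvw hc => ext_proper hm v w hvw (e.injective hc), fun p => ?_, fun v => ?_,
    fun hΔ => ?_, fun T M hM => ?_⟩
  · have h1 := ext_size hn (e.symm p)
    have h2 : ∀ v, e (extColor d k h n Δ v) = p ↔ extColor d k h n Δ v = e.symm p :=
      fun v => e.eq_symm_apply.symm
    simp only [h2]
    convert h1
  · convert ext_degree v
  · obtain ⟨v, hv⟩ := ext_degree_eq (d := d) (k := k) (n := n) hh hΔ
    exact ⟨v, by convert hv⟩
  · obtain ⟨T', hT'⟩ := exists_fullIT_of_injOn (c := extColor d k h n Δ) hM.1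
      (fun v hv w hw hvw => hM.2.1 hv hw (congrArg e hvw))
    have h2 := ext_no hh hm hT'
    rwa [hT'.card_eq, ← hM.card_eq, hcard] at h2

theorem FullIT.of_comap {V P : Type*} {G : SimpleGraph V} {c : V → P} {A : Finset V} {T : Finset P} {M : Finset {v // v ∈ A}}
    (h : FullIT (G.comap Subtype.val) (fun v => c v.1) T M) :
    FullIT G c T (M.map (Function.Embedding.subtype _)) := by
  refine ⟨?_, ?_, ?_⟩
  · intro v hv w hw
    obtain ⟨v', hv', rfl⟩ := mem_map.1 hv
    obtain ⟨w', hw', rfl⟩ := mem_map.1 hw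
    exact h.1 v' hv' w' hw'
  · intro v hv w hw hvw
    obtain ⟨v', hv', rfl⟩ := mem_map.1 (mem_coe.1 hv)
    obtain ⟨w', hw', rfl⟩ := mem_map.1 (mem_coe.1 hw)
    rw [h.2.1 hv' hw' hvw]
  · rw [← h.2.2]
    ext p
    simp

section Restrict

variable {V P : Type*} [Fintype V] {G : SimpleGraph V} {c : V → P} {n : ℕ}

/-- Parts of size at least `n` can be cut down to size exactly `n`. -/
theorem exists_exact (hsize : ∀ p, n ≤ (univ.filter (fun v => c v = p)).card) :
    ∃ A : Finset V, ∀ p, (univ.filter (fun v : {v // v ∈ A} => c v.1 = p)).card = n := by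
  choose B hB hBn using fun p => exists_subset_card_eq (hsize p)
  refine ⟨univ.filter (fun v => v ∈ B (c v)), fun p => ?_⟩
  rw [← hBn p]
  refine card_bij (fun v _ => v.1) ?_ (fun _ _ _ _ h => Subtype.ext h) ?_
  · rintro ⟨v, hv⟩ hvp
    have h1 := (mem_filter.1 hvp).2
    have h2 := (mem_filter.1 hv).2
    simp only at h1
    rwa [h1] at h2
  · intro v hv
    have h1 := (mem_filter.1 (hB p hv)).2
    exact ⟨⟨v, by simp [h1, hv]⟩, by simp [h1], rfl⟩

theorem card_comap_le (A : Finset V) (v : {v // v ∈ A}) :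
    (univ.filter ((G.comap Subtype.val).Adj v)).card ≤ (univ.filter (G.Adj v.1)).card := by
  refine card_le_card_of_injOn Subtype.val ?_ (fun _ _ _ _ h => Subtype.ext h)
  intro w hw
  have := (mem_filter.1 (mem_coe.1 hw)).2
  exact mem_coe.2 (mem_filter.2 ⟨mem_univ _, this⟩)

end Restrict

section Complement

/-- The complement of a graph inside the complete multipartite graph with the same parts. -/
def multiCompl {V P : Type*} (G : SimpleGraph V) (c : V → P) : SimpleGraph V where
  Adj v w := c v ≠ c w ∧ ¬ G.Adj v w
  symm := ⟨fun _ _ h => ⟨h.1.symm, fun hh => h.2 hh.symm⟩⟩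
  loopless := ⟨fun _ h => h.1 rfl⟩

variable {V P : Type*} {G : SimpleGraph V} {c : V → P}

theorem multiCompl_adj {v w : V} : (multiCompl G c).Adj v w ↔ c v ≠ c w ∧ ¬ G.Adj v w := Iff.rfl

theorem card_multiCompl [Fintype V] [Fintype P] {n : ℕ} (hproper : ∀ v w, G.Adj v w → c v ≠ c w)
    (hsize : ∀ p, (univ.filter (fun v => c v = p)).card = n) (v : V) :
    (univ.filter ((multiCompl G c).Adj v)).card + (univ.filter (G.Adj v)).card + n =
      Fintype.card P * n := by
  have h1 : Fintype.card V = Fintype.card P * n := by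
    rw [← card_univ, card_eq_sum_card_fiberwise (f := c) (t := univ) (fun _ _ => by simp),
      sum_congr rfl (fun p _ => hsize p)]
    simp
  rw [← h1, ← hsize (c v), ← card_univ, ← card_union_of_disjoint, ← card_union_of_disjoint]
  · congr 1
    ext w
    simp only [mem_union, mem_filter, mem_univ, true_and, multiCompl_adj, iff_true]
    by_cases hw : c w = c v
    · exact Or.inr hw
    · by_cases hvw : G.Adj v w
      · exact Or.inl (Or.inr hvw)
      · exact Or.inl (Or.inl ⟨Ne.symm hw, hvw⟩)
  · rw [Finset.disjoint_left]
    intro w hw hw'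
    have hw' := (mem_filter.1 hw').2
    rcases mem_union.1 hw with hw | hw
    · exact (mem_filter.1 hw).2.1 hw'.symm
    · exact hproper v w (mem_filter.1 hw).2 hw'.symm
  · rw [Finset.disjoint_left]
    intro w hw hw'
    exact (mem_filter.1 hw).2.2 (mem_filter.1 hw').2

theorem FullIT.isNClique {T : Finset P} {M : Finset V} (h : FullIT (multiCompl G c) c T M) :
    G.IsNClique T.card M := by
  refine ⟨?_, h.card_eq.symm⟩
  · intro v hv w hw hvw
    by_contra hadj
    exact h.1 v hv w hw ⟨fun hc => hvw (h.2.1 hv hw hc), hadj⟩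

theorem fullIT_of_isNClique {M : Finset V} {t : ℕ} (h : (multiCompl G c).IsNClique t M) :
    ∃ T, FullIT G c T M ∧ T.card = t := by
  have hinj : Set.InjOn c (M : Set V) := by
    intro v hv w hw hvw
    by_contra hne
    exact (h.1 hv hw hne).1 hvw
  obtain ⟨T, hT⟩ := exists_fullIT_of_injOn (fun v hv w hw hadj => (h.1 hv hw hadj.ne).2 hadj) hinj
  exact ⟨T, hT, by rw [hT.card_eq, h.2]⟩

end Complement

theorem ncard_colorClass {V : Type*} [Fintype V] {G : SimpleGraph V} {r : ℕ}
    (c : G.Coloring (Fin r)) (i : Fin r) :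
    (c.colorClass i).ncard = (univ.filter (fun v => c v = i)).card := by
  rw [← Set.ncard_coe_finset]
  congr 1
  ext v
  simp [SimpleGraph.Coloring.colorClass]

theorem degree_eq_card {V : Type*} [Fintype V] (G : SimpleGraph V) (v : V) :
    G.degree v = (univ.filter (G.Adj v)).card := by
  rw [← SimpleGraph.card_neighborFinset_eq_degree]
  congr 1
  ext w
  simp

theorem exists_isIT {V : Type*} {G : SimpleGraph V} {r t : ℕ} (c : G.Coloring (Fin r))
    {T : Finset (Fin r)} {M : Finset V} (h : FullIT G c T M) (ht : t ≤ T.card) :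
    ∃ S, IsIT c t S := by
  rw [h.card_eq] at ht
  obtain ⟨S, hS, hSt⟩ := exists_subset_card_eq ht
  exact ⟨S, fun v hv w hw _ => h.1 v (hS hv) w (hS hw), h.2.1.mono (by exact_mod_cast hS), hSt⟩

theorem IsIT.fullIT {V : Type*} {G : SimpleGraph V} {r t : ℕ} {c : G.Coloring (Fin r)}
    {S : Finset V} (h : IsIT c t S) : ∃ T, FullIT G c T S ∧ T.card = t := by
  obtain ⟨T, hT⟩ := exists_fullIT_of_injOn (fun v hv w hw hvw => h.1 hv hw hvw.ne hvw) h.2.1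
  exact ⟨T, hT, by rw [hT.card_eq, h.2.2]⟩

section Main

variable {h d k r : ℕ}

theorem isGreatest_partSizes (hr : r = (2 * h + 1) * (d + 1) + k) (hk : k ≤ d)
    (hh : 3 * (d + k + 1) ≤ h) (Δ : ℕ) :
    IsGreatest (partSizes r (d + 1) Δ) ((2 * Δ * h - Δ) / h) := by
  have hh0 : 0 < h := by omega
  have hle : Δ ≤ 2 * Δ * h := by nlinarith
  have hiff : ∀ n, n ≤ (2 * Δ * h - Δ) / h ↔ n * h + Δ ≤ 2 * Δ * h := by
    intro n
    rw [Nat.le_div_iff_mul_le hh0]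
    omega
  have hrd : r + 1 - (d + 1) = r - d := by omega
  constructor
  · obtain ⟨V, _, G, c, hproper, hsize, hdeg, hex, hno⟩ :=
      exists_extremal hh0 hr ((hiff _).1 le_rfl)
    refine ⟨V, inferInstance, G, SimpleGraph.Coloring.mk c (fun {v w} => hproper v w), ?_, ?_, ?_⟩
    · intro i
      rw [ncard_colorClass]
      exact hsize i
    · apply le_antisymm
      · exact SimpleGraph.maxDegree_le_of_forall_degree_le _ _ fun v => by
          rw [degree_eq_card]; exact hdeg v
      · rcases Nat.eq_zero_or_pos Δ with rfl | hΔ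
        · exact Nat.zero_le _
        · obtain ⟨v, hv⟩ := hex hΔ
          rw [← hv, ← degree_eq_card]
          exact SimpleGraph.degree_le_maxDegree _ _
    · rintro ⟨S, hS⟩
      obtain ⟨T, hT, hTc⟩ := hS.fullIT
      have h1 := hno _ _ hT
      omega
  · rintro n ⟨V, _, G, c, hsize, hmax, hno⟩
    rw [hiff]
    by_contra hlt
    push Not at hlt
    refine Counter.false (G := G) (c := c) (n := n) (Δ := Δ) (h := h) (d := d) (k := k)
      ⟨fun v => ?_, fun p => ?_, fun v w hvw => c.valid hvw, hlt, by rw [Fintype.card_fin, hr], hk,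
        hh, fun T M hM => ?_⟩
    · rw [← degree_eq_card, ← hmax]
      exact SimpleGraph.degree_le_maxDegree _ _
    · have h1 := hsize p
      rw [ncard_colorClass] at h1
      convert h1
    · rw [Fintype.card_fin]
      by_contra hT
      exact hno (hrd ▸ exists_isIT c hM (by omega))

/-- Here `D` is the least maximum degree for which parts of size `n` are admissible. Within the
complete multipartite graph the degrees of a graph and its complement add up to `(r - 1) n`. -/
theorem isGreatest_minDegrees (hr : r = (2 * h + 1) * (d + 1) + k) (hk : k ≤ d)
    (hh : 3 * (d + k + 1) ≤ h) {n D : ℕ} (hD : ∀ Δ, D ≤ Δ ↔ n * h + Δ ≤ 2 * Δ * h) :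
    IsGreatest (minDegrees n r (r - d)) ((r - 1) * n - D) := by
  have hh0 : 0 < h := by omega
  have hdr : d + 2 ≤ r := by rw [hr]; nlinarith
  have hrn : (r - 1) * n + n = r * n := by
    obtain ⟨s, rfl⟩ : ∃ s, r = s + 1 := ⟨r - 1, by omega⟩
    simp only [Nat.add_sub_cancel]
    ring
  have upper : ∀ δ ∈ minDegrees n r (r - d), δ ≤ (r - 1) * n - D := by
    rintro δ ⟨V, _, G, c, hsize, hfree, rfl⟩
    have hsize' : ∀ p, (univ.filter (fun v => c v = p)).card = n := fun p => by
      rw [← ncard_colorClass]; exact hsize p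
    -- Without vertices the minimum degree is zero by convention, so the degree identity is needed
    -- only when there is a vertex.
    rcases isEmpty_or_nonempty V with hV | hV
    · rw [SimpleGraph.minDegree_of_subsingleton]
      exact Nat.zero_le _
    have hsum : ∀ v, (univ.filter ((multiCompl G c).Adj v)).card + (univ.filter (G.Adj v)).card =
        (r - 1) * n := by
      intro v
      have h1 := card_multiCompl (n := n) (fun v w hvw => c.valid hvw)
        (fun p => by convert hsize' p) v
      rw [Fintype.card_fin, ← hrn] at h1
      exact Nat.add_right_cancel h1
    have hdeg : ∀ v, (univ.filter ((multiCompl G c).Adj v)).card ≤ (r - 1) * n - G.minDegree := by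
      intro v
      have h1 := hsum v
      have h2 := G.minDegree_le_degree v
      rw [degree_eq_card] at h2
      omega
    have hδ : G.minDegree ≤ (r - 1) * n := by
      obtain ⟨v⟩ := hV
      have h1 := hsum v
      have h2 := G.minDegree_le_degree v
      rw [degree_eq_card] at h2
      omega
    have h3 : D ≤ (r - 1) * n - G.minDegree := by
      rw [hD]
      by_contra hlt
      push Not at hlt
      refine Counter.false (G := multiCompl G c) (c := c) (n := n) (h := h) (d := d) (k := k)
        ⟨hdeg, fun p => le_of_eq (by convert (hsize' p).symm), fun v w hvw => hvw.1, hlt, by rw [Fintype.card_fin, hr], hk,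
          hh, fun T M hM => ?_⟩
      rw [Fintype.card_fin]
      by_contra hT
      exact (hfree.mono (by omega : r - d ≤ T.card)) M hM.isNClique
    omega
  refine ⟨?_, upper⟩
  obtain ⟨V, _, G, c, hproper, hsize, hdeg, _, hno⟩ :=
    exists_extremal hh0 hr ((hD D).1 le_rfl)
  obtain ⟨A, hA⟩ := exists_exact (n := n) (fun p => by convert hsize p)
  set G' := G.comap (Subtype.val : {v // v ∈ A} → V) with hG'
  set c' : {v // v ∈ A} → Fin r := fun v => c v.1 with hc'
  let col : (multiCompl G' c').Coloring (Fin r) :=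
    SimpleGraph.Coloring.mk c' (fun {v w} hvw => hvw.1)
  have hcol : ∀ i, (col.colorClass i).ncard = n := fun i => by
    rw [ncard_colorClass]
    convert hA i
    rfl
  have hfree : (multiCompl G' c').CliqueFree (r - d) := by
    intro M hM
    obtain ⟨T, h1, h2⟩ := fullIT_of_isNClique hM
    have h3 := hno _ _ h1.of_comap
    omega
  have hmem : (multiCompl G' c').minDegree ∈ minDegrees n r (r - d) :=
    ⟨_, inferInstance, multiCompl G' c', col, hcol, hfree, rfl⟩
  have hle := upper _ hmem
  have hge : (r - 1) * n - D ≤ (multiCompl G' c').minDegree := by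
    rcases Nat.eq_zero_or_pos n with rfl | hn
    · simp
    have hne : Nonempty {v // v ∈ A} := by
      have h1 := hA ⟨0, by omega⟩
      obtain ⟨v, _⟩ := card_pos.1 (h1 ▸ hn)
      exact ⟨v⟩
    apply SimpleGraph.le_minDegree_of_forall_le_degree
    intro v
    rw [degree_eq_card]
    have h1 := card_multiCompl (G := G') (c := c') (fun v w hvw => hproper v.1 w.1 hvw) hA v
    have h2 := Nat.le_trans (card_comap_le A v) (hdeg v.1)
    rw [Fintype.card_fin, ← hrn] at h1
    exact Nat.sub_le_of_le_add ((Nat.add_right_cancel h1).symm.le.trans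
      (Nat.add_le_add_left (le_trans (le_of_eq (by congr!)) h2) _))
  rw [le_antisymm hge hle]
  exact hmem

end Main
end PartialIT

theorem corollary1p6 (r d q k : ℕ) (hr : r = q * (d + 1) + k) (hk : k ≤ d)
    (hodd : Odd q) (hq : 6 * d + 6 * k + 7 ≤ q) :
    (∀ Δ : ℕ,
      IsGreatest (PartialIT.partSizes r (d + 1) Δ) (PartialIT.nMax r (d + 1) Δ) ∧
      (PartialIT.nMax r (d + 1) Δ : ℤ) = ⌊2 * (Δ : ℝ) * (1 - 1 / ((q : ℝ) - 1))⌋) ∧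
    (∀ n : ℕ,
      IsGreatest (PartialIT.minDegrees n r (r - d)) (PartialIT.fMax n r (r - d)) ∧
      (PartialIT.fMax n r (r - d) : ℤ) =
        ((r : ℤ) - 1) * n - ⌈(((q : ℝ) - 1) * n) / (2 * ((q : ℝ) - 2))⌉) := by
  obtain ⟨h, rfl⟩ := hodd
  have hh : 3 * (d + k + 1) ≤ h := by omega
  have hhR : (3 : ℝ) ≤ h := by exact_mod_cast (by omega : 3 ≤ h)
  constructor
  · intro Δ
    have hg := PartialIT.isGreatest_partSizes hr hk hh Δ
    have hN : PartialIT.nMax r (d + 1) Δ = (2 * Δ * h - Δ) / h := hg.csSup_eq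
    rw [hN]
    refine ⟨hg, ?_⟩
    have hle : Δ ≤ 2 * Δ * h := by nlinarith
    have hx : 2 * (Δ : ℝ) * (1 - 1 / (((2 * h + 1 : ℕ) : ℝ) - 1)) =
        ((2 * Δ * h - Δ : ℕ) : ℝ) / (h : ℝ) := by
      rw [Nat.cast_sub hle]
      push_cast
      rw [add_sub_cancel_right]
      field_simp
    rw [hx, ← Int.natCast_floor_eq_floor (by positivity), Nat.floor_div_eq_div]
  · intro n
    set x : ℝ := (((2 * h + 1 : ℕ) : ℝ) - 1) * n / (2 * (((2 * h + 1 : ℕ) : ℝ) - 2)) with hx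
    have hx' : x = (h : ℝ) * n / (2 * h - 1) := by
      rw [hx]
      push_cast
      have : (2 * (h : ℝ) - 1) ≠ 0 := by linarith
      rw [show (2 * (h : ℝ) + 1 - 1) * n = 2 * (h * n) by ring,
        show 2 * (2 * (h : ℝ) + 1 - 2) = 2 * (2 * h - 1) by ring, mul_div_mul_left _ _ two_ne_zero]
    have hx0 : 0 ≤ x := by
      rw [hx']
      apply div_nonneg (by positivity)
      linarith
    -- Solving the threshold for `Δ` gives `Δ ≥ h n / (2h - 1)`, and the right-hand side is `x`.
    have hD : ∀ Δ, ⌈x⌉₊ ≤ Δ ↔ n * h + Δ ≤ 2 * Δ * h := by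
      intro Δ
      rw [Nat.ceil_le, hx', div_le_iff₀ (by linarith), ← Nat.cast_le (α := ℝ)]
      push_cast
      constructor <;> intro _ <;> linarith
    have hg := PartialIT.isGreatest_minDegrees hr hk hh hD
    have hN : PartialIT.fMax n r (r - d) = (r - 1) * n - ⌈x⌉₊ := hg.csSup_eq
    rw [hN]
    refine ⟨hg, ?_⟩
    have hDn : ⌈x⌉₊ ≤ n := by
      rw [hD]
      nlinarith
    have hr2 : 2 ≤ r := by rw [hr]; nlinarith
    have hle : ⌈x⌉₊ ≤ (r - 1) * n := hDn.trans (Nat.le_mul_of_pos_left _ (by omega))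
    rw [Nat.cast_sub hle, Nat.cast_mul, Nat.cast_sub (by omega), Int.natCast_ceil_eq_ceil hx0]
    simp
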